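/- **Setting.** Let $(\Omega,\mathcal G,P)$ be a probability space, $\mathbb F=(\mathcal F_t)_{t\ge 0}$ a filtration, $\mathcal F_\infty=\bigvee_{t}\mathcal F_t$, and $n\ge 1$. For each policy $i=1,\dots,n$ let $\tau^i_0$ be a random time in $[0,\infty]$ with $\tau^i_0>0$ a.s. (accident time), $\theta^i\in[0,\infty)$ a random delay, $X^i_1\in[0,\infty)$ an integrable random variable, and $(\tilde\tau^i_j,\tilde X^i_j)_{j\ge1}$ random variables in $[0,\infty]\times[0,\infty)$ with, a.s., $0<\tilde\tau^i_1\le\tilde\tau^i_2\le\cdots$, $\tilde\tau^i_j<\tilde\tau^i_{j+1}$ whenever $\tilde\tau^i_j<\infty$, $\tilde\tau^i_j\to\infty$, and $E[\sum_j 1_{\{\tilde\tau^i_j\le t\}}\tilde X^i_j]<\infty$ for all $t\ge0$. Put $\tau^i_1=\tau^i_0+\theta^i$ with mark $\Theta^i_1=(\theta^i,X^i_1)$ and $\tau^i_{j+1}=\tau^i_1+\tilde\tau^i_j$, $X^i_{j+1}=\tilde X^i_j$ with mark $\Theta^i_{j+1}=(0,X^i_{j+1})$ for $j\ge1$. Let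 $$N^i(t,B)=\sum_j 1_{\{\tau^i_j\le t\}}1_{\{\Theta^i_j\in B\}},\qquad \tilde N^i(t,B)=\sum_j 1_{\{\tilde\tau^i_j\le t\}}1_{\{\tilde X^i_j\in B\}},$$ let $\mathcal H^i_t=\sigma(N^i(s,B):s\le t,B)$ and $\tilde{\mathcal H}^i_t=\sigma(\tilde N^i(s,B):s\le t,B)$, where $B$ runs through the Borel sets, let $\mathcal H^{i,1}_\infty=\sigma(1_{\{\tau^i_1\le s\}}1_{\{(\theta^i,X^i_1)\in B\}}:s\ge0,B)$, and $\mathcal G_t=\mathcal F_t\vee\mathcal H^1_t\vee\dots\vee\mathcal H^n_t$. Assume: 1. The $\theta^i$ have a common distribution function $G(x)=\alpha_0+\int_0^x g(y)\,dy$, $x\ge0$, with $g\ge0$ measurable and integrable on $(0,\infty)$; the sequences $(\tilde\tau^i_j,\tilde X^i_j)_j$ have the same law for all $i$. 2. The $X^i_1$ are mutually independent and (jointly) independent of $\mathcal F_\infty\vee\sigma(\tau^k_0:k\le n)$; the $\theta^i$ are mutually independent and (jointly) independent of $\mathcal F_\infty\vee\sigma(\tau^k_0,X^k_1:k\le n)$;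 the sequences $(\tilde\tau^i_j,\tilde X^i_j)_j$ are mutually independent and (jointly) independent of $\mathcal F_\infty\vee\sigma(\tau^k_1,\theta^k,X^k_1:k\le n)$. 3. $P(\tau^i_0>s\mid\mathcal F_t)=P(\tau^i_0>s\mid\mathcal F_s)$ for $t\in[0,\infty]$ and finite $s\le t$, and the $\tau^i_0$ are mutually $\mathbb F$-conditionally independent: $P(\tau^1_0>r_1,\dots,\tau^n_0>r_n\mid\mathcal F_t)=\prod_i P(\tau^i_0>r_i\mid\mathcal F_t)$ for $t\in[0,\infty]$ and finite $r_1,\dots,r_n\le t$. 4. There is an $\mathbb F$-progressively measurable, locally integrable process $\mu$ with $e^{-\int_0^t\mu_s\,ds}=1-P(\tau^i_0\le t\mid\mathcal F_t)$ a.s. for all $t\ge0$ and all $i$. Let $\tilde m(t)=E[\sum_j1_{\{\tilde\tau^i_j\le t\}}\tilde X^i_j]$ for $t\ge0$ and $\tilde m(t)=0$ for $t<0$; this is nondecreasing and right-continuous and does not depend on $i$. **Theorem.** Let $0\le t\le T<\infty$, let $Z=(Z_u)_{u\in[0,T]}$ be continuous, bounded and $\mathbb F$-adapted, fix $i$, and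 put $Y=\sum_{j\ge1}1_{\{t<\tau^i_j\le T\}}X^i_jZ_{\tau^i_j}$. Assume that $S_u=\sum_j1_{\{\tilde\tau^i_j\le u\}}\tilde X^i_j$, $u\in[0,T]$, has independent increments with respect to $(\tilde{\mathcal H}^i_u)$, that is, $S_u-S_s$ is independent of $\tilde{\mathcal H}^i_s$ for $0\le s\le u\le T$. Then $Y$ is integrable and, a.s., $$E[Y\mid\mathcal G_t]=1_{\{\tau^i_1\le t\}}\,E\Big[\int_{(t,T]}Z_u\,d\tilde m(u-x)\,\Big|\,\mathcal H^{i,1}_\infty\vee\tilde{\mathcal H}^i_{t-x}\vee\mathcal F_t\Big]\Big|_{x=\tau^i_1}$$ $$\qquad+\,1_{\{\tau^i_1>t\}}\,\frac{E\big[\int_{(t,T]}\big(E[X^i_1]Z_u+\int_{(u,T]}Z_v\,d\tilde m(v-u)\big)\,dP(\tau^i_1\le u\mid\mathcal F_u)\,\big|\,\mathcal F_t\big]}{P(\tau^i_1>t\mid\mathcal F_t)},$$ where the integrals under the conditional expectations are integrable random variables, and for every $s\ge0$, a.s., $$P(\tau^i_1\le s\mid\mathcal F_s)=\int_0^s\Big(\alpha_0e^{-\int_0^u\mu_v\,dv}\mu_u+\int_0^ug(u-v)e^{-\int_0^v\mu_r\,dr}\mu_v\,dv\Big)du.$$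 Here the conditional expectations indexed by $x\in[0,t]$ are taken in a version with a.s. left-continuous paths in $x$; such versions exist, and the formula holds for each of them. The process $u\mapsto P(\tau^i_1\le u\mid\mathcal F_u)$, which is used as integrator, is taken in a version with nondecreasing right-continuous paths; such versions exist (one of them is, a.s. for all $s\geq 0$, given by the last displayed formula), and the formula for $E[Y\mid\mathcal G_t]$ holds for each of them. -/

import Mathlib

open MeasureTheory ProbabilityTheory Filter Topology Set
open scoped NNReal ENNReal

noncomputable section

namespace Insurance

/-! ### Marked point processes

The points `τ 0, τ 1, …` (with values in `[0, ∞]`; the value `∞` stands for an event which never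
happens) carry the marks `ξ 0, ξ 1, …`. Numbering starts at `0`. -/

section MarkedPointProcess

variable {Ω E : Type*}

/-- The marked cumulative process `N(t, B) = ∑ⱼ 1{τⱼ ≤ t} 1{ξⱼ ∈ B}`. -/
def markedCount (τ : ℕ → Ω → ℝ≥0∞) (ξ : ℕ → Ω → E) (t : ℝ≥0) (B : Set E) (ω : Ω) : ℝ≥0∞ :=
  ∑' j, {ω' | τ j ω' ≤ t ∧ ξ j ω' ∈ B}.indicator (fun _ => (1 : ℝ≥0∞)) ω

/-- The natural filtration of the marked cumulative process, at time `t`: the σ-algebra generated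
by `N(s, B)`, for `0 ≤ s ≤ t` and `B` measurable. -/
def naturalSigma [MeasurableSpace E] (τ : ℕ → Ω → ℝ≥0∞) (ξ : ℕ → Ω → E) (t : ℝ≥0) :
    MeasurableSpace Ω :=
  ⨆ (s : ℝ≥0) (_ : s ≤ t) (B : Set E) (_ : MeasurableSet B),
    MeasurableSpace.comap (markedCount τ ξ s B) inferInstance

/-- The σ-algebra generated by the variables `1{τ ≤ s} 1{ξ ∈ B}`, for `0 ≤ s ≤ t` and `B`
measurable: the information up to time `t` about a single random time `τ` with mark `ξ`. -/
def eventSigma [MeasurableSpace E] (τ : Ω → ℝ≥0∞) (ξ : Ω → E) (t : ℝ≥0) : MeasurableSpace Ω :=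
  MeasurableSpace.generateFrom
    {A | ∃ s ≤ t, ∃ B : Set E, MeasurableSet B ∧ A = {ω | τ ω ≤ (s : ℝ≥0∞) ∧ ξ ω ∈ B}}

end MarkedPointProcess

/-- The random variables describing a portfolio of `n` insurance policies. -/
structure Portfolio (Ω : Type*) (n : ℕ) where
  /-- accident times -/
  accident : Fin n → Ω → ℝ≥0∞
  /-- reporting delays -/
  delay : Fin n → Ω → ℝ≥0
  /-- impact size of the accident, reported at the first reporting time -/
  firstMark : Fin n → Ω → ℝ≥0
  /-- times of the updates, counted from the first reporting time -/
  devTime : Fin n → ℕ → Ω → ℝ≥0∞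
  /-- sizes of the updates -/
  devMark : Fin n → ℕ → Ω → ℝ≥0

namespace Portfolio

variable {Ω : Type*} {n : ℕ} (c : Portfolio Ω n) (i : Fin n)

/-- The first reporting time: accident time plus delay. -/
def firstReport (ω : Ω) : ℝ≥0∞ := c.accident i ω + c.delay i ω

/-- The reporting times of the `i`-th policy; index `0` is the first reporting, and index `j + 1`
the `j`-th update. -/
def reportTime : ℕ → Ω → ℝ≥0∞
  | 0, ω => c.firstReport i ω
  | j + 1, ω => c.firstReport i ω + c.devTime i j ω

/-- The amounts `X` reported at the reporting times. -/
def amount : ℕ → Ω → ℝ≥0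
  | 0, ω => c.firstMark i ω
  | j + 1, ω => c.devMark i j ω

/-- The two-dimensional marks: (reporting delay, amount). -/
def mark : ℕ → Ω → ℝ≥0 × ℝ≥0
  | 0, ω => (c.delay i ω, c.amount i 0 ω)
  | j + 1, ω => (0, c.amount i (j + 1) ω)

/-- `𝓗ⁱ_t`: information generated by the claim movements of the `i`-th policy. -/
def sigmaPolicy (t : ℝ≥0) : MeasurableSpace Ω := naturalSigma (c.reportTime i) (c.mark i) t

/-- `𝓗_t`: the internal information of the insurance company. -/
def sigmaInternal (t : ℝ≥0) : MeasurableSpace Ω := ⨆ k, c.sigmaPolicy k t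

/-- `𝓗^{i,1}_∞`: full information about the first reporting. -/
def sigmaFirst : MeasurableSpace Ω :=
  ⨆ t : ℝ≥0, eventSigma (c.reportTime i 0) (c.mark i 0) t

/-- `𝓗̃ⁱ_t`: natural filtration of the development process. -/
def sigmaDev (t : ℝ≥0) : MeasurableSpace Ω := naturalSigma (c.devTime i) (c.devMark i) t

/-- The development process as a random element of the space of sequences. -/
def development (ω : Ω) : ℕ → ℝ≥0∞ × ℝ≥0 := fun j => (c.devTime i j ω, c.devMark i j ω)

/-- The total size of the updates up to time `t` after the first reporting, in `[0, ∞]`. -/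
def devTotalENN (t : ℝ≥0) (ω : Ω) : ℝ≥0∞ :=
  ∑' j, {ω' | c.devTime i j ω' ≤ t}.indicator (fun ω' => (c.devMark i j ω' : ℝ≥0∞)) ω

/-- The compound process of the updates. -/
def devTotal (t : ℝ≥0) (ω : Ω) : ℝ := (c.devTotalENN i t ω).toReal

theorem devTotalENN_mono {s t : ℝ≥0} (hst : s ≤ t) (ω : Ω) :
    c.devTotalENN i s ω ≤ c.devTotalENN i t ω := by
  refine ENNReal.tsum_le_tsum fun j => ?_
  refine indicator_le_indicator_of_subset (fun ω' hω' => ?_) (fun _ => zero_le) ω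
  exact le_trans (α := ℝ≥0∞) hω' (by exact_mod_cast hst)

theorem devTotalENN_tendsto (t : ℝ≥0) (ω : Ω)
    (hω : c.devTotalENN i (t + 1) ω < ∞) :
    Tendsto (fun s => c.devTotalENN i s ω) (𝓝[≥] t) (𝓝 (c.devTotalENN i t ω)) := by
  simp only [Portfolio.devTotalENN, ← lintegral_count] at hω ⊢
  refine tendsto_lintegral_filter_of_dominated_convergence _
    (Eventually.of_forall fun _ => measurable_of_countable _) ?_ hω.ne ?_
  · have : ∀ᶠ s in 𝓝[≥] t, s ≤ t + 1 :=
      nhdsWithin_le_nhds (Iic_mem_nhds (lt_add_of_pos_right t one_pos))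
    filter_upwards [this] with s hs
    refine Eventually.of_forall fun j => ?_
    refine indicator_le_indicator_of_subset (fun ω' hω' => ?_) (fun _ => zero_le) ω
    exact le_trans (α := ℝ≥0∞) hω' (by exact_mod_cast hs)
  · refine Eventually.of_forall fun j => ?_
    refine tendsto_const_nhds.congr' ?_
    by_cases hj : c.devTime i j ω ≤ t
    · filter_upwards [self_mem_nhdsWithin] with s hs
      have hs' : c.devTime i j ω ≤ s := hj.trans (by exact_mod_cast hs)
      rw [indicator_of_mem (by exact hj), indicator_of_mem (by exact hs')]
    · have : ∀ᶠ s : ℝ≥0 in 𝓝[≥] t, (s : ℝ≥0∞) < c.devTime i j ω :=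
        nhdsWithin_le_nhds (ENNReal.continuous_coe.continuousAt.eventually_lt
          continuousAt_const (not_le.1 hj))
      filter_upwards [this] with s hs
      rw [indicator_of_notMem (by exact hj), indicator_of_notMem (by exact not_le.2 hs)]

variable [mΩ : MeasurableSpace Ω]

/-- The function `m̃`: the expectation of the compound process of the updates at nonnegative
times, and `0` at negative times. -/
def meanDev (P : Measure Ω) (r : ℝ) : ℝ := if 0 ≤ r then ∫ ω, c.devTotal i r.toNNReal ω ∂P else 0

/-- `∑ⱼ 1{t < τⱼ ≤ T} Xⱼ Z_{τⱼ}`. -/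
def futurePayments (t T : ℝ≥0) (Z : ℝ≥0 → Ω → ℝ) (ω : Ω) : ℝ :=
  ∑' j, {ω' | (t : ℝ≥0∞) < c.reportTime i j ω' ∧ c.reportTime i j ω' ≤ T}.indicator
    (fun ω' => (c.amount i j ω' : ℝ) * Z (c.reportTime i j ω').toNNReal ω') ω

end Portfolio

variable {Ω : Type*} [mΩ : MeasurableSpace Ω] {n : ℕ}

/-- `𝓕_t` for `t ∈ [0, ∞]`, where `𝓕_∞` is generated by all `𝓕_s`, `s < ∞`. -/
def sigmaAt (F : Filtration ℝ≥0 mΩ) (t : ℝ≥0∞) : MeasurableSpace Ω :=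
  ⨆ (s : ℝ≥0) (_ : (s : ℝ≥0∞) ≤ t), F s

/-- `𝓖_t = 𝓕_t ∨ 𝓗_t`. -/
def sigmaGlobal (F : Filtration ℝ≥0 mΩ) (c : Portfolio Ω n) (t : ℝ≥0) : MeasurableSpace Ω :=
  F t ⊔ c.sigmaInternal t

/-- The hazard process `Γ_t = ∫₀ᵗ μ_s ds`. -/
def hazard (μ : ℝ≥0 → Ω → ℝ) (t : ℝ) (ω : Ω) : ℝ := ∫ s in (0 : ℝ)..t, μ s.toNNReal ω

/-- The standing assumptions on the portfolio: `P` is the probability measure, `F` the reference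
filtration, `μ` the common intensity process of the accident times, and `α₀`, `g` describe the
common law of the delays. -/
structure IsModel (P : Measure Ω) (F : Filtration ℝ≥0 mΩ) (c : Portfolio Ω n)
    (μ : ℝ≥0 → Ω → ℝ) (α₀ : ℝ) (g : ℝ → ℝ) : Prop where
  /- measurability -/
  measurable_accident : ∀ i, Measurable (c.accident i)
  measurable_delay : ∀ i, Measurable (c.delay i)
  measurable_firstMark : ∀ i, Measurable (c.firstMark i)
  measurable_devTime : ∀ i j, Measurable (c.devTime i j)
  measurable_devMark : ∀ i j, Measurable (c.devMark i j)
  /- accident times are positive -/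
  accident_pos : ∀ i, ∀ᵐ ω ∂P, 0 < c.accident i ω
  /- the reporting times of a policy are strictly ordered as long as they are finite, and tend to
  infinity -/
  devTime_pos : ∀ i, ∀ᵐ ω ∂P, 0 < c.devTime i 0 ω
  devTime_lt : ∀ i, ∀ᵐ ω ∂P, ∀ j, c.devTime i j ω ≤ c.devTime i (j + 1) ω ∧
    (c.devTime i j ω < ∞ → c.devTime i j ω < c.devTime i (j + 1) ω)
  devTime_tendsto : ∀ i, ∀ᵐ ω ∂P, Tendsto (fun j => c.devTime i j ω) atTop (𝓝 ∞)
  /- the total size of the updates up to a finite time has finite expectation -/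
  devTotal_finite : ∀ i, ∀ t : ℝ≥0, ∫⁻ ω, c.devTotalENN i t ω ∂P < ∞
  /- the first marks have finite expectation -/
  integrable_firstMark : ∀ i, Integrable (fun ω => (c.firstMark i ω : ℝ)) P
  /- homogeneous delay, with an atom at `0` and a density on `(0, ∞)` -/
  g_measurable : Measurable g
  g_nonneg : ∀ x, 0 < x → 0 ≤ g x
  g_integrable : IntegrableOn g (Ioi 0)
  delay_law : ∀ i, ∀ x : ℝ≥0,
    P.real {ω | c.delay i ω ≤ x} = α₀ + ∫ y in (0 : ℝ)..x, g y
  /- homogeneous development -/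
  development_law : ∀ i k, IdentDistrib (c.development i) (c.development k) P P
  /- independent first marks -/
  firstMark_iIndep : iIndepFun c.firstMark P
  firstMark_indep :
    Indep (⨆ i, MeasurableSpace.comap (c.firstMark i) inferInstance)
      (sigmaAt F ∞ ⊔ ⨆ i, MeasurableSpace.comap (c.accident i) inferInstance) P
  /- independent delays -/
  delay_iIndep : iIndepFun c.delay P
  delay_indep :
    Indep (⨆ i, MeasurableSpace.comap (c.delay i) inferInstance)
      (sigmaAt F ∞ ⊔
        ⨆ i, MeasurableSpace.comap (fun ω => (c.accident i ω, c.firstMark i ω)) inferInstance) P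
  /- independent developments -/
  development_iIndep : iIndepFun c.development P
  development_indep :
    Indep (⨆ i, MeasurableSpace.comap (c.development i) inferInstance)
      (sigmaAt F ∞ ⊔ ⨆ i, MeasurableSpace.comap
        (fun ω => (c.firstReport i ω, c.delay i ω, c.firstMark i ω)) inferInstance) P
  /- information about accidents up to time `s` depends on `𝓕` only through `𝓕_s` -/
  accident_condExp : ∀ i, ∀ t : ℝ≥0∞, ∀ s : ℝ≥0, (s : ℝ≥0∞) ≤ t →
    P⟦{ω | (s : ℝ≥0∞) < c.accident i ω} | sigmaAt F t⟧
      =ᵐ[P] P⟦{ω | (s : ℝ≥0∞) < c.accident i ω} | F s⟧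
  /- the accident times are `𝓕`-conditionally independent -/
  accident_condIndep : ∀ t : ℝ≥0∞, ∀ r : Fin n → ℝ≥0, (∀ i, (r i : ℝ≥0∞) ≤ t) →
    P⟦⋂ i, {ω | (r i : ℝ≥0∞) < c.accident i ω} | sigmaAt F t⟧
      =ᵐ[P] fun ω => ∏ i, (P⟦{ω' | (r i : ℝ≥0∞) < c.accident i ω'} | sigmaAt F t⟧) ω
  /- `μ` is the intensity process of all accident times -/
  progressive_intensity : IsProgressive F μ
  locallyIntegrable_intensity : ∀ᵐ ω ∂P, ∀ t : ℝ, 0 ≤ t →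
    IntervalIntegrable (fun s : ℝ => μ s.toNNReal ω) volume 0 t
  exp_neg_hazard : ∀ i, ∀ t : ℝ≥0,
    (fun ω => Real.exp (-hazard μ t ω))
      =ᵐ[P] fun ω => 1 - (P⟦{ω' | c.accident i ω' ≤ t} | F t⟧) ω

/-- On `[0, T]`, the compound process of the updates of the `i`-th policy has independent increments
with respect to the natural filtration of the development process. -/
def HasIndepDevIncrements (P : Measure Ω) (c : Portfolio Ω n) (i : Fin n) (T : ℝ≥0) : Prop :=
  ∀ s u : ℝ≥0, s ≤ u → u ≤ T →
    Indep (MeasurableSpace.comap (fun ω => c.devTotal i u ω - c.devTotal i s ω) inferInstance)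
      (c.sigmaDev i s) P

namespace IsModel

variable {P : Measure Ω} {F : Filtration ℝ≥0 mΩ} {c : Portfolio Ω n} {μ : ℝ≥0 → Ω → ℝ} {α₀ : ℝ}
  {g : ℝ → ℝ}

theorem measurable_devTotalENN (h : IsModel P F c μ α₀ g) (i : Fin n) (t : ℝ≥0) :
    Measurable (c.devTotalENN i t) := by
  refine Measurable.tsum fun j => ?_
  exact ((h.measurable_devMark i j).coe_nnreal_ennreal).indicator
    (measurableSet_le (h.measurable_devTime i j) measurable_const)

theorem meanDev_of_nonneg (h : IsModel P F c μ α₀ g) (i : Fin n) {r : ℝ} (hr : 0 ≤ r) :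
    c.meanDev i P r = (∫⁻ ω, c.devTotalENN i r.toNNReal ω ∂P).toReal := by
  rw [Portfolio.meanDev, if_pos hr]
  exact integral_toReal (h.measurable_devTotalENN i _).aemeasurable
    (ae_lt_top (h.measurable_devTotalENN i _) (h.devTotal_finite i _).ne)

theorem meanDev_mono (h : IsModel P F c μ α₀ g) (i : Fin n) : Monotone (c.meanDev i P) := by
  intro r s hrs
  by_cases hr : 0 ≤ r
  · rw [h.meanDev_of_nonneg i hr, h.meanDev_of_nonneg i (hr.trans hrs)]
    exact ENNReal.toReal_mono (h.devTotal_finite i _).ne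
      (lintegral_mono fun ω => c.devTotalENN_mono i (Real.toNNReal_le_toNNReal hrs) ω)
  · rw [Portfolio.meanDev, if_neg hr]
    by_cases hs : 0 ≤ s
    · rw [h.meanDev_of_nonneg i hs]
      exact ENNReal.toReal_nonneg
    · rw [Portfolio.meanDev, if_neg hs]

theorem meanDev_right_continuous (h : IsModel P F c μ α₀ g) (i : Fin n) (r : ℝ) :
    ContinuousWithinAt (c.meanDev i P) (Ici r) r := by
  by_cases hr : 0 ≤ r
  · have key : Tendsto (fun s : ℝ≥0 => ∫⁻ ω, c.devTotalENN i s ω ∂P) (𝓝[≥] r.toNNReal)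
        (𝓝 (∫⁻ ω, c.devTotalENN i r.toNNReal ω ∂P)) := by
      refine tendsto_lintegral_filter_of_dominated_convergence
        (fun ω => c.devTotalENN i (r.toNNReal + 1) ω)
        (Eventually.of_forall fun s => h.measurable_devTotalENN i s) ?_
        (h.devTotal_finite i _).ne ?_
      · have : ∀ᶠ s in 𝓝[≥] r.toNNReal, s ≤ r.toNNReal + 1 :=
          nhdsWithin_le_nhds (Iic_mem_nhds (lt_add_of_pos_right _ one_pos))
        filter_upwards [this] with s hs
        exact Eventually.of_forall fun ω => c.devTotalENN_mono i hs ω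
      · filter_upwards [ae_lt_top (h.measurable_devTotalENN i (r.toNNReal + 1))
          (h.devTotal_finite i _).ne] with ω hω
        exact c.devTotalENN_tendsto i _ ω hω
    have hto : Tendsto Real.toNNReal (𝓝[≥] r) (𝓝[≥] r.toNNReal) :=
      tendsto_nhdsWithin_iff.2 ⟨continuous_real_toNNReal.continuousWithinAt,
        eventually_nhdsWithin_of_forall fun s hs => Real.toNNReal_le_toNNReal hs⟩
    have := (ENNReal.tendsto_toReal (h.devTotal_finite i r.toNNReal).ne).comp (key.comp hto)
    rw [ContinuousWithinAt, h.meanDev_of_nonneg i hr]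
    refine this.congr' ?_
    filter_upwards [self_mem_nhdsWithin] with s hs
    rw [h.meanDev_of_nonneg i (hr.trans hs)]
    rfl
  · refine ContinuousAt.continuousWithinAt ?_
    refine (continuousAt_const (y := (0 : ℝ))).congr ?_
    filter_upwards [Iio_mem_nhds (not_le.1 hr)] with s hs
    rw [Portfolio.meanDev, if_neg (not_le.2 hs)]

/-- The nondecreasing right-continuous function `u ↦ m̃(u - x)` on `[0, ∞)`. -/
def shiftedMeanDev (h : IsModel P F c μ α₀ g) (i : Fin n) (x : ℝ≥0) : StieltjesFunction ℝ≥0 where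
  toFun u := c.meanDev i P ((u : ℝ) - x)
  mono' u v huv := h.meanDev_mono i (sub_le_sub_right (by exact_mod_cast huv) _)
  right_continuous' u := by
    refine ContinuousWithinAt.comp (t := Ici ((u : ℝ) - x))
      (h.meanDev_right_continuous i ((u : ℝ) - x)) (f := fun u : ℝ≥0 => (u : ℝ) - x) ?_ ?_
    · exact (NNReal.continuous_coe.sub continuous_const).continuousWithinAt
    · intro v hv
      exact sub_le_sub_right (NNReal.coe_le_coe.2 hv) _

/-- The Lebesgue–Stieltjes integral `∫_{(t, T]} Z_u dm̃(u - x)`. -/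
def devIntegral (h : IsModel P F c μ α₀ g) (i : Fin n) (Z : ℝ≥0 → Ω → ℝ) (t T x : ℝ≥0) (ω : Ω) :
    ℝ :=
  ∫ u in Ioc t T, Z u ω ∂(h.shiftedMeanDev i x).measure

/-- The integral `∫_{(t, T]} (E[X₁] Z_u + ∫_{(u, T]} Z_v dm̃(v - u)) dA_u`, for a process `A` with
nondecreasing right-continuous paths. -/
def reportIntegral (h : IsModel P F c μ α₀ g) (i : Fin n) (Z : ℝ≥0 → Ω → ℝ)
    (A : Ω → StieltjesFunction ℝ≥0) (t T : ℝ≥0) (ω : Ω) : ℝ :=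
  ∫ u in Ioc t T, ((∫ ω', (c.firstMark i ω' : ℝ) ∂P) * Z u ω + h.devIntegral i Z u T u ω)
    ∂(A ω).measure

/-- The family `Φ x`, `x ∈ [0, t]`, is the version with left-continuous paths `x ↦ Φ x ω` of the
conditional expectations `E[∫_{(t, T]} Z_u dm̃(u - x) | 𝓗^{i,1}_∞ ∨ 𝓗̃ⁱ_{t - x} ∨ 𝓕_t]`. -/
structure IsDevVersion (h : IsModel P F c μ α₀ g) (i : Fin n) (Z : ℝ≥0 → Ω → ℝ) (t T : ℝ≥0)
    (Φ : ℝ≥0 → Ω → ℝ) : Prop where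
  condExp : ∀ x ≤ t,
    Φ x =ᵐ[P] P[h.devIntegral i Z t T x | c.sigmaFirst i ⊔ c.sigmaDev i (t - x) ⊔ F t]
  left_continuous : ∀ᵐ ω ∂P, ∀ x ≤ t, ContinuousWithinAt (fun y => Φ y ω) (Iic x) x

end IsModel

/-- `A` is the version of the process `P(τ₁ ≤ u | 𝓕_u)`, `u ≥ 0`, with nondecreasing
right-continuous paths. -/
def IsReportVersion (P : Measure Ω) (F : Filtration ℝ≥0 mΩ) (c : Portfolio Ω n) (i : Fin n)
    (A : Ω → StieltjesFunction ℝ≥0) : Prop :=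
  ∀ u : ℝ≥0, (fun ω => A ω u) =ᵐ[P] P⟦{ω | c.firstReport i ω ≤ u} | F u⟧

/-- `∫₀ˢ (α₀ e^{-Γ_u} μ_u + ∫₀ᵘ g(u - v) e^{-Γ_v} μ_v dv) du`. -/
def explicitReportProb (μ : ℝ≥0 → Ω → ℝ) (α₀ : ℝ) (g : ℝ → ℝ) (s : ℝ≥0) (ω : Ω) : ℝ :=
  ∫ u in (0 : ℝ)..s, (α₀ * Real.exp (-hazard μ u ω) * μ u.toNNReal ω
    + ∫ v in (0 : ℝ)..u, g (u - v) * Real.exp (-hazard μ v ω) * μ v.toNNReal ω)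

end Insurance

end

/-! Two reductions remove the conditioning that carries no information. Given `sigmaAt F ∞` the
accident times are conditionally independent, and the conditional probability of `{r < τ₀}` is
already `F r`-measurable. Delays, marks and developments are independent of the filtration and of
all accident times. Consequently the histories of the other policies may be dropped from the
conditioning (`condExp_sigmaGlobal_ae_eq`), and for a variable that depends on the filtration only,
everything known about the policies by time `t` may be dropped next to `F t`
(`condExp_sigmaLarge_ae_eq`).

On `{τ₁ > t}` the history of the policy is trivial, so the conditional expectation is an elementary
one: a quotient of two conditional expectations given `F t` (`condExp_sup_indicator_ae_eq`). Its
numerator is computed by integrating out independent ingredients (`setLIntegral_payment_late`). The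
development yields a Stieltjes integral against `m̃`, by a Campbell-type formula. The first mark
yields its mean. Finally `τ₁` is integrated against its conditional law `reportLaw` given `sigmaAt F
∞`. This law is the convolution of the accident density `exp (-Γ) μ` with the law of the delay,
which gives the explicit formula. Its distribution function at `u` is also the conditional
probability given `F u`, so every right-continuous version of that process induces the same
Stieltjes measure on `(t, T]` almost surely.

On `{τ₁ ≤ t}`, once the data of the first report are frozen at `τ₁ = x`, the history up to `t`
amounts to the development up to `t - x`. Independent increments then allow the later updates to be
replaced by their mean, the integral of `Z` against `m̃(· - x)` (`setLIntegral_devSum_firstReport`).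
This still involves future values of `Z`, hence the remaining conditional expectation `Φ x`. As `Φ
x` is determined only up to a null set for each `x`, the random time is inserted by approximating
`τ₁` from below by discrete times, for which the identity is exact, and by passing to the limit with
left-continuity (`condExp_floorApprox`, `condExp_early`).

A left-continuous `Φ` exists because the path of `Z` can be conditioned once, as a random element of
a space of continuous functions, after which the integrals for all `x` are continuous linear
functionals of the result (`exists_isDevVersion`). Computations are done with weights in `[0, ∞]`
and transferred to `Z` through its positive and negative parts. -/

noncomputable section

/-! ### Conditional expectations, π-systems and independence. -/

section
namespace Insurance

section Generic

variable {Ω : Type*} {m0 : MeasurableSpace Ω} {P : Measure Ω}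

theorem isPiSystem_inter {m : MeasurableSpace Ω} {C : Set (Set Ω)} (hC : IsPiSystem C) :
    IsPiSystem {S | ∃ A B, MeasurableSet[m] A ∧ B ∈ C ∧ S = A ∩ B} := by
  rintro _ ⟨A, B, hA, hB, rfl⟩ _ ⟨A', B', hA', hB', rfl⟩ hne
  refine ⟨A ∩ A', B ∩ B', hA.inter hA', hC _ hB _ hB' ?_, inter_inter_inter_comm _ _ _ _⟩
  exact hne.mono fun x hx => ⟨hx.1.2, hx.2.2⟩

theorem sup_generateFrom_eq {m : MeasurableSpace Ω} {C : Set (Set Ω)} (hC : univ ∈ C) :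
    m ⊔ MeasurableSpace.generateFrom C =
      MeasurableSpace.generateFrom {S | ∃ A B, MeasurableSet[m] A ∧ B ∈ C ∧ S = A ∩ B} := by
  apply le_antisymm
  · refine sup_le (fun A hA => ?_) (MeasurableSpace.generateFrom_le fun B hB => ?_)
    · exact MeasurableSpace.measurableSet_generateFrom ⟨A, univ, hA, hC, (inter_univ A).symm⟩
    · exact MeasurableSpace.measurableSet_generateFrom
        ⟨univ, B, MeasurableSet.univ, hB, (univ_inter B).symm⟩
  · refine MeasurableSpace.generateFrom_le ?_
    rintro _ ⟨A, B, hA, hB, rfl⟩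
    exact MeasurableSet.inter (le_sup_left (a := m) _ hA)
      (le_sup_right (a := m) _ (MeasurableSpace.measurableSet_generateFrom hB))

/-- Conditional expectations of integrable functions agree as soon as the integrals over the
sets of a generating π-system agree. -/
theorem condExp_ae_eq_of_isPiSystem [IsFiniteMeasure P] {m : MeasurableSpace Ω} (hm : m ≤ m0)
    {C : Set (Set Ω)} (hC : IsPiSystem C) (hgen : m = MeasurableSpace.generateFrom C)
    {f g : Ω → ℝ} (hf : Integrable f P) (hg : Integrable g P)
    (huniv : ∫ ω, f ω ∂P = ∫ ω, g ω ∂P) (h : ∀ A ∈ C, ∫ ω in A, f ω ∂P = ∫ ω in A, g ω ∂P) :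
    P[f | m] =ᵐ[P] P[g | m] := by
  refine ae_eq_condExp_of_forall_setIntegral_eq hm hg
    (fun s _ _ => integrable_condExp.integrableOn) (fun s hs _ => ?_)
    stronglyMeasurable_condExp.aestronglyMeasurable
  rw [setIntegral_condExp hm hf hs]
  -- The finiteness hypothesis mentions `s`; dropping it keeps it out of the induction hypotheses.
  rename_i hfin
  clear hfin
  induction s, hs using MeasurableSpace.induction_on_inter hgen hC with
  | empty => simp
  | basic A hA => exact h A hA
  | compl A hA ih => rw [setIntegral_compl (hm _ hA) hf, setIntegral_compl (hm _ hA) hg, ih, huniv]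
  | iUnion A hd hA ih =>
    rw [integral_iUnion (fun i => hm _ (hA i)) hd hf.integrableOn,
      integral_iUnion (fun i => hm _ (hA i)) hd hg.integrableOn]
    exact tsum_congr ih

/-- Tower property, applied to a conditional expectation given `m₃` that is already `m₁`-measurable
up to null sets. It allows a conditioning σ-algebra to be enlarged to one of convenient form and the
result to be read off for everything in between. -/
theorem condExp_ae_eq_of_le_of_le {m₁ m₂ m₃ : MeasurableSpace Ω} [IsFiniteMeasure P]
    (h₁₂ : m₁ ≤ m₂) (h₂₃ : m₂ ≤ m₃) (h₃ : m₃ ≤ m0) {f : Ω → ℝ}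
    (h : P[f | m₃] =ᵐ[P] P[f | m₁]) : P[f | m₂] =ᵐ[P] P[f | m₁] := by
  refine (condExp_condExp_of_le h₂₃ h₃).symm.trans ((condExp_congr_ae h).trans ?_)
  rw [condExp_of_stronglyMeasurable (h₂₃.trans h₃) (stronglyMeasurable_condExp.mono h₁₂)
    integrable_condExp]

/-- If the sets of a π-system have an `𝓐`-measurable conditional probability given `𝓑 ≥ 𝓐`, then
adding the π-system to `𝓐` does not change the conditional expectation of a `𝓑`-measurable random
variable. -/
theorem condExp_sup_generateFrom_ae_eq [IsFiniteMeasure P] {𝓐 𝓑 : MeasurableSpace Ω}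
    (hAB : 𝓐 ≤ 𝓑) (hB : 𝓑 ≤ m0) {C : Set (Set Ω)} (hC : IsPiSystem C)
    (hCm : ∀ O ∈ C, MeasurableSet[m0] O)
    (hq : ∀ O ∈ C, ∃ q : Ω → ℝ, StronglyMeasurable[𝓐] q ∧ P⟦O | 𝓑⟧ =ᵐ[P] q)
    {Y : Ω → ℝ} (hY : StronglyMeasurable[𝓑] Y) (hYi : Integrable Y P) :
    P[Y | 𝓐 ⊔ MeasurableSpace.generateFrom C] =ᵐ[P] P[Y | 𝓐] := by
  have hA := hAB.trans hB
  have hgen : MeasurableSpace.generateFrom C ≤ m0 := MeasurableSpace.generateFrom_le hCm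
  have key : ∀ A O, MeasurableSet[𝓐] A → O ∈ C →
      ∫ ω in A ∩ O, Y ω ∂P = ∫ ω in A ∩ O, (P[Y | 𝓐]) ω ∂P := by
    intro A O hAm hO
    obtain ⟨q, hqm, hqe⟩ := hq O hO
    have hqb : ∀ᵐ ω ∂P, ‖q ω‖ ≤ 1 := by
      have h1 : ∀ᵐ ω ∂P, |(O.indicator (fun _ => (1 : ℝ))) ω| ≤ (1 : ℝ) := by
        refine Eventually.of_forall fun ω => ?_
        by_cases h : ω ∈ O <;> simp [h]
      filter_upwards [ae_bdd_abs_condExp_of_ae_bdd_abs (m := 𝓑) h1, hqe] with ω h2 h3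
      rw [← h3]
      simpa using h2
    -- Conditioning on `𝓑` replaces the indicator of `O` by `q`. This is used for `Y` and for `P[Y |
    -- 𝓐]`; the two integrals agree because `q` is `𝓐`-measurable and can be pulled out.
    have step : ∀ V : Ω → ℝ, StronglyMeasurable[𝓑] V → Integrable V P →
        ∫ ω in A ∩ O, V ω ∂P = ∫ ω in A, V ω * q ω ∂P := by
      intro V hV hVi
      have hi : Integrable (V * O.indicator (fun _ => (1 : ℝ))) P := by
        have : V * O.indicator (fun _ => (1 : ℝ)) = O.indicator V := by
          ext ω
          by_cases h : ω ∈ O <;> simp [h]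
        rw [this]
        exact hVi.indicator (hCm O hO)
      have h1 := condExp_mul_of_stronglyMeasurable_left hV hi
        ((integrable_const (1 : ℝ)).indicator (hCm O hO))
      have h2 : ∫ ω in A ∩ O, V ω ∂P
          = ∫ ω in A, (V * O.indicator (fun _ => (1 : ℝ))) ω ∂P := by
        have : V * O.indicator (fun _ => (1 : ℝ)) = O.indicator V := by
          ext ω
          by_cases h : ω ∈ O <;> simp [h]
        rw [this, setIntegral_indicator (hCm O hO)]
      rw [h2, ← setIntegral_condExp hB hi (hAB _ hAm)]
      refine setIntegral_congr_ae (hA _ hAm) ?_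
      filter_upwards [h1, hqe] with ω h3 h4 _
      rw [h3, Pi.mul_apply, h4]
    rw [step Y hY hYi, step _ (stronglyMeasurable_condExp.mono hAB) integrable_condExp]
    have hi : Integrable (Y * q) P :=
      hYi.mul_bdd (c := 1) (hqm.mono hA).aestronglyMeasurable hqb
    rw [← Pi.mul_def, ← setIntegral_condExp hA hi hAm]
    refine setIntegral_congr_ae (hA _ hAm) ?_
    filter_upwards [condExp_mul_of_stronglyMeasurable_right hqm hi hYi] with ω h _
    rw [h, Pi.mul_apply]
  -- With `univ` adjoined to the π-system, the intersections `A ∩ O` include the sets of `𝓐`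
  -- themselves.
  have hgen' : 𝓐 ⊔ MeasurableSpace.generateFrom C
      = 𝓐 ⊔ MeasurableSpace.generateFrom (insert univ C) := by
    rw [MeasurableSpace.generateFrom_insert_univ]
  have h1 : P[Y | 𝓐 ⊔ MeasurableSpace.generateFrom C]
      =ᵐ[P] P[P[Y | 𝓐] | 𝓐 ⊔ MeasurableSpace.generateFrom C] := by
    refine condExp_ae_eq_of_isPiSystem (sup_le hA hgen) (isPiSystem_inter hC.insert_univ)
      (hgen'.trans (sup_generateFrom_eq (mem_insert _ _))) hYi integrable_condExp
      (integral_condExp hA).symm ?_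
    rintro _ ⟨A, O, hAm, hO, rfl⟩
    rcases hO with rfl | hO
    · rw [inter_univ, setIntegral_condExp hA hYi hAm]
    · exact key A O hAm hO
  refine h1.trans ?_
  rw [condExp_of_stronglyMeasurable (sup_le hA hgen)
    (stronglyMeasurable_condExp.mono le_sup_left) integrable_condExp]

/-- Adding an independent σ-algebra does not change the conditional expectation. -/
theorem condExp_sup_ae_eq_of_indep [IsProbabilityMeasure P] {𝓐 𝓑 𝓞 : MeasurableSpace Ω}
    (hAB : 𝓐 ≤ 𝓑) (hB : 𝓑 ≤ m0) (hO : 𝓞 ≤ m0) (hind : Indep 𝓞 𝓑 P)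
    {Y : Ω → ℝ} (hY : StronglyMeasurable[𝓑] Y) (hYi : Integrable Y P) :
    P[Y | 𝓐 ⊔ 𝓞] =ᵐ[P] P[Y | 𝓐] := by
  have := condExp_sup_generateFrom_ae_eq hAB hB (C := {O | MeasurableSet[𝓞] O})
    (@MeasurableSpace.isPiSystem_measurableSet _ 𝓞) (fun O h => hO _ h)
    (fun O h => ⟨fun _ => ∫ ω, O.indicator (fun _ => (1 : ℝ)) ω ∂P, stronglyMeasurable_const,
      condExp_indep_eq hO hB (stronglyMeasurable_const.indicator h) hind⟩) hY hYi
  rwa [MeasurableSpace.generateFrom_measurableSet] at this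

/-- For `A`, `B`, `D` in the three σ-algebras, `P(A ∩ B ∩ D) = P(A ∩ B) P(D) = P(A) P(B) P(D) = P(A)
P(B ∩ D)`, and the sets `B ∩ D` form a π-system generating `m₂ ⊔ m₃`. -/
theorem Indep.assoc [IsProbabilityMeasure P] {m₁ m₂ m₃ : MeasurableSpace Ω}
    (h₁ : m₁ ≤ m0) (h₂ : m₂ ≤ m0) (h₃ : m₃ ≤ m0)
    (h₁₂ : Indep m₁ m₂ P) (h₁₂₃ : Indep (m₁ ⊔ m₂) m₃ P) : Indep m₁ (m₂ ⊔ m₃) P := by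
  have hg : m₂ ⊔ m₃ = MeasurableSpace.generateFrom
      {S | ∃ A B, MeasurableSet[m₂] A ∧ B ∈ {B | MeasurableSet[m₃] B} ∧ S = A ∩ B} := by
    rw [← sup_generateFrom_eq (C := {B | MeasurableSet[m₃] B}) (@MeasurableSet.univ _ m₃),
      MeasurableSpace.generateFrom_measurableSet]
  refine IndepSets.indep h₁ (sup_le h₂ h₃) (@MeasurableSpace.isPiSystem_measurableSet _ m₁)
    (isPiSystem_inter (m := m₂) (@MeasurableSpace.isPiSystem_measurableSet _ m₃))
    (@MeasurableSpace.generateFrom_measurableSet _ m₁).symm hg ?_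
  rw [IndepSets_iff]
  rintro A _ hA ⟨B, D, hB, hD, rfl⟩
  rw [Indep_iff] at h₁₂ h₁₂₃
  have hA' : MeasurableSet[m₁ ⊔ m₂] A := le_sup_left (a := m₁) _ hA
  have hB' : MeasurableSet[m₁ ⊔ m₂] B := le_sup_right (a := m₁) _ hB
  rw [← inter_assoc, h₁₂₃ _ _ (hA'.inter hB') hD, h₁₂ _ _ hA hB, h₁₂₃ _ _ hB' hD, mul_assoc]

theorem lintegral_comp_of_indepFun [IsProbabilityMeasure P] {β γ : Type*} [MeasurableSpace β]
    [MeasurableSpace γ] {X : Ω → β} {Y : Ω → γ} (hX : Measurable X) (hY : Measurable Y)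
    (hXY : IndepFun X Y P) {f : β × γ → ℝ≥0∞} (hf : Measurable f) :
    ∫⁻ ω, f (X ω, Y ω) ∂P = ∫⁻ ω, ∫⁻ ω', f (X ω, Y ω') ∂P ∂P := by
  have h1 := (indepFun_iff_map_prod_eq_prod_map_map hX.aemeasurable hY.aemeasurable).1 hXY
  have := Measure.isProbabilityMeasure_map (μ := P) hX.aemeasurable
  have := Measure.isProbabilityMeasure_map (μ := P) hY.aemeasurable
  rw [← lintegral_map (f := f) hf (hX.prodMk hY), h1, lintegral_prod _ hf.aemeasurable,
    lintegral_map (Measurable.lintegral_prod_right' hf) hX]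
  refine lintegral_congr fun ω => ?_
  exact lintegral_map (hf.comp measurable_prodMk_left) hY

/-- Integrating out an independent random variable. -/
theorem lintegral_comp_of_indep [IsProbabilityMeasure P] {γ : Type*}
    [mγ : MeasurableSpace γ] {𝓑 : MeasurableSpace Ω} {Y : Ω → γ} (hB : 𝓑 ≤ m0)
    (hY : Measurable[m0] Y)
    (hXY : Indep 𝓑 (MeasurableSpace.comap Y mγ) P) {f : Ω × γ → ℝ≥0∞}
    (hf : Measurable[𝓑.prod mγ] f) :
    ∫⁻ ω, f (ω, Y ω) ∂P = ∫⁻ ω, ∫⁻ ω', f (ω, Y ω') ∂P ∂P := by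
  -- The identity, regarded as a variable with values in `Ω` equipped with `𝓑`, generates `𝓑`. So
  -- the statement is about two independent random variables.
  refine @lintegral_comp_of_indepFun Ω m0 P _ Ω γ 𝓑 mγ id Y (measurable_id'' hB) hY ?_ f hf
  rw [IndepFun_iff_Indep]
  rwa [MeasurableSpace.comap_id]

/-- If the generators of `m` intersected with `D` are `m'`-measurable, then so are all sets. -/
theorem measurableSet_inter_of_generateFrom {m' : MeasurableSpace Ω} {C : Set (Set Ω)} {D : Set Ω}
    (hD : MeasurableSet[m'] D) (hC : ∀ A ∈ C, MeasurableSet[m'] (A ∩ D)) {A : Set Ω}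
    (hA : MeasurableSet[MeasurableSpace.generateFrom C] A) : MeasurableSet[m'] (A ∩ D) := by
  induction A, hA using MeasurableSpace.generateFrom_induction with
  | hC A hA => exact hC A hA
  | empty => simp
  | compl A _ ih =>
    have : Aᶜ ∩ D = D \ (A ∩ D) := by ext ω; simp; tauto
    rw [this]
    exact hD.diff ih
  | iUnion A _ ih => rw [iUnion_inter]; exact MeasurableSet.iUnion ih

end Generic

end Insurance

end

/-! ### Measurability of policy histories and independence of the marks. -/

section
namespace Insurance

theorem measurable_markedCount {Ω E : Type*} {m : MeasurableSpace Ω} {τ : ℕ → Ω → ℝ≥0∞}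
    {ξ : ℕ → Ω → E} {s : ℝ≥0} {B : Set E}
    (h : ∀ j, MeasurableSet[m] {ω | τ j ω ≤ s ∧ ξ j ω ∈ B}) :
    Measurable[m] (markedCount τ ξ s B) :=
  Measurable.tsum fun j => measurable_const.indicator (h j)

theorem naturalSigma_le {Ω E : Type*} [MeasurableSpace E] {m : MeasurableSpace Ω}
    {τ : ℕ → Ω → ℝ≥0∞} {ξ : ℕ → Ω → E} {t : ℝ≥0}
    (h : ∀ s ≤ t, ∀ B, MeasurableSet B → ∀ j, MeasurableSet[m] {ω | τ j ω ≤ s ∧ ξ j ω ∈ B}) :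
    naturalSigma τ ξ t ≤ m :=
  iSup₂_le fun s hs => iSup₂_le fun B hB => (measurable_markedCount (h s hs B hB)).comap_le

namespace Portfolio

variable {Ω : Type*} {n : ℕ} (c : Portfolio Ω n)

/-- The events `{r < τ₀}`, `r ≤ t`. -/
def lateEvents (k : Fin n) (t : ℝ≥0) : Set (Set Ω) :=
  {A | ∃ r : ℝ≥0, r ≤ t ∧ A = {ω | (r : ℝ≥0∞) < c.accident k ω}}

/-- The σ-algebra generated by the delay, the first mark and the development of a policy. -/
@[reducible] def sigmaMarks (k : Fin n) : MeasurableSpace Ω :=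
  MeasurableSpace.comap (c.firstMark k) inferInstance
    ⊔ MeasurableSpace.comap (c.delay k) inferInstance
    ⊔ MeasurableSpace.comap (c.development k) inferInstance

/-- The σ-algebra generated by the accident time. -/
@[reducible] def sigmaAccident (k : Fin n) : MeasurableSpace Ω :=
  MeasurableSpace.comap (c.accident k) inferInstance

theorem isPiSystem_lateEvents (k : Fin n) (t : ℝ≥0) : IsPiSystem (c.lateEvents k t) := by
  rintro _ ⟨r, hr, rfl⟩ _ ⟨s, hs, rfl⟩ -
  refine ⟨max r s, max_le hr hs, ?_⟩
  ext ω
  simp [ENNReal.coe_max]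

variable {c} {k : Fin n} {m : MeasurableSpace Ω}

theorem measurable_firstMark_of_le (h : c.sigmaMarks k ≤ m) : Measurable[m] (c.firstMark k) :=
  (comap_measurable _).mono ((le_sup_left.trans le_sup_left).trans h) le_rfl

theorem measurable_delay_of_le (h : c.sigmaMarks k ≤ m) : Measurable[m] (c.delay k) :=
  (comap_measurable _).mono ((le_sup_right.trans le_sup_left).trans h) le_rfl

theorem measurable_development_of_le (h : c.sigmaMarks k ≤ m) :
    Measurable[m] (c.development k) :=
  (comap_measurable _).mono (le_sup_right.trans h) le_rfl

theorem measurable_devTime_of_le (h : c.sigmaMarks k ≤ m) (j : ℕ) :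
    Measurable[m] (c.devTime k j) :=
  ((measurable_pi_apply j).comp (measurable_development_of_le h)).fst

theorem measurable_devMark_of_le (h : c.sigmaMarks k ≤ m) (j : ℕ) :
    Measurable[m] (c.devMark k j) :=
  ((measurable_pi_apply j).comp (measurable_development_of_le h)).snd

theorem measurable_mark_of_le (h : c.sigmaMarks k ≤ m) (j : ℕ) : Measurable[m] (c.mark k j) := by
  cases j with
  | zero => exact (measurable_delay_of_le h).prodMk (measurable_firstMark_of_le h)
  | succ j => exact measurable_const.prodMk (measurable_devMark_of_le h j)

theorem measurable_firstReport_of_le (h : c.sigmaMarks k ≤ m)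
    (ha : Measurable[m] (c.accident k)) : Measurable[m] (c.firstReport k) :=
  ha.add (measurable_delay_of_le h).coe_nnreal_ennreal

theorem measurable_reportTime_of_le (h : c.sigmaMarks k ≤ m)
    (ha : Measurable[m] (c.accident k)) (j : ℕ) : Measurable[m] (c.reportTime k j) := by
  cases j with
  | zero => exact measurable_firstReport_of_le h ha
  | succ j => exact (measurable_firstReport_of_le h ha).add (measurable_devTime_of_le h j)

/-- The accident time, replaced by `∞` if it is greater than `t`. -/
def cappedAccident (c : Portfolio Ω n) (k : Fin n) (t : ℝ≥0) (ω : Ω) : ℝ≥0∞ :=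
  if c.accident k ω ≤ t then c.accident k ω else ∞

/-- For finite `r` the capped time exceeds `r` exactly when the accident time exceeds `min r t`, and
this is one of the `lateEvents`. -/
theorem measurable_cappedAccident {t : ℝ≥0}
    (h : MeasurableSpace.generateFrom (c.lateEvents k t) ≤ m) :
    Measurable[m] (c.cappedAccident k t) := by
  refine measurable_of_Ioi fun r => ?_
  induction r with
  | top => simp
  | coe r =>
    refine h _ (MeasurableSpace.measurableSet_generateFrom ⟨min r t, min_le_right _ _, ?_⟩)
    ext ω
    simp only [mem_preimage, mem_Ioi, cappedAccident, mem_ofPred_eq, ENNReal.coe_min]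
    split_ifs with h1
    · constructor
      · exact fun h2 => (min_le_left _ _).trans_lt h2
      · intro h2
        rcases min_lt_iff.1 h2 with h3 | h3
        · exact h3
        · exact absurd h3 (not_lt.2 h1)
    · simp only [ENNReal.coe_lt_top, true_iff]
      exact (min_le_right _ _).trans_lt (not_le.1 h1)

/-- A report by time `s ≤ t` presupposes an accident by time `t`, so capping the accident time at
`t` does not change the event. Hence only early information about the accident is needed, even if
delay, marks and development are known in full. -/
theorem measurableSet_report_of_le {t s : ℝ≥0} (hs : s ≤ t)
    (h : MeasurableSpace.generateFrom (c.lateEvents k t) ≤ m) (hV : c.sigmaMarks k ≤ m) (j : ℕ) :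
    MeasurableSet[m] {ω | c.reportTime k j ω ≤ s} := by
  have hcap := measurable_cappedAccident h
  have hs' : (s : ℝ≥0∞) ≤ t := by exact_mod_cast hs
  have aux : ∀ (ω : Ω) (x : ℝ≥0∞),
      c.accident k ω + x ≤ s ↔ c.cappedAccident k t ω + x ≤ s := by
    intro ω x
    unfold cappedAccident
    split_ifs with h1
    · rfl
    · simp only [top_add, top_le_iff, ENNReal.coe_ne_top, iff_false, not_le]
      exact hs'.trans_lt ((not_le.1 h1).trans_le le_self_add)
  cases j with
  | zero =>
    have : {ω | c.reportTime k 0 ω ≤ s} = {ω | c.cappedAccident k t ω + c.delay k ω ≤ s} := by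
      ext ω
      exact aux ω _
    rw [this]
    exact measurableSet_le (hcap.add (measurable_delay_of_le hV).coe_nnreal_ennreal)
      measurable_const
  | succ j =>
    have : {ω | c.reportTime k (j + 1) ω ≤ s}
        = {ω | c.cappedAccident k t ω + (c.delay k ω + c.devTime k j ω) ≤ s} := by
      ext ω
      simp only [reportTime, firstReport, mem_ofPred_eq, add_assoc]
      exact aux ω _
    rw [this]
    exact measurableSet_le (hcap.add ((measurable_delay_of_le hV).coe_nnreal_ennreal.add
      (measurable_devTime_of_le hV j))) measurable_const

theorem sigmaPolicy_le {t : ℝ≥0}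
    (h : MeasurableSpace.generateFrom (c.lateEvents k t) ≤ m) (hV : c.sigmaMarks k ≤ m) :
    c.sigmaPolicy k t ≤ m :=
  naturalSigma_le fun _ hs _ hB j =>
    (measurableSet_report_of_le hs h hV j).inter (measurable_mark_of_le hV j hB)

theorem sigmaDev_le (hV : c.sigmaMarks k ≤ m) (t : ℝ≥0) : c.sigmaDev k t ≤ m :=
  naturalSigma_le fun _ _ _ hB j =>
    (measurableSet_le (measurable_devTime_of_le hV j) measurable_const).inter
      (measurable_devMark_of_le hV j hB)

theorem sigmaFirst_le (hV : c.sigmaMarks k ≤ m) (ha : c.sigmaAccident k ≤ m) :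
    c.sigmaFirst k ≤ m := by
  refine iSup_le fun t => MeasurableSpace.generateFrom_le ?_
  rintro _ ⟨s, -, B, hB, rfl⟩
  have ha' : Measurable[m] (c.accident k) := measurable_iff_comap_le.2 ha
  exact (measurableSet_le (measurable_reportTime_of_le hV ha' 0) measurable_const).inter
    (measurable_mark_of_le hV 0 hB)

theorem sigmaAccident_le_generateFrom :
    c.sigmaAccident k
      ≤ MeasurableSpace.generateFrom {A | ∃ r : ℝ≥0, A = {ω | (r : ℝ≥0∞) < c.accident k ω}} := by
  rw [← measurable_iff_comap_le]
  refine measurable_of_Ioi fun r => ?_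
  induction r with
  | top => simp
  | coe r => exact MeasurableSpace.measurableSet_generateFrom ⟨r, rfl⟩

theorem lateEvents_le_of_le {t : ℝ≥0} (ha : c.sigmaAccident k ≤ m) :
    MeasurableSpace.generateFrom (c.lateEvents k t) ≤ m := by
  refine MeasurableSpace.generateFrom_le ?_
  rintro _ ⟨r, -, rfl⟩
  exact ha _ ⟨Ioi (r : ℝ≥0∞), measurableSet_Ioi, rfl⟩

end Portfolio

variable {Ω : Type*} [mΩ : MeasurableSpace Ω] {n : ℕ} {P : Measure Ω} {F : Filtration ℝ≥0 mΩ}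
  {c : Portfolio Ω n} {μ : ℝ≥0 → Ω → ℝ} {α₀ : ℝ} {g : ℝ → ℝ}

theorem le_sigmaAt_top (F : Filtration ℝ≥0 mΩ) (t : ℝ≥0) : F t ≤ sigmaAt F ∞ :=
  le_iSup₂_of_le t le_top le_rfl

theorem sigmaAt_le (F : Filtration ℝ≥0 mΩ) (t : ℝ≥0∞) : sigmaAt F t ≤ mΩ :=
  iSup₂_le fun s _ => F.le s

namespace IsModel

theorem measurable_development (h : IsModel P F c μ α₀ g) (k : Fin n) :
    Measurable (c.development k) :=
  measurable_pi_iff.2 fun j => (h.measurable_devTime k j).prodMk (h.measurable_devMark k j)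

theorem sigmaMarks_le (h : IsModel P F c μ α₀ g) (k : Fin n) : c.sigmaMarks k ≤ mΩ :=
  sup_le (sup_le (h.measurable_firstMark k).comap_le (h.measurable_delay k).comap_le)
    (h.measurable_development k).comap_le

theorem sigmaAccident_le (h : IsModel P F c μ α₀ g) (k : Fin n) : c.sigmaAccident k ≤ mΩ :=
  (h.measurable_accident k).comap_le

theorem sigmaPolicy_le (h : IsModel P F c μ α₀ g) (k : Fin n) (t : ℝ≥0) :
    c.sigmaPolicy k t ≤ mΩ :=
  Portfolio.sigmaPolicy_le (Portfolio.lateEvents_le_of_le (h.sigmaAccident_le k))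
    (h.sigmaMarks_le k)

theorem measurable_firstReport (h : IsModel P F c μ α₀ g) (k : Fin n) :
    Measurable (c.firstReport k) :=
  Portfolio.measurable_firstReport_of_le (h.sigmaMarks_le k) (h.measurable_accident k)

/-- The σ-algebra generated by the reference filtration and the accident times. -/
@[reducible] def sigmaBase (F : Filtration ℝ≥0 mΩ) (c : Portfolio Ω n) : MeasurableSpace Ω :=
  sigmaAt F ∞ ⊔ ⨆ k, c.sigmaAccident k

theorem sigmaBase_le (h : IsModel P F c μ α₀ g) : sigmaBase F c ≤ mΩ :=
  sup_le (sigmaAt_le F ∞) (iSup_le h.sigmaAccident_le)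

section Independence

variable [IsProbabilityMeasure P]

/-- Adds one layer of variables. `O` collects the earlier layers of the policies in `S`, and `R` the
base information with the earlier layers of the remaining policies. A new independent family that is
also independent of `R ⊔ O` can be distributed over the two sides. It is applied in turn to first
marks, delays and developments. -/
theorem indep_sup_family {m : Fin n → MeasurableSpace Ω} (hm : ∀ k, m k ≤ mΩ) (hi : iIndep m P)
    {R O : MeasurableSpace Ω} (hR : R ≤ mΩ) (hO : O ≤ mΩ) (hOR : Indep O R P)
    (hind : Indep (⨆ k, m k) (R ⊔ O) P) (S : Set (Fin n)) :
    Indep (O ⊔ ⨆ k ∈ S, m k) (R ⊔ ⨆ k ∈ Sᶜ, m k) P := by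
  have hS : ∀ S : Set (Fin n), ⨆ k ∈ S, m k ≤ mΩ := fun S => iSup₂_le fun k _ => hm k
  have hS' : ∀ S : Set (Fin n), ⨆ k ∈ S, m k ≤ ⨆ k, m k := fun S =>
    iSup₂_le fun k _ => le_iSup m k
  have h0 : Indep (⨆ k ∈ S, m k) (⨆ k ∈ Sᶜ, m k) P :=
    indep_iSup_of_disjoint hm hi disjoint_compl_right
  have h1 : Indep (⨆ k ∈ S, m k) ((⨆ k ∈ Sᶜ, m k) ⊔ (R ⊔ O)) P :=
    Indep.assoc (hS _) (hS _) (sup_le hR hO) h0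
      (indep_of_indep_of_le_left hind (sup_le (hS' _) (hS' _)))
  have h2 : Indep O (R ⊔ ⨆ k ∈ Sᶜ, m k) P := by
    refine Indep.assoc hO hR (hS _) hOR ?_
    rw [sup_comm]
    exact (indep_of_indep_of_le_left hind (hS' _)).symm
  refine (Indep.assoc (sup_le hR (hS _)) hO (hS _) h2.symm ?_).symm
  refine (indep_of_indep_of_le_right h1 ?_).symm
  rw [sup_assoc, sup_comm, sup_assoc, sup_comm O]

/-- The delays, first marks and developments of some policies are independent of those of the other
policies, the reference filtration and all accident times. -/
theorem indep_sigmaMarks (h : IsModel P F c μ α₀ g) (S : Set (Fin n)) :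
    Indep (⨆ k ∈ S, c.sigmaMarks k) (sigmaBase F c ⊔ ⨆ k ∈ Sᶜ, c.sigmaMarks k) P := by
  have hB := h.sigmaBase_le
  have hx : ∀ k, MeasurableSpace.comap (c.firstMark k) inferInstance ≤ mΩ := fun k =>
    (h.measurable_firstMark k).comap_le
  have hd : ∀ k, MeasurableSpace.comap (c.delay k) inferInstance ≤ mΩ := fun k =>
    (h.measurable_delay k).comap_le
  have hv : ∀ k, MeasurableSpace.comap (c.development k) inferInstance ≤ mΩ := fun k =>
    (h.measurable_development k).comap_le
  have hX := indep_sup_family hx h.firstMark_iIndep.iIndep hB bot_le (indep_bot_left _)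
    (by rw [sup_bot_eq]; exact h.firstMark_indep) S
  rw [bot_sup_eq] at hX
  have hxS : ∀ S : Set (Fin n),
      ⨆ k ∈ S, MeasurableSpace.comap (c.firstMark k) inferInstance ≤ mΩ :=
    fun S => iSup₂_le fun k _ => hx k
  have hdS : ∀ S : Set (Fin n),
      ⨆ k ∈ S, MeasurableSpace.comap (c.delay k) inferInstance ≤ mΩ :=
    fun S => iSup₂_le fun k _ => hd k
  have hD := indep_sup_family hd h.delay_iIndep.iIndep (sup_le hB (hxS _)) (hxS _) hX (by
    refine indep_of_indep_of_le_right h.delay_indep ?_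
    have h1 : ∀ k, Measurable[sigmaAt F ∞ ⊔ ⨆ i, MeasurableSpace.comap
        (fun ω => (c.accident i ω, c.firstMark i ω)) inferInstance]
        (fun ω => (c.accident k ω, c.firstMark k ω)) := fun k =>
      (comap_measurable _).mono ((le_iSup (fun i => MeasurableSpace.comap
        (fun ω => (c.accident i ω, c.firstMark i ω)) inferInstance) k).trans le_sup_right) le_rfl
    exact sup_le (sup_le (sup_le le_sup_left (iSup_le fun k => (h1 k).fst.comap_le))
      (iSup₂_le fun k _ => (h1 k).snd.comap_le)) (iSup₂_le fun k _ => (h1 k).snd.comap_le)) S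
  have hV := indep_sup_family hv h.development_iIndep.iIndep
    (sup_le (sup_le hB (hxS _)) (hdS _)) (sup_le (hxS _) (hdS _)) hD (by
    refine indep_of_indep_of_le_right h.development_indep ?_
    have h1 : ∀ k, Measurable[sigmaAt F ∞ ⊔ ⨆ i, MeasurableSpace.comap
        (fun ω => (c.firstReport i ω, c.delay i ω, c.firstMark i ω)) inferInstance]
        (fun ω => (c.firstReport k ω, c.delay k ω, c.firstMark k ω)) := fun k =>
      (comap_measurable _).mono ((le_iSup (fun i => MeasurableSpace.comap
        (fun ω => (c.firstReport i ω, c.delay i ω, c.firstMark i ω)) inferInstance) k).trans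
          le_sup_right) le_rfl
    -- The assumption on the developments mentions the reporting time instead of the accident time;
    -- as delays are finite, the accident time is recovered by subtraction.
    have h2 : ∀ k, Measurable[sigmaAt F ∞ ⊔ ⨆ i, MeasurableSpace.comap
        (fun ω => (c.firstReport i ω, c.delay i ω, c.firstMark i ω)) inferInstance]
        (c.accident k) := by
      intro k
      have h3 : c.accident k = fun ω => c.firstReport k ω - c.delay k ω := by
        ext ω
        exact (ENNReal.add_sub_cancel_right ENNReal.coe_ne_top).symm
      rw [h3]
      exact (h1 k).fst.sub (h1 k).snd.fst.coe_nnreal_ennreal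
    exact sup_le (sup_le (sup_le (sup_le le_sup_left (iSup_le fun k => (h2 k).comap_le))
      (iSup₂_le fun k _ => (h1 k).snd.snd.comap_le)) (iSup₂_le fun k _ => (h1 k).snd.fst.comap_le))
      (sup_le (iSup₂_le fun k _ => (h1 k).snd.snd.comap_le)
        (iSup₂_le fun k _ => (h1 k).snd.fst.comap_le))) S
  refine indep_of_indep_of_le hV ?_ ?_
  · simp only [Portfolio.sigmaMarks, iSup_sup_eq]
    exact le_rfl
  · simp only [Portfolio.sigmaMarks, iSup_sup_eq, sup_assoc]
    exact le_rfl

theorem indep_sigmaMarks_self (h : IsModel P F c μ α₀ g) (k : Fin n) :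
    Indep (c.sigmaMarks k) (sigmaBase F c) P :=
  indep_of_indep_of_le (h.indep_sigmaMarks {k}) (by simp) le_sup_left

end Independence

end IsModel

end Insurance

end

/-! ### Conditional independence of accident times; reduction to one policy. -/

section
namespace Insurance

variable {Ω : Type*} [mΩ : MeasurableSpace Ω] {n : ℕ} {P : Measure Ω} {F : Filtration ℝ≥0 mΩ}
  {c : Portfolio Ω n} {μ : ℝ≥0 → Ω → ℝ} {α₀ : ℝ} {g : ℝ → ℝ}

namespace IsModel

theorem measurableSet_lt_accident (h : IsModel P F c μ α₀ g) (k : Fin n) (r : ℝ≥0) :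
    MeasurableSet {ω | (r : ℝ≥0∞) < c.accident k ω} :=
  measurableSet_lt measurable_const (h.measurable_accident k)

/-- The accident times are conditionally independent given the full reference filtration. -/
theorem condExp_biInter_accident [IsProbabilityMeasure P] (h : IsModel P F c μ α₀ g) (o : Finset (Fin n))
    (r : Fin n → ℝ≥0) :
    P⟦⋂ k ∈ o, {ω | (r k : ℝ≥0∞) < c.accident k ω} | sigmaAt F ∞⟧
      =ᵐ[P] fun ω => ∏ k ∈ o, (P⟦{ω | (r k : ℝ≥0∞) < c.accident k ω} | sigmaAt F ∞⟧) ω := by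
  classical
  -- Indices outside `o` receive the time `0`. Accident times are a.s. positive, so the
  -- corresponding factors are a.s. equal to `1`.
  let r' : Fin n → ℝ≥0 := fun k => if k ∈ o then r k else 0
  have h1 := h.accident_condIndep ∞ r' (fun k => le_top)
  have hpos : ∀ᵐ ω ∂P, ∀ k, 0 < c.accident k ω := ae_all_iff.2 h.accident_pos
  have h2 : (⋂ k, {ω | (r' k : ℝ≥0∞) < c.accident k ω}).indicator (fun _ => (1 : ℝ))
      =ᵐ[P] (⋂ k ∈ o, {ω | (r k : ℝ≥0∞) < c.accident k ω}).indicator (fun _ => (1 : ℝ)) := by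
    filter_upwards [hpos] with ω hω
    refine indicator_const_eq_indicator_const ?_
    simp only [mem_iInter, mem_ofPred_eq]
    refine forall_congr' fun k => ?_
    by_cases hk : k ∈ o <;> simp [r', hk, hω k]
  have h3 : ∀ k ∉ o, P⟦{ω | (r' k : ℝ≥0∞) < c.accident k ω} | sigmaAt F ∞⟧
      =ᵐ[P] fun _ => (1 : ℝ) := by
    intro k hk
    have h4 : {ω | (r' k : ℝ≥0∞) < c.accident k ω}.indicator (fun _ => (1 : ℝ))
        =ᵐ[P] fun _ => (1 : ℝ) := by
      filter_upwards [hpos] with ω hω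
      simp [r', hk, hω k]
    refine (condExp_congr_ae h4).trans ?_
    rw [condExp_const (sigmaAt_le F ∞)]
  have h5 : ∀ᵐ ω ∂P, ∀ k ∉ o,
      (P⟦{ω | (r' k : ℝ≥0∞) < c.accident k ω} | sigmaAt F ∞⟧) ω = 1 := by
    refine ae_all_iff.2 fun k => ?_
    by_cases hk : k ∈ o
    · simp [hk]
    · filter_upwards [h3 k hk] with ω hω _ using hω
  refine (condExp_congr_ae h2).symm.trans (h1.trans ?_)
  filter_upwards [h5] with ω hω
  rw [← Finset.prod_subset (Finset.subset_univ o) (fun k _ hk => hω k hk)]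
  refine Finset.prod_congr rfl fun k hk => ?_
  simp [r', hk]

theorem exists_of_mem_piiUnionInter {Ω : Type*} {c : Portfolio Ω n} {S : Set (Fin n)} {t : ℝ≥0} {O : Set Ω}
    (hO : O ∈ piiUnionInter (fun k => c.lateEvents k t) S) :
    ∃ (o : Finset (Fin n)) (r : Fin n → ℝ≥0), ↑o ⊆ S ∧ (∀ k, r k ≤ t) ∧
      O = ⋂ k ∈ o, {ω | (r k : ℝ≥0∞) < c.accident k ω} := by
  classical
  obtain ⟨o, ho, f, hf, rfl⟩ := hO
  choose! r hr hr' using hf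
  refine ⟨o, fun k => if k ∈ o then r k else 0, ho, fun k => ?_, ?_⟩
  · by_cases hk : k ∈ o <;> simp [hk, hr]
  · refine iInter₂_congr fun k hk => ?_
    rw [hr' k hk]
    simp only [if_pos hk]

theorem measurableSet_of_mem_piiUnionInter (h : IsModel P F c μ α₀ g) {S : Set (Fin n)} {t : ℝ≥0}
    {O : Set Ω} (hO : O ∈ piiUnionInter (fun k => c.lateEvents k t) S) : MeasurableSet O := by
  obtain ⟨o, r, -, -, rfl⟩ := exists_of_mem_piiUnionInter hO
  exact Finset.measurableSet_biInter o fun k _ => h.measurableSet_lt_accident k _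

theorem isPiSystem_piiUnionInter_lateEvents {Ω : Type*} {c : Portfolio Ω n} (S : Set (Fin n)) (t : ℝ≥0) :
    IsPiSystem (piiUnionInter (fun k => c.lateEvents k t) S) :=
  isPiSystem_piiUnionInter _ (fun k => c.isPiSystem_lateEvents k t) S

/-- Given the full reference filtration and possibly one accident time, the conditional
probability of early information about the other accident times depends on the filtration
up to that time only. -/
theorem exists_condExp_lateEvents [IsProbabilityMeasure P] (h : IsModel P F c μ α₀ g) {S : Set (Fin n)} {t : ℝ≥0}
    {O : Set Ω} (hO : O ∈ piiUnionInter (fun k => c.lateEvents k t) S) :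
    ∃ q : Ω → ℝ, StronglyMeasurable[F t] q ∧ P⟦O | sigmaAt F ∞⟧ =ᵐ[P] q ∧
      ∀ i ∉ S, P⟦O | sigmaAt F ∞ ⊔ c.sigmaAccident i⟧ =ᵐ[P] q := by
  classical
  have hOm := h.measurableSet_of_mem_piiUnionInter hO
  obtain ⟨o, r, hoS, hrt, rfl⟩ := exists_of_mem_piiUnionInter hO
  -- Each factor is conditioned on `F (r k)` with `r k ≤ t`, so the product is `F t`-measurable
  -- while being a conditional probability given the whole filtration.
  let p : Fin n → Ω → ℝ := fun k => P⟦{ω | (r k : ℝ≥0∞) < c.accident k ω} | F (r k)⟧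
  let q : Ω → ℝ := fun ω => ∏ k ∈ o, p k ω
  have hq : StronglyMeasurable[F t] q := by
    refine Finset.stronglyMeasurable_fun_prod o fun k _ => ?_
    exact stronglyMeasurable_condExp.mono (F.mono (hrt k))
  have hp : ∀ᵐ ω ∂P, ∀ k,
      (P⟦{ω | (r k : ℝ≥0∞) < c.accident k ω} | sigmaAt F ∞⟧) ω = p k ω :=
    ae_all_iff.2 fun k => h.accident_condExp k ∞ (r k) le_top
  have hOq : P⟦⋂ k ∈ o, {ω | (r k : ℝ≥0∞) < c.accident k ω} | sigmaAt F ∞⟧ =ᵐ[P] q := by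
    refine (h.condExp_biInter_accident o r).trans ?_
    filter_upwards [hp] with ω hω
    exact Finset.prod_congr rfl fun k _ => hω k
  have hqF : StronglyMeasurable[sigmaAt F ∞] q := hq.mono (le_sigmaAt_top F t)
  have hqi : Integrable q P := (integrable_congr hOq).1 integrable_condExp
  refine ⟨q, hq, hOq, fun i hi => ?_⟩
  have hio : i ∉ o := fun hi' => hi (hoS hi')
  set O : Set Ω := ⋂ k ∈ o, {ω | (r k : ℝ≥0∞) < c.accident k ω} with hOdef
  set C : Set (Set Ω) := {A | ∃ r : ℝ≥0, A = {ω | (r : ℝ≥0∞) < c.accident i ω}} with hCdef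
  have hC : IsPiSystem C := by
    rintro _ ⟨a, rfl⟩ _ ⟨b, rfl⟩ -
    refine ⟨max a b, ?_⟩
    ext ω
    simp [ENNReal.coe_max]
  have hgen : c.sigmaAccident i = MeasurableSpace.generateFrom C := by
    refine le_antisymm Portfolio.sigmaAccident_le_generateFrom
      (MeasurableSpace.generateFrom_le ?_)
    rintro _ ⟨a, rfl⟩
    exact ⟨Ioi (a : ℝ≥0∞), measurableSet_Ioi, rfl⟩
  have hgen' : sigmaAt F ∞ ⊔ c.sigmaAccident i
      = sigmaAt F ∞ ⊔ MeasurableSpace.generateFrom (insert univ C) := by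
    rw [MeasurableSpace.generateFrom_insert_univ, hgen]
  have hle : sigmaAt F ∞ ⊔ c.sigmaAccident i ≤ mΩ := sup_le (sigmaAt_le F ∞) (h.sigmaAccident_le i)
  have hOi : Integrable (O.indicator fun _ => (1 : ℝ)) P := (integrable_const _).indicator hOm
  have key : P⟦O | sigmaAt F ∞ ⊔ c.sigmaAccident i⟧ =ᵐ[P] P[q | sigmaAt F ∞ ⊔ c.sigmaAccident i] := by
    have hA : ∀ A, MeasurableSet[sigmaAt F ∞] A →
        ∫ ω in A, O.indicator (fun _ => (1 : ℝ)) ω ∂P = ∫ ω in A, q ω ∂P := by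
      intro A hA
      rw [← setIntegral_condExp (sigmaAt_le F ∞) hOi hA]
      exact setIntegral_congr_ae (sigmaAt_le F ∞ _ hA) (hOq.mono fun ω hω _ => hω)
    refine condExp_ae_eq_of_isPiSystem hle (isPiSystem_inter hC.insert_univ)
      (hgen'.trans (sup_generateFrom_eq (mem_insert _ _))) hOi hqi ?_ ?_
    · simpa using hA univ MeasurableSet.univ
    · rintro _ ⟨A, B, hAm, hB, rfl⟩
      rcases hB with rfl | ⟨a, rfl⟩
      · rw [inter_univ, hA A hAm]
      · set B : Set Ω := {ω | (a : ℝ≥0∞) < c.accident i ω} with hBdef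
        have hBm : MeasurableSet B := h.measurableSet_lt_accident i a
        have hAm' := sigmaAt_le F ∞ _ hAm
        -- The product formula with policy `i` adjoined at time `a` shows that the conditional
        -- probability of `O ∩ B` is `q` times that of `B`. Therefore `q` has the right integral
        -- over `A ∩ B`.
        have h1 := h.condExp_biInter_accident (insert i o) (Function.update r i a)
        have h2 : ⋂ k ∈ insert i o, {ω | (Function.update r i a k : ℝ≥0∞) < c.accident k ω}
            = O ∩ B := by
          rw [Finset.set_biInter_insert, inter_comm, hBdef, Function.update_self]
          congr 1
          refine iInter₂_congr fun k hk => ?_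
          rw [Function.update_of_ne (fun h' : k = i => hio (h' ▸ hk))]
        rw [h2] at h1
        have h3 : P⟦O ∩ B | sigmaAt F ∞⟧ =ᵐ[P] fun ω => q ω * (P⟦B | sigmaAt F ∞⟧) ω := by
          filter_upwards [h1, hp] with ω h4 h5
          rw [h4, Finset.prod_insert hio, mul_comm, Function.update_self]
          congr 1
          refine Finset.prod_congr rfl fun k hk => ?_
          rw [Function.update_of_ne (fun h' : k = i => hio (h' ▸ hk)), h5 k]
        have h6 : Integrable (q * B.indicator fun _ => (1 : ℝ)) P := by
          have : (q * B.indicator fun _ => (1 : ℝ)) = B.indicator q := by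
            ext ω
            by_cases h : ω ∈ B <;> simp [h]
          rw [this]
          exact hqi.indicator hBm
        have h7 := condExp_mul_of_stronglyMeasurable_left hqF h6
          ((integrable_const (1 : ℝ)).indicator hBm)
        calc ∫ ω in A ∩ B, O.indicator (fun _ => (1 : ℝ)) ω ∂P
            = ∫ ω in A, (O ∩ B).indicator (fun _ => (1 : ℝ)) ω ∂P := by
              rw [inter_comm O B, ← indicator_indicator, setIntegral_indicator hBm]
          _ = ∫ ω in A, (P⟦O ∩ B | sigmaAt F ∞⟧) ω ∂P :=
              (setIntegral_condExp (sigmaAt_le F ∞)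
                ((integrable_const _).indicator (hOm.inter hBm)) hAm).symm
          _ = ∫ ω in A, (P[q * B.indicator (fun _ => (1 : ℝ)) | sigmaAt F ∞]) ω ∂P := by
              refine setIntegral_congr_ae hAm' ?_
              filter_upwards [h3, h7] with ω h8 h9 _
              rw [h8, h9, Pi.mul_apply]
          _ = ∫ ω in A, (q * B.indicator (fun _ => (1 : ℝ))) ω ∂P :=
              setIntegral_condExp (sigmaAt_le F ∞) h6 hAm
          _ = ∫ ω in A, B.indicator q ω ∂P := by
              refine setIntegral_congr_fun hAm' fun ω _ => ?_
              by_cases h : ω ∈ B <;> simp [h]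
          _ = ∫ ω in A ∩ B, q ω ∂P := setIntegral_indicator hBm
  refine key.trans ?_
  rw [condExp_of_stronglyMeasurable hle (hqF.mono le_sup_left) hqi]

/-- The early information about the accident times and all information about
delays, marks and developments. -/
@[reducible] def sigmaLarge {Ω : Type*} (c : Portfolio Ω n) (S : Set (Fin n)) (t : ℝ≥0) :
    MeasurableSpace Ω :=
  MeasurableSpace.generateFrom (piiUnionInter (fun k => c.lateEvents k t) S)
    ⊔ ⨆ k ∈ S, c.sigmaMarks k

theorem generateFrom_lateEvents_le {Ω : Type*} {c : Portfolio Ω n} {S : Set (Fin n)} {k : Fin n} (hk : k ∈ S) (t : ℝ≥0) :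
    MeasurableSpace.generateFrom (c.lateEvents k t) ≤ sigmaLarge c S t :=
  le_sup_of_le_left (MeasurableSpace.generateFrom_mono (subset_piiUnionInter (π := fun k => c.lateEvents k t) hk))

theorem sigmaMarks_le_sigmaLarge {Ω : Type*} {c : Portfolio Ω n} {S : Set (Fin n)} {k : Fin n} (hk : k ∈ S) (t : ℝ≥0) :
    c.sigmaMarks k ≤ sigmaLarge c S t :=
  le_sup_of_le_right (le_iSup₂_of_le k hk le_rfl)

theorem sigmaPolicy_le_sigmaLarge {Ω : Type*} {c : Portfolio Ω n} {S : Set (Fin n)} {k : Fin n} (hk : k ∈ S) (t : ℝ≥0) :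
    c.sigmaPolicy k t ≤ sigmaLarge c S t :=
  Portfolio.sigmaPolicy_le (generateFrom_lateEvents_le hk t) (sigmaMarks_le_sigmaLarge hk t)

theorem sigmaLarge_le (h : IsModel P F c μ α₀ g) (S : Set (Fin n)) (t : ℝ≥0) :
    sigmaLarge c S t ≤ mΩ :=
  sup_le (MeasurableSpace.generateFrom_le fun _ hO => h.measurableSet_of_mem_piiUnionInter hO)
    (iSup₂_le fun k _ => h.sigmaMarks_le k)

/-- Future information of the reference filtration is conditionally independent of the information
about the policies up to time `t`, given `𝓕_t`. -/
theorem condExp_sigmaLarge_ae_eq [IsProbabilityMeasure P] (h : IsModel P F c μ α₀ g) (t : ℝ≥0) {W : Ω → ℝ}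
    (hW : StronglyMeasurable[sigmaAt F ∞] W) (hWi : Integrable W P) :
    P[W | F t ⊔ sigmaLarge c univ t] =ᵐ[P] P[W | F t] := by
  have hpi := isPiSystem_piiUnionInter_lateEvents (c := c) univ t
  have hm := fun O hO => h.measurableSet_of_mem_piiUnionInter (S := univ) (t := t) (O := O) hO
  -- Early accident events have an `F t`-measurable conditional probability given the whole
  -- filtration, hence they do not improve the prediction of `W`. The marks are added afterwards by
  -- independence.
  have h1 := condExp_sup_generateFrom_ae_eq (P := P) (le_sigmaAt_top F t) (sigmaAt_le F ∞) hpi hm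
    (fun O hO => by
      obtain ⟨q, h1, h2, -⟩ := h.exists_condExp_lateEvents hO
      exact ⟨q, h1, h2⟩) hW hWi
  have hV := h.indep_sigmaMarks univ
  have hle : MeasurableSpace.generateFrom (piiUnionInter (fun k => c.lateEvents k t) univ)
      ≤ sigmaBase F c :=
    generateFrom_piiUnionInter_le _ (fun k => Portfolio.lateEvents_le_of_le
      ((le_iSup c.sigmaAccident k).trans le_sup_right)) _
  have h2 := condExp_sup_ae_eq_of_indep (P := P)
    (𝓐 := F t ⊔ MeasurableSpace.generateFrom (piiUnionInter (fun k => c.lateEvents k t) univ))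
    (sup_le ((le_sigmaAt_top F t).trans le_sup_left) hle) h.sigmaBase_le
    (iSup₂_le fun k _ => h.sigmaMarks_le k) (indep_of_indep_of_le_right hV le_sup_left)
    (hW.mono le_sup_left) hWi
  rw [sup_assoc] at h2
  exact h2.trans h1

/-- The sandwich argument makes the preceding result available for actual histories, such as `F t ⊔
c.sigmaPolicy i t`. -/
theorem condExp_ae_eq_of_le_sigmaLarge [IsProbabilityMeasure P] (h : IsModel P F c μ α₀ g)
    {t : ℝ≥0} {W : Ω → ℝ} (hW : StronglyMeasurable[sigmaAt F ∞] W) (hWi : Integrable W P)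
    (m : MeasurableSpace Ω) (hm : F t ≤ m) (hm' : m ≤ F t ⊔ sigmaLarge c univ t) :
    P[W | m] =ᵐ[P] P[W | F t] := by
  have h1 := @sup_le _ _ _ _ _ (F.le t) (@sigmaLarge_le _ mΩ _ _ _ _ _ _ _ h univ t)
  exact condExp_ae_eq_of_le_of_le hm hm' h1
    (@condExp_sigmaLarge_ae_eq _ mΩ _ _ _ _ _ _ _ _ h t _ hW hWi)

/-- The σ-algebra generated by the reference filtration and all the data of one policy. -/
@[reducible] def sigmaOwn (F : Filtration ℝ≥0 mΩ) (c : Portfolio Ω n) (i : Fin n) :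
    MeasurableSpace Ω :=
  sigmaAt F ∞ ⊔ c.sigmaAccident i ⊔ c.sigmaMarks i

/-- The other policies contain no information about policy `i`. -/
theorem condExp_sigmaGlobal_ae_eq [IsProbabilityMeasure P] (h : IsModel P F c μ α₀ g) (i : Fin n) (t : ℝ≥0) {Y : Ω → ℝ}
    (hY : StronglyMeasurable[sigmaOwn F c i] Y) (hYi : Integrable Y P) :
    P[Y | sigmaGlobal F c t] =ᵐ[P] P[Y | F t ⊔ c.sigmaPolicy i t] := by
  have hbase : sigmaAt F ∞ ⊔ c.sigmaAccident i ≤ sigmaBase F c :=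
    sup_le_sup_left (le_iSup c.sigmaAccident i) _
  have hown : sigmaOwn F c i ≤ mΩ :=
    sup_le (sup_le (sigmaAt_le F ∞) (h.sigmaAccident_le i)) (h.sigmaMarks_le i)
  have hpi := isPiSystem_piiUnionInter_lateEvents (c := c) {i}ᶜ t
  have hm := fun O hO => h.measurableSet_of_mem_piiUnionInter (S := {i}ᶜ) (t := t) (O := O) hO
  have hle : MeasurableSpace.generateFrom (piiUnionInter (fun k => c.lateEvents k t) {i}ᶜ)
      ≤ sigmaBase F c :=
    generateFrom_piiUnionInter_le _ (fun k => Portfolio.lateEvents_le_of_le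
      ((le_iSup c.sigmaAccident k).trans le_sup_right)) _
  have hA : F t ⊔ c.sigmaPolicy i t ≤ sigmaOwn F c i :=
    sup_le ((le_sigmaAt_top F t).trans (le_sup_left.trans le_sup_left))
      (Portfolio.sigmaPolicy_le (Portfolio.lateEvents_le_of_le (le_sup_right.trans le_sup_left))
        le_sup_right)
  -- The early accident events of the other policies keep their `F t`-measurable conditional
  -- probability when all data of policy `i` are known: its accident time is handled by the product
  -- formula, its marks by independence.
  have h1 := condExp_sup_generateFrom_ae_eq (P := P) hA hown hpi hm (fun O hO => by
    obtain ⟨q, hq, -, hq'⟩ := h.exists_condExp_lateEvents hO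
    refine ⟨q, hq.mono le_sup_left, ?_⟩
    refine EventuallyEq.trans ?_ (hq' i (by simp))
    refine condExp_sup_ae_eq_of_indep (P := P) hbase h.sigmaBase_le (h.sigmaMarks_le i)
      (h.indep_sigmaMarks_self i) (stronglyMeasurable_const.indicator ?_)
      ((integrable_const _).indicator (hm O hO))
    exact hle _ (MeasurableSpace.measurableSet_generateFrom hO)) hY hYi
  have hV := h.indep_sigmaMarks {i}ᶜ
  have h2 := condExp_sup_ae_eq_of_indep (P := P)
    (𝓐 := F t ⊔ c.sigmaPolicy i t
      ⊔ MeasurableSpace.generateFrom (piiUnionInter (fun k => c.lateEvents k t) {i}ᶜ))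
    (𝓑 := sigmaBase F c ⊔ c.sigmaMarks i) (𝓞 := ⨆ k ∈ ({i}ᶜ : Set (Fin n)), c.sigmaMarks k)
    (sup_le (hA.trans (sup_le_sup_right hbase _)) (hle.trans le_sup_left))
    (sup_le h.sigmaBase_le (h.sigmaMarks_le i))
    (iSup₂_le fun k _ => h.sigmaMarks_le k) (by simpa using hV)
    (hY.mono (sup_le_sup_right hbase _)) hYi
  rw [sup_assoc] at h2
  -- `sigmaGlobal` lies between the history of policy `i` alone and the σ-algebra that also contains
  -- all marks and early accident events of the others.
  refine condExp_ae_eq_of_le_of_le ?_ ?_ ?_ (h2.trans h1)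
  · exact sup_le_sup_left (le_iSup (fun k => c.sigmaPolicy k t) i) _
  · refine sup_le (le_sup_left.trans le_sup_left) (iSup_le fun k => ?_)
    by_cases hk : k = i
    · subst hk
      exact le_sup_right.trans le_sup_left
    · exact (sigmaPolicy_le_sigmaLarge (S := {i}ᶜ) (by simpa using hk) t).trans
        le_sup_right
  · exact sup_le (sup_le (F.le t) (h.sigmaPolicy_le i t)) (h.sigmaLarge_le {i}ᶜ t)

end IsModel

end Insurance

end

/-! ### Expected weighted updates as Stieltjes integrals against m̃. -/

section
namespace Insurance

/-- The sum of the `φ`-weighted sizes of the updates falling into `(t, T]`, if the first reporting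
happens at time `x` and the development is given by the sequence `d`. -/
def devSum (φ : ℝ≥0 → ℝ≥0∞) (t T : ℝ≥0) (x : ℝ≥0∞) (d : ℕ → ℝ≥0∞ × ℝ≥0) : ℝ≥0∞ :=
  ∑' j, {u : ℝ≥0∞ | t < u ∧ u ≤ T}.indicator (fun u => ((d j).2 : ℝ≥0∞) * φ u.toNNReal)
    (x + (d j).1)

theorem measurable_devSum {β : Type*} {m : MeasurableSpace β} {φ : β → ℝ≥0 → ℝ≥0∞}
    (hφ : Measurable (Function.uncurry φ)) {t : β → ℝ≥0} (ht : Measurable t) (T : ℝ≥0)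
    {x : β → ℝ≥0∞} (hx : Measurable x) {d : β → ℕ → ℝ≥0∞ × ℝ≥0} (hd : Measurable d) :
    Measurable fun b => devSum (φ b) (t b) T (x b) (d b) := by
  refine Measurable.tsum fun j => ?_
  have hdj : Measurable fun b => d b j := (measurable_pi_apply j).comp hd
  have hu : Measurable fun b => x b + (d b j).1 := hx.add hdj.fst
  have hf : Measurable fun b => ((d b j).2 : ℝ≥0∞) * φ b (x b + (d b j).1).toNNReal :=
    hdj.snd.coe_nnreal_ennreal.mul (hφ.comp (measurable_id.prodMk hu.ennreal_toNNReal))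
  have hS : MeasurableSet {b | (t b : ℝ≥0∞) < x b + (d b j).1 ∧ x b + (d b j).1 ≤ T} :=
    (measurableSet_lt ht.coe_nnreal_ennreal hu).inter (measurableSet_le hu measurable_const)
  exact hf.indicator hS

theorem mem_Ioc_toNNReal {t T : ℝ≥0} {u : ℝ≥0∞} (hu : (t : ℝ≥0∞) < u ∧ u ≤ T) :
    u.toNNReal ∈ Ioc t T := by
  lift u to ℝ≥0 using (hu.2.trans_lt ENNReal.coe_lt_top).ne
  simpa using hu

/-- Two measures agree on `(t, T]` if they agree on all intervals `(t, a]`, `a ∈ [t, T]`. -/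
theorem restrict_Ioc_eq_of_Ioc {ν₁ ν₂ : Measure ℝ≥0} {t T : ℝ≥0} (htT : t ≤ T)
    (h : ∀ a, t ≤ a → a ≤ T → ν₁ (Ioc t a) = ν₂ (Ioc t a)) (hfin : ν₂ (Ioc t T) ≠ ∞) :
    ν₁.restrict (Ioc t T) = ν₂.restrict (Ioc t T) := by
  have : IsFiniteMeasure (ν₁.restrict (Ioc t T)) :=
    ⟨by rw [Measure.restrict_apply_univ, h T htT le_rfl]; exact hfin.lt_top⟩
  refine Measure.ext_of_Iic _ _ fun a => ?_
  rw [Measure.restrict_apply measurableSet_Iic, Measure.restrict_apply measurableSet_Iic]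
  have h1 : Iic a ∩ Ioc t T = Ioc t (min a T) := by
    ext u
    simp only [mem_inter_iff, mem_Iic, mem_Ioc, le_min_iff]
    tauto
  rw [h1]
  rcases le_total t (min a T) with h2 | h2
  · exact h _ h2 (min_le_right _ _)
  · rw [Ioc_eq_empty (not_lt.2 h2)]
    simp

variable {Ω : Type*} [mΩ : MeasurableSpace Ω] {n : ℕ} {P : Measure Ω} {F : Filtration ℝ≥0 mΩ}
  {c : Portfolio Ω n} {μ : ℝ≥0 → Ω → ℝ} {α₀ : ℝ} {g : ℝ → ℝ}

/-- The weight `1` on `(t, a]` picks out the increment of the compound process between `t - x` and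
`a - x`. The additive form avoids subtracting totals that may be infinite. -/
theorem devSum_indicator_Ioc_add {Ω : Type*} {c : Portfolio Ω n} {i : Fin n} {t T x a : ℝ≥0} (hxt : x ≤ t) (hta : t ≤ a)
    (haT : a ≤ T) (ω : Ω) :
    devSum ((Ioc t a).indicator fun _ => 1) t T x (c.development i ω) + c.devTotalENN i (t - x) ω
      = c.devTotalENN i (a - x) ω := by
  unfold devSum Portfolio.devTotalENN
  rw [← ENNReal.tsum_add]
  refine tsum_congr fun j => ?_
  have hle : ∀ b : ℝ≥0, x ≤ b →
      (c.devTime i j ω ≤ ((b - x : ℝ≥0) : ℝ≥0∞) ↔ x + c.devTime i j ω ≤ b) := by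
    intro b hb
    rw [ENNReal.coe_sub]
    exact ENNReal.le_sub_iff_add_le_left ENNReal.coe_ne_top (by exact_mod_cast hb)
  have hta' : (t : ℝ≥0∞) ≤ a := by exact_mod_cast hta
  have haT' : (a : ℝ≥0∞) ≤ T := by exact_mod_cast haT
  simp only [indicator_apply, mem_ofPred_eq, Portfolio.development, hle t hxt, hle a (hxt.trans hta)]
  generalize hu : (x : ℝ≥0∞) + c.devTime i j ω = u
  by_cases h1 : u ≤ t
  · simp [h1, h1.trans hta', not_lt.2 h1]
  · have h1' := not_le.1 h1
    by_cases h2 : u ≤ a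
    · have hu' : u ≠ ∞ := (h2.trans_lt ENNReal.coe_lt_top).ne
      lift u to ℝ≥0 using hu'
      have h3 : t < u := by exact_mod_cast h1'
      have h4 : u ≤ a := by exact_mod_cast h2
      simp [h3, h4, h4.trans haT]
    · by_cases h3 : u ≤ T
      · have hu' : u ≠ ∞ := (h3.trans_lt ENNReal.coe_lt_top).ne
        lift u to ℝ≥0 using hu'
        have h4 : ¬ u ≤ a := fun h => h2 (by exact_mod_cast h)
        simp [h1, h4]
      · simp [h1, h2, h3]

theorem devSum_le {Ω : Type*} {c : Portfolio Ω n} {φ : ℝ≥0 → ℝ≥0∞} {t T : ℝ≥0} {K : ℝ≥0∞} (hK : ∀ u ≤ T, φ u ≤ K) (x : ℝ≥0∞)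
    (i : Fin n) (ω : Ω) : devSum φ t T x (c.development i ω) ≤ c.devTotalENN i T ω * K := by
  unfold devSum Portfolio.devTotalENN
  rw [← ENNReal.tsum_mul_right]
  refine ENNReal.tsum_le_tsum fun j => ?_
  refine indicator_apply_le' (fun hu => ?_) fun _ => zero_le
  have h1 : c.devTime i j ω ≤ T := le_add_self.trans hu.2
  rw [indicator_of_mem (by exact h1)]
  exact mul_le_mul_right (hK _ (ENNReal.toNNReal_mono ENNReal.coe_ne_top hu.2)) _

namespace IsModel

theorem ae_devTotalENN_lt_top (h : IsModel P F c μ α₀ g) (i : Fin n) (t : ℝ≥0) :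
    ∀ᵐ ω ∂P, c.devTotalENN i t ω < ∞ :=
  ae_lt_top (h.measurable_devTotalENN i t) (h.devTotal_finite i t).ne

theorem ae_devSum_indicator_Ioc (h : IsModel P F c μ α₀ g) (i : Fin n) {t T x a : ℝ≥0}
    (hxt : x ≤ t) (hta : t ≤ a) (haT : a ≤ T) :
    (fun ω => devSum ((Ioc t a).indicator fun _ => 1) t T x (c.development i ω))
      =ᵐ[P] fun ω => ENNReal.ofReal (c.devTotal i (a - x) ω - c.devTotal i (t - x) ω) := by
  filter_upwards [h.ae_devTotalENN_lt_top i (t - x), h.ae_devTotalENN_lt_top i (a - x)]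
    with ω h1 h2
  have h3 := devSum_indicator_Ioc_add (c := c) (i := i) hxt hta haT ω
  have h4 := ENNReal.eq_sub_of_add_eq h1.ne h3
  rw [h4, Portfolio.devTotal, Portfolio.devTotal, ENNReal.ofReal_sub _ ENNReal.toReal_nonneg,
    ENNReal.ofReal_toReal h1.ne, ENNReal.ofReal_toReal h2.ne]

theorem measurable_devSum_development (h : IsModel P F c μ α₀ g) (i : Fin n)
    {φ : ℝ≥0 → ℝ≥0∞} (hφ : Measurable φ) (t T : ℝ≥0) (x : ℝ≥0∞) :
    Measurable fun ω => devSum φ t T x (c.development i ω) :=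
  measurable_devSum (φ := fun _ => φ) (hφ.comp measurable_snd) measurable_const T
    measurable_const (h.measurable_development i)

theorem lintegral_devSum_indicator_Ioc (h : IsModel P F c μ α₀ g) (i : Fin n) {t T x a : ℝ≥0}
    (hxt : x ≤ t) (hta : t ≤ a) (haT : a ≤ T) :
    ∫⁻ ω, devSum ((Ioc t a).indicator fun _ => 1) t T x (c.development i ω) ∂P
      = (h.shiftedMeanDev i x).measure (Ioc t a) := by
  have h1 : ∫⁻ ω, devSum ((Ioc t a).indicator fun _ => 1) t T x (c.development i ω) ∂P
      + ∫⁻ ω, c.devTotalENN i (t - x) ω ∂P = ∫⁻ ω, c.devTotalENN i (a - x) ω ∂P := by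
    rw [← lintegral_add_right _ (h.measurable_devTotalENN i _)]
    exact lintegral_congr fun ω => devSum_indicator_Ioc_add hxt hta haT ω
  have h2 := ENNReal.eq_sub_of_add_eq (h.devTotal_finite i (t - x)).ne h1
  have h3 : ∀ b : ℝ≥0, x ≤ b →
      h.shiftedMeanDev i x b = (∫⁻ ω, c.devTotalENN i (b - x) ω ∂P).toReal := by
    intro b hb
    have h4 : (0 : ℝ) ≤ (b : ℝ) - x := sub_nonneg.2 (by exact_mod_cast hb)
    change c.meanDev i P ((b : ℝ) - x) = _
    rw [h.meanDev_of_nonneg i h4, ← NNReal.coe_sub hb, Real.toNNReal_coe]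
  rw [StieltjesFunction.measure_Ioc, h3 t hxt, h3 a (hxt.trans hta),
    ENNReal.ofReal_sub _ ENNReal.toReal_nonneg, ENNReal.ofReal_toReal (h.devTotal_finite i _).ne,
    ENNReal.ofReal_toReal (h.devTotal_finite i _).ne, h2]

/-- The expected sum of weighted updates on an event `C` which is uncorrelated with the increments
of the compound process of the updates. -/
theorem setLIntegral_devSum (h : IsModel P F c μ α₀ g) (i : Fin n) {t T x : ℝ≥0}
    (hxt : x ≤ t) (htT : t ≤ T) {C : Set Ω} (hfin : P C ≠ ∞)
    (hC : ∀ a, t ≤ a → a ≤ T →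
      ∫⁻ ω in C, devSum ((Ioc t a).indicator fun _ => 1) t T x (c.development i ω) ∂P
        = P C * ∫⁻ ω, devSum ((Ioc t a).indicator fun _ => 1) t T x (c.development i ω) ∂P)
    {φ : ℝ≥0 → ℝ≥0∞} (hφ : Measurable φ) :
    ∫⁻ ω in C, devSum φ t T x (c.development i ω) ∂P
      = P C * ∫⁻ u in Ioc t T, φ u ∂(h.shiftedMeanDev i x).measure := by
  let u : ℕ → Ω → ℝ≥0∞ := fun j ω => x + c.devTime i j ω
  have hu : ∀ j, Measurable (u j) := fun j => measurable_const.add (h.measurable_devTime i j)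
  let E : ℕ → Set Ω := fun j => {ω | (t : ℝ≥0∞) < u j ω ∧ u j ω ≤ T}
  have hE : ∀ j, MeasurableSet (E j) := fun j =>
    (measurableSet_lt measurable_const (hu j)).inter (measurableSet_le (hu j) measurable_const)
  -- The image of `P` on `C` under the update times, weighted by the amounts. Its integrals give the
  -- left-hand side for all weights simultaneously, so it suffices to identify `M` on the intervals
  -- `(t, a]`, where `hC` applies.
  let M : Measure ℝ≥0 := Measure.sum fun j =>
    (((P.restrict C).restrict (E j)).withDensity fun ω => (c.devMark i j ω : ℝ≥0∞)).map
      fun ω => (u j ω).toNNReal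
  have hM : ∀ ψ : ℝ≥0 → ℝ≥0∞, Measurable ψ →
      ∫⁻ v, ψ v ∂M = ∫⁻ ω in C, devSum ψ t T x (c.development i ω) ∂P := by
    intro ψ hψ
    have hm : ∀ j, Measurable fun ω =>
        {v : ℝ≥0∞ | t < v ∧ v ≤ T}.indicator
          (fun v => ((c.development i ω j).2 : ℝ≥0∞) * ψ v.toNNReal)
          (x + (c.development i ω j).1) := fun j =>
      ((h.measurable_devMark i j).coe_nnreal_ennreal.mul
        (hψ.comp (hu j).ennreal_toNNReal)).indicator (hE j)
    simp only [devSum]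
    rw [lintegral_tsum fun j => (hm j).aemeasurable, lintegral_sum_measure]
    refine tsum_congr fun j => ?_
    have hψu : Measurable fun ω => ψ (u j ω).toNNReal := hψ.comp (hu j).ennreal_toNNReal
    rw [lintegral_map hψ (hu j).ennreal_toNNReal,
      lintegral_withDensity_eq_lintegral_mul _ (h.measurable_devMark i j).coe_nnreal_ennreal hψu,
      ← lintegral_indicator (hE j)]
    rfl
  have hrest : M.restrict (Ioc t T)
      = (P C • (h.shiftedMeanDev i x).measure).restrict (Ioc t T) := by
    refine restrict_Ioc_eq_of_Ioc htT (fun a hta haT => ?_) ?_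
    · rw [← lintegral_indicator_one measurableSet_Ioc]
      rw [hM _ (measurable_one.indicator measurableSet_Ioc)]
      refine (hC a hta haT).trans ?_
      rw [h.lintegral_devSum_indicator_Ioc i hxt hta haT]
      rfl
    · rw [Measure.smul_apply, smul_eq_mul, StieltjesFunction.measure_Ioc]
      exact ENNReal.mul_ne_top hfin ENNReal.ofReal_ne_top
  -- Only updates inside `(t, T]` enter the sum, so `M` has no mass elsewhere.
  have hfull : M.restrict (Ioc t T) = M := by
    refine Measure.restrict_eq_self_of_ae_mem ?_
    rw [ae_iff]
    change M (Ioc t T)ᶜ = 0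
    rw [← lintegral_indicator_one measurableSet_Ioc.compl, hM _ (measurable_one.indicator measurableSet_Ioc.compl)]
    refine (lintegral_congr fun ω => ?_).trans lintegral_zero
    refine ENNReal.tsum_eq_zero.2 fun j => ?_
    refine indicator_apply_eq_zero.2 fun hv => ?_
    rw [indicator_of_notMem, mul_zero]
    exact not_not.2 (mem_Ioc_toNNReal hv)
  rw [← hM φ hφ, ← hfull, hrest, Measure.restrict_smul, lintegral_smul_measure]
  rfl

theorem lintegral_devSum [IsProbabilityMeasure P] (h : IsModel P F c μ α₀ g) (i : Fin n)
    {t T x : ℝ≥0} (hxt : x ≤ t) (htT : t ≤ T) {φ : ℝ≥0 → ℝ≥0∞} (hφ : Measurable φ) :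
    ∫⁻ ω, devSum φ t T x (c.development i ω) ∂P
      = ∫⁻ u in Ioc t T, φ u ∂(h.shiftedMeanDev i x).measure := by
  have := h.setLIntegral_devSum i (C := univ) hxt htT (measure_ne_top P _) (by simp) hφ
  simpa using this

/-- With independent increments, the updates after time `t` are independent of the development
known at time `t`. -/
theorem setLIntegral_devSum_of_indep [IsProbabilityMeasure P] (h : IsModel P F c μ α₀ g)
    {i : Fin n} {t T x : ℝ≥0} (hS : HasIndepDevIncrements P c i T) (hxt : x ≤ t) (htT : t ≤ T)
    {C : Set Ω} (hC : MeasurableSet[c.sigmaDev i (t - x)] C)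
    {φ : ℝ≥0 → ℝ≥0∞} (hφ : Measurable φ) :
    ∫⁻ ω in C, devSum φ t T x (c.development i ω) ∂P
      = P C * ∫⁻ ω, devSum φ t T x (c.development i ω) ∂P := by
  have hle : c.sigmaDev i (t - x) ≤ mΩ := Portfolio.sigmaDev_le (h.sigmaMarks_le i) _
  rw [h.lintegral_devSum i hxt htT hφ]
  -- The independence hypothesis concerns increments only, that is, the indicator weights of `(t,
  -- a]`; the measure argument of `setLIntegral_devSum` carries it to all weights.
  refine h.setLIntegral_devSum i hxt htT (measure_ne_top P _) (fun a hta haT => ?_) hφ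
  have hind := hS (t - x) (a - x) (tsub_le_tsub_right hta x) (tsub_le_self.trans haT)
  have hdm : ∀ b, Measurable (c.devTotal i b) := fun b =>
    (h.measurable_devTotalENN i b).ennreal_toReal
  have hcm : MeasurableSpace.comap (fun ω => c.devTotal i (a - x) ω - c.devTotal i (t - x) ω)
      inferInstance ≤ mΩ := ((hdm _).sub (hdm _)).comap_le
  have h1 := lintegral_mul_eq_lintegral_mul_lintegral_of_independent_measurableSpace hcm hle hind
    (f := fun ω => ENNReal.ofReal (c.devTotal i (a - x) ω - c.devTotal i (t - x) ω))
    (g := C.indicator fun _ => 1)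
    (ENNReal.measurable_ofReal.comp (comap_measurable _)) (measurable_const.indicator hC)
  have h2 := h.ae_devSum_indicator_Ioc i hxt hta haT
  rw [lintegral_congr_ae h2, setLIntegral_congr_fun_ae (hle _ hC) (h2.mono fun ω hω _ => hω),
    mul_comm, ← setLIntegral_one, ← lintegral_indicator (hle _ hC), ← lintegral_indicator (hle _ hC),
    ← h1]
  refine lintegral_congr fun ω => ?_
  by_cases hω : ω ∈ C <;> simp [hω]

theorem lintegral_devSum_le (h : IsModel P F c μ α₀ g) {φ : ℝ≥0 → ℝ≥0∞} {t T : ℝ≥0} {K : ℝ≥0∞}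
    (hK : ∀ u ≤ T, φ u ≤ K) (x : ℝ≥0∞) (i : Fin n) :
    ∫⁻ ω, devSum φ t T x (c.development i ω) ∂P ≤ (∫⁻ ω, c.devTotalENN i T ω ∂P) * K := by
  rw [← lintegral_mul_const _ (h.measurable_devTotalENN i T)]
  exact lintegral_mono fun ω => devSum_le hK x i ω

/-- Left-continuity in the time of the first report. When `y` increases to `x`, each update time `y
+ v` increases to `x + v`, and the indicator of `(t, T]`, open on the left and closed on the right,
is left-continuous. Dominated convergence is used twice, over `ω` and over the index `j`. From the
right the claim could fail, if an update falls exactly on `t` or `T`. -/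
theorem tendsto_lintegral_devSum (h : IsModel P F c μ α₀ g) (i : Fin n) {φ : ℝ≥0 → ℝ≥0∞}
    (hφ : Continuous φ) {T : ℝ≥0} {K : ℝ≥0∞} (hK : ∀ u ≤ T, φ u ≤ K) (hK' : K ≠ ∞) (t x : ℝ≥0) :
    Tendsto (fun y : ℝ≥0 => ∫⁻ ω, devSum φ t T y (c.development i ω) ∂P) (𝓝[≤] x)
      (𝓝 (∫⁻ ω, devSum φ t T x (c.development i ω) ∂P)) := by
  refine tendsto_lintegral_filter_of_dominated_convergence (fun ω => c.devTotalENN i T ω * K)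
    (Eventually.of_forall fun y => h.measurable_devSum_development i hφ.measurable t T y)
    (Eventually.of_forall fun y => Eventually.of_forall fun ω => devSum_le hK y i ω) ?_ ?_
  · rw [lintegral_mul_const _ (h.measurable_devTotalENN i T)]
    exact ENNReal.mul_ne_top (h.devTotal_finite i T).ne hK'
  filter_upwards [h.ae_devTotalENN_lt_top i T] with ω hω
  simp only [devSum, ← lintegral_count]
  refine tendsto_lintegral_filter_of_dominated_convergence
    (fun j => {ω' | c.devTime i j ω' ≤ T}.indicator
      (fun ω' => (c.devMark i j ω' : ℝ≥0∞)) ω * K)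
    (Eventually.of_forall fun y => measurable_of_countable _)
    (Eventually.of_forall fun y => Eventually.of_forall fun j => ?_) ?_
    (Eventually.of_forall fun j => ?_)
  · refine indicator_apply_le' (fun hu => ?_) fun _ => zero_le
    have h1 : c.devTime i j ω ≤ T := le_add_self.trans hu.2
    rw [indicator_of_mem (by exact h1)]
    exact mul_le_mul_right (hK _ (ENNReal.toNNReal_mono ENNReal.coe_ne_top hu.2)) _
  · rw [lintegral_mul_const _ (measurable_of_countable _), lintegral_count]
    exact ENNReal.mul_ne_top hω.ne hK'
  · change Tendsto (fun y : ℝ≥0 => {u : ℝ≥0∞ | t < u ∧ u ≤ T}.indicator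
      (fun u => (c.devMark i j ω : ℝ≥0∞) * φ u.toNNReal) (y + c.devTime i j ω)) (𝓝[≤] x)
      (𝓝 ({u : ℝ≥0∞ | t < u ∧ u ≤ T}.indicator
        (fun u => (c.devMark i j ω : ℝ≥0∞) * φ u.toNNReal) (x + c.devTime i j ω)))
    generalize c.devTime i j ω = v
    induction v with
    | top => simp
    | coe v =>
      have hmem : ∀ y : ℝ≥0,
          ((y : ℝ≥0∞) + v ∈ {u : ℝ≥0∞ | t < u ∧ u ≤ T}) ↔ t < y + v ∧ y + v ≤ T := by
        intro y
        rw [← ENNReal.coe_add]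
        simp only [mem_ofPred_eq, ENNReal.coe_lt_coe, ENNReal.coe_le_coe]
      have hcont : Continuous fun y : ℝ≥0 => y + v := continuous_id.add continuous_const
      by_cases h1 : x + v ≤ t
      -- An update that comes at or before `t` when counted from `x` does so when counted from any
      -- earlier `y`.
      · have h0 : ∀ y ≤ x, {u : ℝ≥0∞ | t < u ∧ u ≤ T}.indicator
            (fun u => (c.devMark i j ω : ℝ≥0∞) * φ u.toNNReal) (y + v) = 0 := by
          intro y hy
          rw [indicator_of_notMem]
          rw [hmem]
          exact fun h2 => absurd h2.1 (not_lt.2 ((add_le_add_left hy v).trans h1))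
        rw [h0 x le_rfl]
        exact tendsto_const_nhds.congr' (eventually_nhdsWithin_of_forall fun y hy => (h0 y hy).symm)
      · have h1' : ∀ᶠ y in 𝓝[≤] x, t < y + v :=
          nhdsWithin_le_nhds (hcont.continuousAt.eventually (lt_mem_nhds (not_le.1 h1)))
        by_cases h2 : x + v ≤ T
        · rw [indicator_of_mem ((hmem x).2 ⟨not_le.1 h1, h2⟩)]
          have h3 : Tendsto (fun y : ℝ≥0 =>
              (c.devMark i j ω : ℝ≥0∞) * φ ((y : ℝ≥0∞) + v).toNNReal) (𝓝[≤] x)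
              (𝓝 ((c.devMark i j ω : ℝ≥0∞) * φ ((x : ℝ≥0∞) + v).toNNReal)) := by
            refine ENNReal.Tendsto.const_mul ?_ (Or.inr ENNReal.coe_ne_top)
            simp only [← ENNReal.coe_add, ENNReal.toNNReal_coe]
            exact ((hφ.comp hcont).tendsto x).mono_left nhdsWithin_le_nhds
          refine h3.congr' ?_
          filter_upwards [h1', self_mem_nhdsWithin] with y h4 h5
          rw [indicator_of_mem ((hmem y).2 ⟨h4, (add_le_add_left h5 v).trans h2⟩)]
        · rw [indicator_of_notMem (fun h3 => h2 ((hmem x).1 h3).2)]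
          have h2' : ∀ᶠ y in 𝓝[≤] x, T < y + v :=
            nhdsWithin_le_nhds (hcont.continuousAt.eventually (lt_mem_nhds (not_le.1 h2)))
          refine tendsto_const_nhds.congr' ?_
          filter_upwards [h2'] with y h4
          rw [indicator_of_notMem (fun h3 => absurd ((hmem y).1 h3).2 (not_le.2 h4))]

end IsModel

end Insurance

end

/-! ### Absolutely continuous hazards; random times with a conditional density. -/

section
namespace Insurance

section Hazard

/-- A continuous function which is monotone along a dense set is monotone. -/
theorem monotone_of_dense {f : ℝ≥0 → ℝ} (hf : Continuous f) {Q : Set ℝ≥0} (hQ : Dense Q)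
    (h : ∀ a ∈ Q, ∀ b ∈ Q, a ≤ b → f a ≤ f b) : Monotone f := by
  intro a b hab
  rcases hab.eq_or_lt with rfl | hab
  · exact le_rfl
  by_contra hlt
  have hopen : IsOpen {p : ℝ≥0 × ℝ≥0 | f p.2 < f p.1 ∧ p.1 < p.2} :=
    (isOpen_lt (hf.comp continuous_snd) (hf.comp continuous_fst)).inter
      (isOpen_lt (α := ℝ≥0) continuous_fst continuous_snd)
  obtain ⟨p, hp, hpQ⟩ := (hQ.prod hQ).inter_open_nonempty _ hopen ⟨(a, b), not_le.1 hlt, hab⟩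
  exact absurd (h p.1 hpQ.1 p.2 hpQ.2 hp.2.le) (not_le.2 hp.1)

/-- By Lebesgue differentiation the integral has derivative `m s` at almost every `s`, and a
monotone function has nonnegative derivative. -/
theorem ae_nonneg_of_monotone_integral {m : ℝ → ℝ}
    (hm : ∀ t : ℝ, 0 ≤ t → IntervalIntegrable m volume 0 t)
    (hmono : MonotoneOn (fun t => ∫ s in (0 : ℝ)..t, m s) (Ici 0)) :
    ∀ᵐ s, 0 < s → 0 ≤ m s := by
  have h1 : ∀ N : ℕ, ∀ᵐ s, s ∈ uIcc (0 : ℝ) N → ∀ c ∈ uIcc (0 : ℝ) N,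
      HasDerivAt (fun x => ∫ t in c..x, m t) (m s) s := fun N =>
    (hm N (Nat.cast_nonneg N)).ae_hasDerivAt_integral
  filter_upwards [ae_all_iff.2 h1] with s hs h0
  obtain ⟨N, hN⟩ := exists_nat_ge s
  have h2 := hs N (by rw [uIcc_of_le (Nat.cast_nonneg N)]; exact ⟨h0.le, hN⟩) 0 left_mem_uIcc
  rw [← (h2.hasDerivWithinAt (s := Ici 0)).derivWithin (uniqueDiffOn_Ici 0 s h0.le)]
  exact hmono.derivWithin_nonneg

theorem absolutelyContinuousOnInterval_comp {f φ : ℝ → ℝ} {a b : ℝ} {L : ℝ≥0} {S : Set ℝ}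
    (hφ : LipschitzOnWith L φ S) (hf : AbsolutelyContinuousOnInterval f a b)
    (hS : MapsTo f (uIcc a b) S) : AbsolutelyContinuousOnInterval (fun x => φ (f x)) a b := by
  rw [absolutelyContinuousOnInterval_iff] at hf ⊢
  intro ε hε
  -- Dividing by `L + 1` instead of `L` covers the case `L = 0`.
  obtain ⟨δ, hδ, h⟩ := hf (ε / (L + 1)) (by positivity)
  refine ⟨δ, hδ, fun E hE hlt => ?_⟩
  have h1 := h E hE hlt
  calc ∑ i ∈ Finset.range E.1, dist (φ (f (E.2 i).1)) (φ (f (E.2 i).2))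
      ≤ ∑ i ∈ Finset.range E.1, (L + 1) * dist (f (E.2 i).1) (f (E.2 i).2) := by
        refine Finset.sum_le_sum fun i hi => ?_
        have h2 := hE.1 i hi
        refine (hφ.dist_le_mul _ (hS h2.1) _ (hS h2.2)).trans ?_
        gcongr
        linarith
    _ = (L + 1) * ∑ i ∈ Finset.range E.1, dist (f (E.2 i).1) (f (E.2 i).2) := by
        rw [Finset.mul_sum]
    _ < (L + 1) * (ε / (L + 1)) := by gcongr
    _ = ε := by field_simp

/-- `Γ` is absolutely continuous with bounded range on `[0, t]` and the exponential is Lipschitz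
there, so `exp (-Γ)` is absolutely continuous and equals the integral of its a.e. derivative. As `m`
is only locally integrable, the chain rule holds merely almost everywhere, and absolute continuity
is what allows integrating it. -/
theorem lintegral_exp_neg_integral {m : ℝ → ℝ}
    (hm : ∀ t : ℝ, 0 ≤ t → IntervalIntegrable m volume 0 t) (hpos : ∀ᵐ s, 0 < s → 0 ≤ m s)
    {t : ℝ} (ht : 0 ≤ t) :
    ∫⁻ s in Ioc 0 t, ENNReal.ofReal (Real.exp (-∫ v in (0 : ℝ)..s, m v) * m s)
      = ENNReal.ofReal (1 - Real.exp (-∫ v in (0 : ℝ)..t, m v)) := by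
  set Γ : ℝ → ℝ := fun s => ∫ v in (0 : ℝ)..s, m v with hΓ
  have hac : AbsolutelyContinuousOnInterval Γ 0 t :=
    (hm t ht).absolutelyContinuousOnInterval_intervalIntegral left_mem_uIcc
  obtain ⟨K, hK⟩ := hac.exists_bound
  have hexp : AbsolutelyContinuousOnInterval (fun s => Real.exp (-Γ s)) 0 t := by
    have hφ : ContDiffOn ℝ 1 (fun y : ℝ => Real.exp (-y)) (Icc (-K) K) :=
      (Real.contDiff_exp.comp contDiff_neg).contDiffOn
    obtain ⟨L, hL⟩ := hφ.exists_lipschitzOnWith (by decide) (convex_Icc _ _) isCompact_Icc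
    exact absolutelyContinuousOnInterval_comp (φ := fun y => Real.exp (-y)) hL hac fun s hs => abs_le.1 (hK s hs)
  have hderiv : ∀ᵐ s, s ∈ uIcc 0 t → deriv (fun s => Real.exp (-Γ s)) s = -(Real.exp (-Γ s) * m s) := by
    filter_upwards [(hm t ht).ae_hasDerivAt_integral] with s hs hst
    have h1 := (hs hst 0 left_mem_uIcc).neg.exp
    rw [show (fun s => Real.exp (-Γ s)) = fun x => Real.exp ((-fun x => ∫ t in (0 : ℝ)..x, m t) x)
      from rfl, h1.deriv]
    simp [hΓ]
  have h2 := hexp.integral_deriv_eq_sub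
  have h3 : ∫ s in (0 : ℝ)..t, Real.exp (-Γ s) * m s = 1 - Real.exp (-Γ t) := by
    have h4 : ∫ s in (0 : ℝ)..t, deriv (fun s => Real.exp (-Γ s)) s
        = ∫ s in (0 : ℝ)..t, -(Real.exp (-Γ s) * m s) := by
      refine intervalIntegral.integral_congr_ae ?_
      filter_upwards [hderiv] with s hs hst using hs (uIoc_subset_uIcc hst)
    rw [h4, intervalIntegral.integral_neg] at h2
    have h5 : Γ 0 = 0 := intervalIntegral.integral_same
    rw [h5] at h2
    simp at h2
    linarith
  have hint : IntervalIntegrable (fun s => Real.exp (-Γ s) * m s) volume 0 t :=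
    (hm t ht).continuousOn_mul hexp.continuousOn
  rw [← h3, intervalIntegral.integral_of_le ht,
    ofReal_integral_eq_lintegral_ofReal ((intervalIntegrable_iff_integrableOn_Ioc_of_le ht).1 hint)]
  rw [EventuallyLE, ae_restrict_iff' measurableSet_Ioc]
  filter_upwards [hpos] with s hs hst
  exact mul_nonneg (Real.exp_nonneg _) (hs hst.1)

end Hazard

section Density

variable {Ω : Type*} [mΩ : MeasurableSpace Ω] {P : Measure Ω}

/-- If a random time has a conditional density, then this density can be used to compute
expectations. -/
theorem lintegral_comp_eq_of_density [SFinite P] {Ω' : Type*} [MeasurableSpace Ω'] {π : Ω → Ω'}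
    (hπ : Measurable π) {τ : Ω → ℝ≥0∞} (hτ : Measurable τ) {p : ℝ → Ω → ℝ≥0∞}
    (hp : Measurable (Function.uncurry p))
    (h : ∀ (s : ℝ≥0) (B : Set Ω'), MeasurableSet B → P ({ω | τ ω ≤ s} ∩ π ⁻¹' B)
      = ∫⁻ ω in π ⁻¹' B, (∫⁻ v in Ioc (0 : ℝ) s, p v ω) ∂P)
    (hfin : ∀ s : ℝ≥0, P {ω | τ ω ≤ s} ≠ ∞)
    {f : ℝ≥0 × Ω' → ℝ≥0∞} (hf : Measurable f) :
    ∫⁻ ω in {ω | τ ω < ∞}, f ((τ ω).toNNReal, π ω) ∂P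
      = ∫⁻ ω, (∫⁻ v in Ioi (0 : ℝ), p v ω * f (v.toNNReal, π ω)) ∂P := by
  -- Both sides are integrals of `f` against measures on the product of time and `Ω'`: `M₁` is the
  -- joint law of `τ` and `π` on finite times, `M₂` the measure built from the density. Hypothesis
  -- `h` gives equality on the rectangles `[0, s] × B`, a π-system; finite mass on `[0, N] × Ω'`
  -- extends it.
  let M₁ : Measure (ℝ≥0 × Ω') :=
    (P.restrict {ω | τ ω < ∞}).map fun ω => ((τ ω).toNNReal, π ω)
  let M₂ : Measure (ℝ≥0 × Ω') :=
    ((P.prod (volume.restrict (Ioi 0))).withDensity fun z => p z.2 z.1).map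
      fun z => (z.2.toNNReal, π z.1)
  have hm₁ : Measurable fun ω => ((τ ω).toNNReal, π ω) := hτ.ennreal_toNNReal.prodMk hπ
  have hm₂ : Measurable fun z : Ω × ℝ => (z.2.toNNReal, π z.1) :=
    measurable_snd.real_toNNReal.prodMk (hπ.comp measurable_fst)
  have hp' : Measurable fun z : Ω × ℝ => p z.2 z.1 := hp.comp measurable_swap
  have hL₁ : ∀ f : ℝ≥0 × Ω' → ℝ≥0∞, Measurable f →
      ∫⁻ z, f z ∂M₁ = ∫⁻ ω in {ω | τ ω < ∞}, f ((τ ω).toNNReal, π ω) ∂P := fun f hf =>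
    lintegral_map hf hm₁
  have hL₂ : ∀ f : ℝ≥0 × Ω' → ℝ≥0∞, Measurable f →
      ∫⁻ z, f z ∂M₂ = ∫⁻ ω, (∫⁻ v in Ioi (0 : ℝ), p v ω * f (v.toNNReal, π ω)) ∂P := by
    intro f hf
    have hf₂ : Measurable fun z : Ω × ℝ => f (z.2.toNNReal, π z.1) := hf.comp hm₂
    rw [lintegral_map hf hm₂, lintegral_withDensity_eq_lintegral_mul _ hp' hf₂,
      lintegral_prod _ (hp'.mul hf₂).aemeasurable]
    rfl
  have hrect : ∀ (s : ℝ≥0) (B : Set Ω'), MeasurableSet B →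
      M₁ (Iic s ×ˢ B) = P ({ω | τ ω ≤ s} ∩ π ⁻¹' B) ∧ M₁ (Iic s ×ˢ B) = M₂ (Iic s ×ˢ B) := by
    intro s B hB
    have hsB : MeasurableSet (Iic s ×ˢ B) := measurableSet_Iic.prod hB
    have h1 : M₁ (Iic s ×ˢ B) = P ({ω | τ ω ≤ s} ∩ π ⁻¹' B) := by
      rw [Measure.map_apply hm₁ hsB, Measure.restrict_apply (hm₁ hsB)]
      congr 1
      ext ω
      simp only [mem_inter_iff, mem_preimage, mem_prod, mem_Iic, mem_ofPred_eq]
      constructor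
      · rintro ⟨⟨h1, h2⟩, h3⟩
        refine ⟨?_, h2⟩
        rw [← ENNReal.coe_toNNReal h3.ne]
        exact_mod_cast h1
      · rintro ⟨h1, h2⟩
        exact ⟨⟨ENNReal.toNNReal_mono ENNReal.coe_ne_top h1, h2⟩, h1.trans_lt ENNReal.coe_lt_top⟩
    refine ⟨h1, ?_⟩
    rw [h1, h s B hB, ← lintegral_indicator_one hsB, hL₂ _ (measurable_one.indicator hsB),
      ← lintegral_indicator (hπ hB)]
    refine lintegral_congr fun ω => ?_
    by_cases hω : π ω ∈ B
    · rw [indicator_of_mem (by exact hω), ← lintegral_indicator measurableSet_Ioc,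
        ← lintegral_indicator measurableSet_Ioi]
      refine lintegral_congr fun v => ?_
      by_cases hv : 0 < v
      · by_cases hvs : v ≤ s
        · simp [indicator, hv, hvs, hω, Real.toNNReal_le_iff_le_coe]
        · simp [indicator, hv, hvs, Real.toNNReal_le_iff_le_coe]
      · simp [indicator, hv]
    · rw [indicator_of_notMem (by exact hω)]
      refine ((lintegral_congr fun v => ?_).trans lintegral_zero).symm
      simp [indicator, hω]
  have hM : M₁ = M₂ := by
    refine Measure.ext_of_generateFrom_of_iUnion
      (image2 (· ×ˢ ·) (range Iic) {B : Set Ω' | MeasurableSet B})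
      (fun N : ℕ => Iic (N : ℝ≥0) ×ˢ univ) ?_ ?_ ?_ ?_ ?_ ?_
    · refine (generateFrom_eq_prod ?_ MeasurableSpace.generateFrom_measurableSet ?_
        isCountablySpanning_measurableSet).symm
      · rw [← borel_eq_generateFrom_Iic, BorelSpace.measurable_eq (α := ℝ≥0)]
      · refine ⟨fun N : ℕ => Iic (N : ℝ≥0), fun N => mem_range_self _, ?_⟩
        exact iUnion_eq_univ_iff.2 fun x => exists_nat_ge x
    · refine IsPiSystem.prod ?_ MeasurableSpace.isPiSystem_measurableSet
      rintro _ ⟨a, rfl⟩ _ ⟨b, rfl⟩ -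
      exact ⟨min a b, Iic_inter_Iic.symm⟩
    · refine iUnion_eq_univ_iff.2 fun x => ?_
      obtain ⟨N, hN⟩ := exists_nat_ge x.1
      exact ⟨N, hN, mem_univ _⟩
    · exact fun N => mem_image2_of_mem (mem_range_self _) MeasurableSet.univ
    · intro N
      rw [(hrect _ _ MeasurableSet.univ).1]
      simpa using hfin N
    · rintro _ ⟨_, ⟨s, rfl⟩, B, hB, rfl⟩
      exact (hrect s B hB).2
  rw [← hL₁ f hf, ← hL₂ f hf, hM]

end Density

end Insurance

end

/-! ### Conditional law of the accident time given the filtration. -/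

section
namespace Insurance

/-- Stopping the time variable at `N` reduces joint measurability to progressive measurability at
`N`. At every point the stopped values are eventually constant in `N`. -/
theorem measurable_uncurry_of_isProgressive {Ω : Type*} [mΩ : MeasurableSpace Ω]
    {F : Filtration ℝ≥0 mΩ} {μ : ℝ≥0 → Ω → ℝ} (hμ : IsProgressive F μ) :
    Measurable[MeasurableSpace.prod inferInstance (sigmaAt F ∞)]
      fun p : ℝ≥0 × Ω => μ p.1 p.2 := by
  refine @measurable_of_tendsto_metrizable _ _
    (MeasurableSpace.prod inferInstance (sigmaAt F ∞)) _ _ _ _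
    (fun (N : ℕ) (p : ℝ≥0 × Ω) => μ (min p.1 N) p.2) _ (fun N => ?_) ?_
  · have h1 : Measurable[MeasurableSpace.prod inferInstance (sigmaAt F ∞),
        (inferInstance : MeasurableSpace (Iic (N : ℝ≥0))).prod (F N)]
        fun p : ℝ≥0 × Ω => ((⟨min p.1 N, mem_Iic.2 (min_le_right _ _)⟩ : Iic (N : ℝ≥0)), p.2) := by
      refine @Measurable.prodMk _ (MeasurableSpace.prod (inferInstance : MeasurableSpace ℝ≥0)
        (sigmaAt F ∞)) _ _ _ (F N) _ _ ?_ ?_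
      · have hfst : Measurable[MeasurableSpace.prod inferInstance (sigmaAt F ∞)]
            fun p : ℝ≥0 × Ω => p.1 := @measurable_fst _ _ _ (sigmaAt F ∞)
        exact (hfst.min measurable_const).subtype_mk
      · exact (@measurable_snd _ _ _ (sigmaAt F ∞)).mono le_rfl (le_sigmaAt_top F N)
    exact (hμ N).comp h1
  · refine tendsto_pi_nhds.2 fun p => ?_
    obtain ⟨N, hN⟩ := exists_nat_ge p.1
    refine tendsto_const_nhds.congr' ?_
    filter_upwards [eventually_ge_atTop N] with M hM
    rw [min_eq_left (hN.trans (by exact_mod_cast hM))]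

theorem measurable_hazard {Ω : Type*} [MeasurableSpace Ω] {μ : ℝ≥0 → Ω → ℝ}
    (hμ : Measurable fun p : ℝ≥0 × Ω => μ p.1 p.2) :
    Measurable fun p : ℝ × Ω => hazard μ p.1 p.2 := by
  have hm : Measurable fun q : (ℝ × Ω) × ℝ => μ q.2.toNNReal q.1.2 :=
    hμ.comp (measurable_snd.real_toNNReal.prodMk measurable_fst.snd)
  have h1 : Measurable fun p : ℝ × Ω => ∫ s in Ioc 0 p.1, μ s.toNNReal p.2 := by
    simp_rw [← integral_indicator measurableSet_Ioc]
    have : Measurable fun q : (ℝ × Ω) × ℝ =>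
        {q : (ℝ × Ω) × ℝ | 0 < q.2 ∧ q.2 ≤ q.1.1}.indicator
          (fun q => μ q.2.toNNReal q.1.2) q :=
      hm.indicator ((measurableSet_lt measurable_const measurable_snd).inter
        (measurableSet_le measurable_snd measurable_fst.fst))
    exact (this.stronglyMeasurable.integral_prod_right (ν := volume)).measurable
  have h2 : Measurable fun p : ℝ × Ω => ∫ s in Ioc p.1 0, μ s.toNNReal p.2 := by
    simp_rw [← integral_indicator measurableSet_Ioc]
    have : Measurable fun q : (ℝ × Ω) × ℝ =>
        {q : (ℝ × Ω) × ℝ | q.1.1 < q.2 ∧ q.2 ≤ 0}.indicator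
          (fun q => μ q.2.toNNReal q.1.2) q :=
      hm.indicator ((measurableSet_lt measurable_fst.fst measurable_snd).inter
        (measurableSet_le measurable_snd measurable_const))
    exact (this.stronglyMeasurable.integral_prod_right (ν := volume)).measurable
  exact h1.sub h2

/-- The density of the conditional law of the accident times given the reference filtration. -/
def accidentDensity {Ω : Type*} (μ : ℝ≥0 → Ω → ℝ) (v : ℝ) (ω : Ω) : ℝ≥0∞ :=
  ENNReal.ofReal (Real.exp (-hazard μ v ω) * μ v.toNNReal ω)

theorem measurable_accidentDensity {Ω : Type*} [MeasurableSpace Ω] {μ : ℝ≥0 → Ω → ℝ}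
    (hμ : Measurable fun p : ℝ≥0 × Ω => μ p.1 p.2) :
    Measurable (Function.uncurry (accidentDensity μ)) :=
  ((Real.measurable_exp.comp (measurable_hazard hμ).neg).mul
    (hμ.comp (measurable_fst.real_toNNReal.prodMk measurable_snd))).ennreal_ofReal

/-- The conditional law of the first reporting time on `[0, ∞)` given the reference filtration. -/
def reportLaw {Ω : Type*} [MeasurableSpace Ω] {n : ℕ} (P : Measure Ω) (c : Portfolio Ω n) (μ : ℝ≥0 → Ω → ℝ) (i : Fin n) (ω : Ω) :
    Measure ℝ≥0 :=
  (((volume.restrict (Ioi (0 : ℝ))).withDensity fun v => accidentDensity μ v ω).prod P).map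
    fun z => z.1.toNNReal + c.delay i z.2

/-- The paths of the intensity process which are locally integrable and nonnegative. -/
def IsRegularPath {Ω : Type*} (μ : ℝ≥0 → Ω → ℝ) (ω : Ω) : Prop :=
  (∀ t : ℝ, 0 ≤ t → IntervalIntegrable (fun s : ℝ => μ s.toNNReal ω) volume 0 t) ∧
    ∀ᵐ s : ℝ, 0 < s → 0 ≤ μ s.toNNReal ω

theorem IsRegularPath.lintegral_accidentDensity {Ω : Type*} {μ : ℝ≥0 → Ω → ℝ} {ω : Ω} (hω : IsRegularPath μ ω) {t : ℝ}
    (ht : 0 ≤ t) : ∫⁻ v in Ioc 0 t, accidentDensity μ v ω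
      = ENNReal.ofReal (1 - Real.exp (-hazard μ t ω)) :=
  lintegral_exp_neg_integral hω.1 hω.2 ht

theorem IsRegularPath.lintegral_accidentDensity_le {Ω : Type*} {μ : ℝ≥0 → Ω → ℝ} {ω : Ω} (hω : IsRegularPath μ ω) :
    ∫⁻ v in Ioi 0, accidentDensity μ v ω ≤ 1 := by
  have h1 : Ioi (0 : ℝ) = ⋃ N : ℕ, Ioc (0 : ℝ) N := by
    ext v
    simp only [mem_Ioi, mem_iUnion, mem_Ioc, exists_and_left, iff_self_and]
    exact fun _ => exists_nat_ge v
  have h2 : Monotone fun N : ℕ => Ioc (0 : ℝ) N := fun a b hab =>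
    Ioc_subset_Ioc_right (by exact_mod_cast hab)
  rw [h1, setLIntegral_iUnion_of_directed _ h2.directed_le]
  refine iSup_le fun N => ?_
  rw [hω.lintegral_accidentDensity N.cast_nonneg]
  exact ENNReal.ofReal_le_one.2 (sub_le_self _ (Real.exp_pos _).le)

variable {Ω : Type*} [mΩ : MeasurableSpace Ω] {n : ℕ} {P : Measure Ω} {F : Filtration ℝ≥0 mΩ}
  {c : Portfolio Ω n} {μ : ℝ≥0 → Ω → ℝ} {α₀ : ℝ} {g : ℝ → ℝ}

theorem prod_sigmaAt_le {β : Type*} [mβ : MeasurableSpace β] (F : Filtration ℝ≥0 mΩ) :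
    MeasurableSpace.prod mβ (sigmaAt F ∞) ≤ MeasurableSpace.prod mβ mΩ :=
  sup_le_sup_left (MeasurableSpace.comap_mono (sigmaAt_le F ∞)) _

namespace IsModel

theorem measurable_intensity (h : IsModel P F c μ α₀ g) :
    Measurable[MeasurableSpace.prod inferInstance (sigmaAt F ∞)] fun p : ℝ≥0 × Ω => μ p.1 p.2 :=
  measurable_uncurry_of_isProgressive h.progressive_intensity

theorem measurable_intensity' (h : IsModel P F c μ α₀ g) :
    Measurable fun p : ℝ≥0 × Ω => μ p.1 p.2 :=
  h.measurable_intensity.mono (prod_sigmaAt_le F) le_rfl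

/-- Conditioning on the whole filtration may be replaced by conditioning on `F s`, where the
intensity prescribes the survival probability. -/
theorem condExp_lt_accident [IsProbabilityMeasure P] (h : IsModel P F c μ α₀ g) (i : Fin n) (s : ℝ≥0) :
    P⟦{ω | (s : ℝ≥0∞) < c.accident i ω} | sigmaAt F ∞⟧
      =ᵐ[P] fun ω => Real.exp (-hazard μ s ω) := by
  refine (h.accident_condExp i ∞ s le_top).trans ?_
  have hm : MeasurableSet {ω | c.accident i ω ≤ s} :=
    measurableSet_le (h.measurable_accident i) measurable_const
  have h1 : {ω | (s : ℝ≥0∞) < c.accident i ω}.indicator (fun _ => (1 : ℝ))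
      = (fun _ => 1) - {ω | c.accident i ω ≤ s}.indicator (fun _ => (1 : ℝ)) := by
    ext ω
    by_cases hω : c.accident i ω ≤ s
    · simp [indicator, hω, not_lt.2 hω]
    · simp [indicator, hω, not_le.1 hω]
  rw [h1]
  refine (condExp_sub (integrable_const _) ((integrable_const _).indicator hm) _).trans ?_
  filter_upwards [h.exp_neg_hazard i s] with ω hω
  rw [hω, Pi.sub_apply, condExp_const (F.le s)]

/-- Almost all paths of the intensity process are locally integrable and nonnegative. -/
theorem ae_isRegularPath [IsProbabilityMeasure P] (h : IsModel P F c μ α₀ g) (i : Fin n) :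
    ∀ᵐ ω ∂P, IsRegularPath μ ω := by
  obtain ⟨Q, hQc, hQd⟩ := TopologicalSpace.exists_countable_dense ℝ≥0
  -- Nonnegativity of the intensity has to be derived. Given one common σ-algebra, survival
  -- probabilities decrease in time, so the hazard increases along a countable dense set, hence
  -- everywhere by continuity, and the intensity is its a.e. derivative.
  have h1 : ∀ᵐ ω ∂P, ∀ a ∈ Q, ∀ b ∈ Q, a ≤ b → hazard μ a ω ≤ hazard μ b ω := by
    refine (ae_ball_iff hQc).2 fun a _ => (ae_ball_iff hQc).2 fun b _ => ?_
    by_cases hab : a ≤ b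
    · have h2 : P⟦{ω | (b : ℝ≥0∞) < c.accident i ω} | sigmaAt F ∞⟧
          ≤ᵐ[P] P⟦{ω | (a : ℝ≥0∞) < c.accident i ω} | sigmaAt F ∞⟧ := by
        refine condExp_mono ((integrable_const _).indicator (h.measurableSet_lt_accident i b))
          ((integrable_const _).indicator (h.measurableSet_lt_accident i a))
          (Eventually.of_forall fun ω => ?_)
        refine indicator_le_indicator_of_subset (fun ω hω => ?_) (fun _ => zero_le_one) ω
        exact lt_of_le_of_lt (show (a : ℝ≥0∞) ≤ b by exact_mod_cast hab) hω
      filter_upwards [h2, h.condExp_lt_accident i a, h.condExp_lt_accident i b] with ω h3 h4 h5 _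
      rw [h4, h5] at h3
      simpa using h3
    · simp [hab]
  filter_upwards [h1, h.locallyIntegrable_intensity] with ω hω hint
  refine ⟨hint, ae_nonneg_of_monotone_integral hint ?_⟩
  have hcont : ContinuousOn (fun t => hazard μ t ω) (Ici 0) := by
    intro t ht
    have h2 := (hint (t + 1) (add_nonneg ht zero_le_one)).absolutelyContinuousOnInterval_intervalIntegral
      (c := 0) left_mem_uIcc
    have h3 := h2.continuousOn t (by rw [uIcc_of_le (add_nonneg ht zero_le_one)]; exact ⟨ht, by linarith⟩)
    refine h3.mono_of_mem_nhdsWithin ?_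
    rw [uIcc_of_le (add_nonneg ht zero_le_one)]
    filter_upwards [self_mem_nhdsWithin, mem_nhdsWithin_of_mem_nhds
      (Iic_mem_nhds (lt_add_one t))] with s hs hs'
    exact ⟨hs, hs'⟩
  have hcont' : Continuous fun a : ℝ≥0 => hazard μ a ω :=
    hcont.comp_continuous NNReal.continuous_coe fun a => a.2
  have hmono := monotone_of_dense hcont' hQd hω
  intro a ha b hb hab
  exact hmono (show (⟨a, ha⟩ : ℝ≥0) ≤ ⟨b, hb⟩ from hab)

/-- The conditional law of the accident times given the reference filtration. -/
theorem lintegral_comp_accident [IsProbabilityMeasure P] (h : IsModel P F c μ α₀ g) (i : Fin n) {f : ℝ≥0 × Ω → ℝ≥0∞}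
    (hf : Measurable[MeasurableSpace.prod inferInstance (sigmaAt F ∞)] f) :
    ∫⁻ ω in {ω | c.accident i ω < ∞}, f ((c.accident i ω).toNNReal, ω) ∂P
      = ∫⁻ ω, (∫⁻ v in Ioi (0 : ℝ), accidentDensity μ v ω * f (v.toNNReal, ω)) ∂P := by
  -- `Ω'` is `Ω` itself with the σ-algebra `sigmaAt F ∞` and `π` is the identity, so the test sets
  -- run through the whole filtration.
  refine @lintegral_comp_eq_of_density Ω mΩ P _ Ω (sigmaAt F ∞) id (measurable_id'' (sigmaAt_le F ∞))
    (c.accident i) (h.measurable_accident i) (accidentDensity μ)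
    (measurable_accidentDensity h.measurable_intensity') (fun s B hB => ?_)
    (fun s => measure_ne_top P _) f hf
  have hB' := sigmaAt_le F ∞ _ hB
  have hm := h.measurableSet_lt_accident i s
  have h1 : ∫⁻ ω in B, (∫⁻ v in Ioc (0 : ℝ) s, accidentDensity μ v ω) ∂P
      = ∫⁻ ω in B, ENNReal.ofReal (1 - Real.exp (-hazard μ s ω)) ∂P := by
    refine setLIntegral_congr_fun_ae hB' ?_
    filter_upwards [h.ae_isRegularPath i] with ω hω _
    exact hω.lintegral_accidentDensity s.2
  have hce := h.condExp_lt_accident i s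
  have hi : Integrable (fun ω => Real.exp (-hazard μ s ω)) P :=
    (integrable_congr hce).1 integrable_condExp
  have hle : ∀ᵐ ω ∂P, 0 ≤ 1 - Real.exp (-hazard μ s ω) := by
    filter_upwards [h.exp_neg_hazard i s, condExp_nonneg (m := F s) (μ := P)
      (f := {ω' | c.accident i ω' ≤ s}.indicator fun _ => (1 : ℝ))
      (Eventually.of_forall fun ω => indicator_nonneg (fun _ _ => zero_le_one) ω)] with ω h2 h3
    rw [h2]
    simpa using h3
  have hi' : Integrable (fun ω => 1 - Real.exp (-hazard μ s ω)) P := (integrable_const _).sub hi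
  rw [preimage_id, h1, ← ofReal_integral_eq_lintegral_ofReal hi'.integrableOn
    (ae_restrict_of_ae hle),
    integral_sub (integrable_const _) hi.integrableOn]
  have h2 : ∫ ω in B, Real.exp (-hazard μ s ω) ∂P
      = P.real ({ω | (s : ℝ≥0∞) < c.accident i ω} ∩ B) := by
    have h3 : ∫ ω in B, Real.exp (-hazard μ s ω) ∂P
        = ∫ ω in B, (P⟦{ω | (s : ℝ≥0∞) < c.accident i ω} | sigmaAt F ∞⟧) ω ∂P :=
      setIntegral_congr_ae hB' (hce.mono fun ω hω _ => hω.symm)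
    rw [h3, setIntegral_condExp (sigmaAt_le F ∞) ((integrable_const _).indicator hm) hB,
      integral_indicator_const _ hm, smul_eq_mul, mul_one, measureReal_restrict_apply hm]
  have h4 : P.real ({ω | c.accident i ω ≤ s} ∩ B) + P.real ({ω | (s : ℝ≥0∞) < c.accident i ω} ∩ B)
      = P.real B := by
    rw [inter_comm, inter_comm _ B]
    have : {ω | c.accident i ω ≤ s} = {ω | (s : ℝ≥0∞) < c.accident i ω}ᶜ := by
      ext ω
      simp
    rw [this, ← sdiff_eq, add_comm]
    exact measureReal_inter_add_sdiff hm
  rw [h2]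
  simp only [integral_const, measureReal_restrict_apply_univ, smul_eq_mul, mul_one]
  rw [← h4, add_sub_cancel_right, ofReal_measureReal]

end IsModel

end Insurance

end

/-! ### Conditional law of the first reporting time. -/

section
namespace Insurance

theorem measurable_comp_prodMk {X α β γ : Type*} {m : MeasurableSpace X} {mα : MeasurableSpace α}
    {mβ : MeasurableSpace β} {mγ : MeasurableSpace γ} {f : α × β → γ} {a : X → α} {b : X → β}
    (hf : Measurable[mα.prod mβ] f) (ha : Measurable[m] a) (hb : Measurable[m] b) :
    Measurable[m] fun x => f (a x, b x) :=
  hf.comp (ha.prodMk hb)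

theorem measurable_lintegral_comp_add {α Ω Ω' : Type*} {mα : MeasurableSpace α}
    {m : MeasurableSpace Ω} {mΩ' : MeasurableSpace Ω'} {ν : Measure Ω'} [SFinite ν]
    {f : ℝ≥0 × Ω → ℝ≥0∞} (hf : Measurable f) {a : α → ℝ≥0} (ha : Measurable a) {d : Ω' → ℝ≥0}
    (hd : Measurable d) : Measurable fun z : α × Ω => ∫⁻ ω', f (a z.1 + d ω', z.2) ∂ν := by
  have : Measurable fun q : (α × Ω) × Ω' => f (a q.1.1 + d q.2, q.1.2) :=
    hf.comp (((ha.comp measurable_fst.fst).add (hd.comp measurable_snd)).prodMk measurable_fst.snd)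
  exact this.lintegral_prod_right'

variable {Ω : Type*} [mΩ : MeasurableSpace Ω] {n : ℕ} {P : Measure Ω} {F : Filtration ℝ≥0 mΩ}
  {c : Portfolio Ω n} {μ : ℝ≥0 → Ω → ℝ} {α₀ : ℝ} {g : ℝ → ℝ}

namespace IsModel

theorem lintegral_reportLaw [IsProbabilityMeasure P] (h : IsModel P F c μ α₀ g) (i : Fin n) (ω : Ω)
    {f : ℝ≥0 → ℝ≥0∞} (hf : Measurable f) :
    ∫⁻ u, f u ∂reportLaw P c μ i ω
      = ∫⁻ v in Ioi (0 : ℝ), accidentDensity μ v ω * ∫⁻ ω', f (v.toNNReal + c.delay i ω') ∂P := by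
  have hp : Measurable fun v => accidentDensity μ v ω :=
    (measurable_accidentDensity h.measurable_intensity').of_uncurry_right
  have hm : Measurable fun z : ℝ × Ω => z.1.toNNReal + c.delay i z.2 :=
    measurable_fst.real_toNNReal.add ((h.measurable_delay i).comp measurable_snd)
  have hF : Measurable fun z : ℝ × Ω => f (z.1.toNNReal + c.delay i z.2) := hf.comp hm
  rw [reportLaw, lintegral_map hf hm, lintegral_prod _ hF.aemeasurable,
    lintegral_withDensity_eq_lintegral_mul _ hp hF.lintegral_prod_right']
  rfl

theorem reportLaw_univ_le [IsProbabilityMeasure P] (h : IsModel P F c μ α₀ g) (i : Fin n) {ω : Ω}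
    (hω : IsRegularPath μ ω) : reportLaw P c μ i ω univ ≤ 1 := by
  rw [← lintegral_one, h.lintegral_reportLaw i ω measurable_const]
  simpa using hω.lintegral_accidentDensity_le

/-- The conditional law of the first reporting time given the reference filtration. -/
theorem lintegral_comp_firstReport [IsProbabilityMeasure P] (h : IsModel P F c μ α₀ g) (i : Fin n)
    {f : ℝ≥0 × Ω → ℝ≥0∞} (hf : Measurable[MeasurableSpace.prod inferInstance (sigmaAt F ∞)] f) :
    ∫⁻ ω in {ω | c.firstReport i ω < ∞}, f ((c.firstReport i ω).toNNReal, ω) ∂P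
      = ∫⁻ ω, (∫⁻ u, f (u, ω) ∂reportLaw P c μ i ω) ∂P := by
  have hf' : Measurable f := hf.mono (prod_sigmaAt_le F) le_rfl
  have hfin : {ω | c.firstReport i ω < ∞} = {ω | c.accident i ω < ∞} := by
    ext ω
    simp [Portfolio.firstReport]
  have hmfin : MeasurableSet[sigmaBase F c] {ω | c.accident i ω < ∞} := by
    refine (le_sup_right.trans' (le_iSup c.sigmaAccident i) : _ ≤ sigmaBase F c) _ ?_
    exact ⟨_, measurableSet_Iio, rfl⟩
  have hacc : Measurable[sigmaBase F c] (c.accident i) :=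
    measurable_iff_comap_le.2 (le_sup_right.trans' (le_iSup c.sigmaAccident i))
  have hFn : Measurable[MeasurableSpace.prod (sigmaBase F c) inferInstance] fun z : Ω × ℝ≥0 =>
      {ω | c.accident i ω < ∞}.indicator
        (fun ω => f ((c.accident i ω).toNNReal + z.2, ω)) z.1 := by
    have hfst : Measurable[MeasurableSpace.prod (sigmaBase F c) inferInstance, sigmaBase F c]
        fun z : Ω × ℝ≥0 => z.1 := @measurable_fst _ _ (sigmaBase F c) _
    have hsnd : Measurable[MeasurableSpace.prod (sigmaBase F c) inferInstance]
        fun z : Ω × ℝ≥0 => z.2 := @measurable_snd _ _ (sigmaBase F c) _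
    exact Measurable.indicator (measurable_comp_prodMk (mβ := sigmaAt F ∞) hf
      ((hacc.comp hfst).ennreal_toNNReal.add hsnd) (hfst.mono le_rfl le_sup_left)) (hfst hmfin)
  have h1 : ∀ ω, {ω | c.accident i ω < ∞}.indicator
      (fun ω => f ((c.firstReport i ω).toNNReal, ω)) ω
      = {ω | c.accident i ω < ∞}.indicator
        (fun ω' => f ((c.accident i ω').toNNReal + c.delay i ω, ω')) ω := by
    intro ω
    by_cases hω : c.accident i ω < ∞
    · rw [indicator_of_mem (by exact hω), indicator_of_mem (by exact hω), Portfolio.firstReport,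
        ENNReal.toNNReal_add hω.ne ENNReal.coe_ne_top, ENNReal.toNNReal_coe]
    · rw [indicator_of_notMem (by exact hω), indicator_of_notMem (by exact hω)]
  have hind : Indep (sigmaBase F c) (MeasurableSpace.comap (c.delay i) inferInstance) P :=
    (indep_of_indep_of_le_left (h.indep_sigmaMarks_self i)
      (le_sup_left.trans' le_sup_right)).symm
  -- The delay is independent of the filtration and the accident times. It is integrated out first;
  -- the density of the accident time is then applied to the resulting function.
  rw [hfin, ← lintegral_indicator (h.sigmaBase_le _ hmfin), lintegral_congr h1,
    lintegral_comp_of_indep h.sigmaBase_le (h.measurable_delay i) hind hFn]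
  have hG : Measurable[MeasurableSpace.prod inferInstance (sigmaAt F ∞)] fun z : ℝ≥0 × Ω =>
      ∫⁻ ω', f (z.1 + c.delay i ω', z.2) ∂P := by
    exact measurable_lintegral_comp_add (m := sigmaAt F ∞) hf measurable_id (h.measurable_delay i)
  have h2 := h.lintegral_comp_accident i hG
  calc _ = ∫⁻ ω in {ω | c.accident i ω < ∞}, ∫⁻ ω', f ((c.accident i ω).toNNReal + c.delay i ω', ω) ∂P
        ∂P := by
        rw [← lintegral_indicator (h.sigmaBase_le _ hmfin)]
        refine lintegral_congr fun ω => ?_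
        by_cases hω : c.accident i ω < ∞
        · simp [indicator, hω]
        · simp [indicator, hω]
    _ = _ := h2
    _ = _ := by
        refine lintegral_congr fun ω => ?_
        exact (h.lintegral_reportLaw i ω (f := fun u => f (u, ω))
          (hf'.comp measurable_prodMk_right)).symm

theorem alpha_nonneg (h : IsModel P F c μ α₀ g) (i : Fin n) : 0 ≤ α₀ := by
  have := h.delay_law i 0
  simp only [NNReal.coe_zero, intervalIntegral.integral_same, add_zero] at this
  rw [← this]
  exact measureReal_nonneg

/-- The law of the delay, as a function with values in `[0, ∞]`. -/
theorem measure_delay_le [IsProbabilityMeasure P] (h : IsModel P F c μ α₀ g) (i : Fin n) (x : ℝ≥0) :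
    P {ω | c.delay i ω ≤ x} = ENNReal.ofReal α₀ + ∫⁻ y in Ioc (0 : ℝ) x, ENNReal.ofReal (g y) := by
  rw [← ofReal_measureReal, h.delay_law i x, intervalIntegral.integral_of_le x.coe_nonneg,
    ENNReal.ofReal_add (h.alpha_nonneg i) (setIntegral_nonneg measurableSet_Ioc fun y hy => h.g_nonneg y hy.1),
    ofReal_integral_eq_lintegral_ofReal (h.g_integrable.mono_set Ioc_subset_Ioi_self)
      ((ae_restrict_iff' measurableSet_Ioc).2 (Eventually.of_forall fun y hy => h.g_nonneg y hy.1))]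

/-- The law is a convolution of the accident density with the law of the delay. The atom of the
delay at `0` gives the first summand. Its density gives a double integral over the accident time `v`
and the reporting time `u`, whose order is exchanged by Tonelli. -/
theorem reportLaw_Iic [IsProbabilityMeasure P] (h : IsModel P F c μ α₀ g) (i : Fin n) (s : ℝ≥0)
    (ω : Ω) :
    reportLaw P c μ i ω (Iic s)
      = ∫⁻ u in Ioc (0 : ℝ) s, (ENNReal.ofReal α₀ * accidentDensity μ u ω
          + ∫⁻ v in Ioo (0 : ℝ) u, accidentDensity μ v ω * ENNReal.ofReal (g (u - v))) := by
  have hp : Measurable fun v => accidentDensity μ v ω :=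
    (measurable_accidentDensity h.measurable_intensity').of_uncurry_right
  -- Extension by zero to the whole line, which lets the shift `y = u - v` and the exchange of
  -- integrals be carried out without domains.
  set p := fun v => (Ioi (0 : ℝ)).indicator (fun v => accidentDensity μ v ω) v with hpdef
  set γ := fun y => (Ioi (0 : ℝ)).indicator (fun y => ENNReal.ofReal (g y)) y with hγdef
  have hpm : Measurable p := hp.indicator measurableSet_Ioi
  have hγm : Measurable γ := h.g_measurable.ennreal_ofReal.indicator measurableSet_Ioi
  have h1 : reportLaw P c μ i ω (Iic s)
      = ∫⁻ v in Ioc (0 : ℝ) s, (ENNReal.ofReal α₀ * accidentDensity μ v ω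
          + p v * ∫⁻ u, (Iic (s : ℝ)).indicator (fun u => γ (u - v)) u) := by
    rw [← lintegral_indicator_one measurableSet_Iic, h.lintegral_reportLaw i ω
      (measurable_one.indicator measurableSet_Iic), ← lintegral_indicator measurableSet_Ioi,
      ← lintegral_indicator measurableSet_Ioc]
    refine lintegral_congr fun v => ?_
    by_cases hv0 : 0 < v
    · rw [indicator_of_mem (by exact hv0)]
      by_cases hvs : v ≤ s
      · rw [indicator_of_mem (by exact ⟨hv0, hvs⟩)]
        have h2 : ∫⁻ ω', (Iic s).indicator 1 (v.toNNReal + c.delay i ω') ∂P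
            = P {ω' | c.delay i ω' ≤ s - v.toNNReal} := by
          rw [← lintegral_indicator_one (measurableSet_le (h.measurable_delay i) measurable_const)]
          refine lintegral_congr fun ω' => ?_
          have : v.toNNReal + c.delay i ω' ≤ s ↔ c.delay i ω' ≤ s - v.toNNReal := by
            rw [le_tsub_iff_left (Real.toNNReal_le_iff_le_coe.2 hvs)]
          simp [indicator, this]
        have h3 : ∫⁻ y in Ioc (0 : ℝ) (s - v), ENNReal.ofReal (g y)
            = ∫⁻ u, (Iic (s : ℝ)).indicator (fun u => γ (u - v)) u := by
          rw [← lintegral_indicator measurableSet_Ioc, ← lintegral_sub_right_eq_self _ v]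
          refine lintegral_congr fun u => ?_
          simp only [hγdef, indicator, mem_Ioc, mem_Iic, mem_Ioi, sub_le_sub_iff_right, ite_and]
          split_ifs <;> rfl
        rw [h2, h.measure_delay_le i, NNReal.coe_sub (Real.toNNReal_le_iff_le_coe.2 hvs),
          Real.coe_toNNReal _ hv0.le, h3, mul_add, hpdef]
        simp only [indicator_of_mem (show v ∈ Ioi (0 : ℝ) from hv0)]
        rw [mul_comm]
      · rw [indicator_of_notMem (fun hh => hvs hh.2)]
        have h2 : ∀ ω', (Iic s).indicator (1 : ℝ≥0 → ℝ≥0∞) (v.toNNReal + c.delay i ω') = 0 := by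
          intro ω'
          refine indicator_of_notMem (fun hh => hvs ?_) _
          exact Real.toNNReal_le_iff_le_coe.1 (le_self_add.trans hh)
        simp [h2]
    · rw [indicator_of_notMem (by exact hv0), indicator_of_notMem (fun hh => hv0 hh.1)]
  have hp' : Measurable fun v => ENNReal.ofReal α₀ * accidentDensity μ v ω := hp.const_mul _
  rw [h1, lintegral_add_left hp', lintegral_add_left hp']
  congr 1
  have hjm : Measurable fun z : ℝ × ℝ => p z.1 * (Iic (s : ℝ)).indicator (fun u => γ (u - z.1)) z.2 :=
    (hpm.comp measurable_fst).mul ((hγm.comp (measurable_snd.sub measurable_fst)).indicator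
      (measurable_snd measurableSet_Iic))
  calc _ = ∫⁻ v, ∫⁻ u, p v * (Iic (s : ℝ)).indicator (fun u => γ (u - v)) u := by
        rw [← lintegral_indicator measurableSet_Ioc]
        refine lintegral_congr fun v => ?_
        have hcm : Measurable fun u => (Iic (s : ℝ)).indicator (fun u => γ (u - v)) u :=
          (hγm.comp (measurable_id.sub_const v)).indicator measurableSet_Iic
        rw [lintegral_const_mul _ hcm]
        by_cases hv0 : 0 < v
        · by_cases hvs : v ≤ s
          · rw [indicator_of_mem (by exact ⟨hv0, hvs⟩)]
          · rw [indicator_of_notMem (fun hh => hvs hh.2)]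
            have : ∀ u, (Iic (s : ℝ)).indicator (fun u => γ (u - v)) u = 0 := by
              intro u
              by_cases hu : u ≤ s
              · rw [indicator_of_mem (by exact hu)]
                exact indicator_of_notMem (fun hh => hvs ((sub_pos.1 hh).le.trans hu)) _
              · exact indicator_of_notMem (by exact hu) _
            simp [this]
        · rw [indicator_of_notMem (fun hh => hv0 hh.1), hpdef]
          simp [indicator, hv0]
    _ = ∫⁻ u, ∫⁻ v, p v * (Iic (s : ℝ)).indicator (fun u => γ (u - v)) u :=
        lintegral_lintegral_swap hjm.aemeasurable
    _ = _ := by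
        rw [← lintegral_indicator measurableSet_Ioc]
        refine lintegral_congr fun u => ?_
        by_cases hu : 0 < u ∧ u ≤ s
        · rw [indicator_of_mem (by exact hu), ← lintegral_indicator measurableSet_Ioo]
          refine lintegral_congr fun v => ?_
          by_cases hv0 : 0 < v
          · by_cases hvu : v < u
            · simp [hpdef, hγdef, indicator, hv0, hvu, hu.2]
            · simp [hpdef, hγdef, indicator, hv0, hvu]
          · simp [hpdef, indicator, hv0]
        · rw [indicator_of_notMem (by exact hu)]
          refine (lintegral_eq_zero_iff' ?_).2 (Eventually.of_forall fun v => ?_)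
          · exact (hjm.comp measurable_prodMk_right).aemeasurable
          · by_cases hv0 : 0 < v
            · by_cases hus : u ≤ s
              · have : ¬ v < u := fun hvu => hu ⟨hv0.trans hvu, hus⟩
                simp [hγdef, indicator, this]
              · simp [indicator, hus]
            · simp [hpdef, indicator, hv0]

/-- On a regular path the intensity is a.e. nonnegative, so the real integrals of the explicit
formula are integrals of nonnegative functions and can be compared with those in `[0, ∞]`. -/
theorem toReal_reportLaw_Iic [IsProbabilityMeasure P] (h : IsModel P F c μ α₀ g) (i : Fin n)
    (s : ℝ≥0) {ω : Ω} (hω : IsRegularPath μ ω) :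
    (reportLaw P c μ i ω (Iic s)).toReal = explicitReportProb μ α₀ g s ω := by
  have hp : Measurable fun v => accidentDensity μ v ω :=
    (measurable_accidentDensity h.measurable_intensity').of_uncurry_right
  have hμm : Measurable fun v : ℝ => μ v.toNNReal ω :=
    h.measurable_intensity'.comp (measurable_id.real_toNNReal.prodMk measurable_const)
  have hem : Measurable fun v : ℝ => Real.exp (-hazard μ v ω) :=
    Real.measurable_exp.comp
      ((measurable_hazard h.measurable_intensity').comp measurable_prodMk_right).neg
  set conv : ℝ → ℝ≥0∞ := fun u =>
    ∫⁻ v in Ioo (0 : ℝ) u, accidentDensity μ v ω * ENNReal.ofReal (g (u - v)) with hconv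
  have hcm : Measurable conv := by
    have h1 : conv = fun u => ∫⁻ v, {z : ℝ × ℝ | 0 < z.2 ∧ z.2 < z.1}.indicator
        (fun z => accidentDensity μ z.2 ω * ENNReal.ofReal (g (z.1 - z.2))) (u, v) := by
      ext u
      simp only [hconv, ← lintegral_indicator measurableSet_Ioo]
      rfl
    rw [h1]
    have h2 : Measurable fun z : ℝ × ℝ =>
        accidentDensity μ z.2 ω * ENNReal.ofReal (g (z.1 - z.2)) :=
      (hp.comp measurable_snd).mul
        (h.g_measurable.comp (measurable_fst.sub measurable_snd)).ennreal_ofReal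
    have h3 : MeasurableSet {z : ℝ × ℝ | 0 < z.2 ∧ z.2 < z.1} :=
      (measurableSet_lt measurable_const measurable_snd).inter
        (measurableSet_lt measurable_snd measurable_fst)
    exact (h2.indicator h3).lintegral_prod_right'
  have hinner : ∀ u : ℝ, 0 < u → ∫ v in (0 : ℝ)..u, g (u - v) * Real.exp (-hazard μ v ω)
      * μ v.toNNReal ω = (conv u).toReal := by
    intro u hu
    have hnn : ∀ᵐ v ∂volume.restrict (Ioo 0 u), 0 ≤ μ v.toNNReal ω ∧ 0 ≤ g (u - v) := by
      refine (ae_restrict_iff' measurableSet_Ioo).2 ?_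
      filter_upwards [hω.2] with v hv huv
      exact ⟨hv huv.1, h.g_nonneg _ (sub_pos.2 huv.2)⟩
    rw [intervalIntegral.integral_of_le hu.le, integral_Ioc_eq_integral_Ioo,
      integral_eq_lintegral_of_nonneg_ae]
    · congr 1
      refine lintegral_congr_ae ?_
      filter_upwards [hnn] with v hv
      rw [mul_assoc, ENNReal.ofReal_mul hv.2, mul_comm]
      rfl
    · filter_upwards [hnn] with v hv
      exact mul_nonneg (mul_nonneg hv.2 (Real.exp_pos _).le) hv.1
    · exact (((h.g_measurable.comp (measurable_const.sub measurable_id)).mul hem).mul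
        hμm).aestronglyMeasurable
  -- The convolution is part of a law of mass at most `1`, so it is finite almost everywhere and
  -- `toReal` loses nothing.
  have hle : ∫⁻ u in Ioc (0 : ℝ) s, conv u ≤ 1 :=
    calc _ ≤ reportLaw P c μ i ω (Iic s) := by
          rw [h.reportLaw_Iic]
          exact lintegral_mono fun u => le_add_self
      _ ≤ 1 := (measure_mono (subset_univ _)).trans (h.reportLaw_univ_le i hω)
  have hfin : ∀ᵐ u ∂volume.restrict (Ioc (0 : ℝ) s), conv u < ∞ :=
    ae_lt_top hcm (hle.trans_lt ENNReal.one_lt_top).ne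
  have hpos : ∀ᵐ u ∂volume.restrict (Ioc (0 : ℝ) s), 0 < u ∧ 0 ≤ μ u.toNNReal ω := by
    refine (ae_restrict_iff' measurableSet_Ioc).2 ?_
    filter_upwards [hω.2] with v hv huv
    exact ⟨huv.1, hv huv.1⟩
  have hα := h.alpha_nonneg i
  have hcongr : explicitReportProb μ α₀ g s ω = ∫ u in Ioc (0 : ℝ) s,
      (α₀ * Real.exp (-hazard μ u ω) * μ u.toNNReal ω + (conv u).toReal) := by
    rw [explicitReportProb, intervalIntegral.integral_of_le s.coe_nonneg]
    exact setIntegral_congr_fun measurableSet_Ioc fun u hu => by simp only [hinner u hu.1]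
  rw [hcongr, h.reportLaw_Iic, integral_eq_lintegral_of_nonneg_ae]
  · congr 1
    refine lintegral_congr_ae ?_
    filter_upwards [hfin, hpos] with u hu hu'
    rw [ENNReal.ofReal_add (mul_nonneg (mul_nonneg hα (Real.exp_pos _).le) hu'.2)
      ENNReal.toReal_nonneg, ENNReal.ofReal_toReal hu.ne, mul_assoc, ENNReal.ofReal_mul hα]
    rfl
  · filter_upwards [hpos] with u hu
    exact add_nonneg (mul_nonneg (mul_nonneg hα (Real.exp_pos _).le) hu.2) ENNReal.toReal_nonneg
  · exact (((hem.const_mul α₀).mul hμm).add hcm.ennreal_toReal).aestronglyMeasurable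

theorem measurable_reportLaw [IsProbabilityMeasure P] (h : IsModel P F c μ α₀ g) (i : Fin n)
    {f : ℝ≥0 × Ω → ℝ≥0∞} (hf : Measurable[MeasurableSpace.prod inferInstance (sigmaAt F ∞)] f) :
    Measurable[sigmaAt F ∞] fun ω => ∫⁻ u, f (u, ω) ∂reportLaw P c μ i ω := by
  have h1 : (fun ω => ∫⁻ u, f (u, ω) ∂reportLaw P c μ i ω) = fun ω => ∫⁻ v in Ioi (0 : ℝ),
      accidentDensity μ v ω * ∫⁻ ω', f (v.toNNReal + c.delay i ω', ω) ∂P := by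
    ext ω
    exact h.lintegral_reportLaw i ω (f := fun u => f (u, ω))
      ((hf.mono (prod_sigmaAt_le F) le_rfl).comp measurable_prodMk_right)
  rw [h1]
  have hG : Measurable[MeasurableSpace.prod inferInstance (sigmaAt F ∞)] fun z : ℝ × Ω =>
      ∫⁻ ω', f (z.1.toNNReal + c.delay i ω', z.2) ∂P := by
    exact measurable_lintegral_comp_add (m := sigmaAt F ∞) hf measurable_real_toNNReal
      (h.measurable_delay i)
  exact @Measurable.lintegral_prod_left' _ _ _ (sigmaAt F ∞) _ _ _
    ((@measurable_accidentDensity _ (sigmaAt F ∞) _ h.measurable_intensity).mul hG)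

end IsModel

end Insurance

end

/-! ### Versions of the conditional distribution process of the first report. -/

section
namespace Insurance

theorem eq_of_dense_of_right_continuous {f k : ℝ≥0 → ℝ}
    (hf : ∀ u, ContinuousWithinAt f (Ici u) u) (hk : ∀ u, ContinuousWithinAt k (Ici u) u)
    {Q : Set ℝ≥0} (hQ : Dense Q) (h : ∀ q ∈ Q, f q = k q) (u : ℝ≥0) : f u = k u := by
  have h1 : u ∈ closure (Ioi u ∩ Q) := by
    have h2 : closure (Ioi u) ⊆ closure (Ioi u ∩ Q) :=
      closure_minimal (hQ.open_subset_closure_inter isOpen_Ioi) isClosed_closure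
    exact h2 (by rw [closure_Ioi]; exact self_mem_Ici)
  have h3 : (𝓝[Ioi u ∩ Q] u).NeBot := mem_closure_iff_nhdsWithin_neBot.1 h1
  have hle : 𝓝[Ioi u ∩ Q] u ≤ 𝓝[Ici u] u :=
    nhdsWithin_mono _ (inter_subset_left.trans Ioi_subset_Ici_self)
  refine tendsto_nhds_unique_of_eventuallyEq ((hf u).tendsto.mono_left hle)
    ((hk u).tendsto.mono_left hle) ?_
  filter_upwards [self_mem_nhdsWithin] with q hq
  exact h q hq.2

theorem measurable_indicator_prod {α β : Type*} {mα : MeasurableSpace α} {mβ : MeasurableSpace β}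
    {s : Set α} {B : Set β} (hs : MeasurableSet s) (hB : MeasurableSet B) :
    Measurable fun z : α × β => (s ×ˢ B).indicator (1 : α × β → ℝ≥0∞) z :=
  measurable_one.indicator (hs.prod hB)

/-- The distribution function of a finite measure on `[0, ∞)`. -/
def distributionFunction (κ : Measure ℝ≥0) [IsFiniteMeasure κ] : StieltjesFunction ℝ≥0 where
  toFun u := (κ (Iic u)).toReal
  mono' u v huv := ENNReal.toReal_mono (measure_ne_top κ _) (measure_mono (Iic_subset_Iic.2 huv))
  right_continuous' u := by
    have h1 : Tendsto (κ ∘ Iic) (𝓝[>] u) (𝓝 (κ (⋂ r > u, Iic r))) :=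
      tendsto_measure_biInter_gt (fun _ _ => measurableSet_Iic.nullMeasurableSet)
        (fun a b _ hab => Iic_subset_Iic.2 hab) ⟨u + 1, lt_add_one u, measure_ne_top κ _⟩
    have h2 : ⋂ r > u, Iic r = Iic u := by
      ext v
      simp only [mem_iInter, mem_Iic]
      exact ⟨fun hv => le_of_forall_gt_imp_ge_of_dense hv, fun hv r hr => hv.trans (le_of_lt hr)⟩
    rw [h2] at h1
    rw [← continuousWithinAt_Ioi_iff_Ici]
    exact (ENNReal.tendsto_toReal (measure_ne_top κ _)).comp h1

/-- Increments of a distribution function do not determine a mass at `0`, so the measures are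
compared on `(t, T]` only. -/
theorem distributionFunction_measure_restrict (κ : Measure ℝ≥0) [IsFiniteMeasure κ] {t T : ℝ≥0}
    (htT : t ≤ T) :
    (distributionFunction κ).measure.restrict (Ioc t T) = κ.restrict (Ioc t T) := by
  refine restrict_Ioc_eq_of_Ioc htT (fun a hta _ => ?_) (measure_ne_top κ _)
  have h1 : κ (Ioc t a) = κ (Iic a) - κ (Iic t) := by
    rw [← measure_sdiff (Iic_subset_Iic.2 hta) measurableSet_Iic.nullMeasurableSet
      (measure_ne_top κ _), Iic_sdiff_Iic]
  rw [StieltjesFunction.measure_Ioc, h1]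
  change ENNReal.ofReal ((κ (Iic a)).toReal - (κ (Iic t)).toReal) = _
  rw [ENNReal.ofReal_sub _ ENNReal.toReal_nonneg, ENNReal.ofReal_toReal (measure_ne_top κ _),
    ENNReal.ofReal_toReal (measure_ne_top κ _)]

variable {Ω : Type*} [mΩ : MeasurableSpace Ω] {n : ℕ} {P : Measure Ω} {F : Filtration ℝ≥0 mΩ}
  {c : Portfolio Ω n} {μ : ℝ≥0 → Ω → ℝ} {α₀ : ℝ} {g : ℝ → ℝ}

namespace IsModel

/-- The information about the policies up to time `t` depends on the reference filtration only
through `F t`. -/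
theorem condExp_sigmaAt_top_ae_eq [IsProbabilityMeasure P] (h : IsModel P F c μ α₀ g) (t : ℝ≥0)
    {O : Set Ω} (hO : MeasurableSet[sigmaLarge c univ t] O) :
    P⟦O | sigmaAt F ∞⟧ =ᵐ[P] P⟦O | F t⟧ := by
  have hle : F t ⊔ sigmaLarge c univ t ≤ mΩ := sup_le (F.le t) (h.sigmaLarge_le univ t)
  -- The extension lemma with the roles exchanged: the sets of `sigmaAt F ∞` are now added to `F t`,
  -- and the variable to be predicted is the indicator of `O`.
  have h1 := condExp_sup_generateFrom_ae_eq (P := P) (𝓐 := F t) (𝓑 := F t ⊔ sigmaLarge c univ t)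
    (C := {A | MeasurableSet[sigmaAt F ∞] A}) le_sup_left hle
    (@MeasurableSpace.isPiSystem_measurableSet _ (sigmaAt F ∞))
    (fun A hA => sigmaAt_le F ∞ A hA)
    (fun A hA => ⟨_, stronglyMeasurable_condExp, h.condExp_sigmaLarge_ae_eq t
      (stronglyMeasurable_const.indicator hA)
      ((integrable_const (1 : ℝ)).indicator (sigmaAt_le F ∞ A hA))⟩)
    (stronglyMeasurable_const.indicator (le_sup_right (a := F t) _ hO) :
      StronglyMeasurable[F t ⊔ sigmaLarge c univ t] (O.indicator fun _ => (1 : ℝ)))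
    ((integrable_const (1 : ℝ)).indicator (h.sigmaLarge_le univ t O hO))
  rwa [@MeasurableSpace.generateFrom_measurableSet _ (sigmaAt F ∞),
    sup_eq_right.2 (le_sigmaAt_top F t)] at h1

theorem measurableSet_firstReport_le {Ω : Type*} {c : Portfolio Ω n} {i : Fin n} {s t : ℝ≥0} (hst : s ≤ t) :
    MeasurableSet[sigmaLarge c univ t] {ω | c.firstReport i ω ≤ s} :=
  Portfolio.measurableSet_report_of_le hst (generateFrom_lateEvents_le (mem_univ i) t)
    (sigmaMarks_le_sigmaLarge (mem_univ i) t) 0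

/-- By `condExp_sigmaAt_top_ae_eq` the conditioning may be on the whole filtration, where
`reportLaw` gives the probability. So a single random measure serves for all times `s`, and it
supplies monotone right-continuous paths. -/
theorem condExp_firstReport [IsProbabilityMeasure P] (h : IsModel P F c μ α₀ g) (i : Fin n)
    (s : ℝ≥0) :
    P⟦{ω | c.firstReport i ω ≤ s} | F s⟧
      =ᵐ[P] fun ω => (reportLaw P c μ i ω (Iic s)).toReal := by
  have hO : MeasurableSet {ω | c.firstReport i ω ≤ s} :=
    measurableSet_le (h.measurable_firstReport i) measurable_const
  have hle1 : ∀ᵐ ω ∂P, reportLaw P c μ i ω (Iic s) ≤ 1 :=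
    (h.ae_isRegularPath i).mono fun ω hω =>
      (measure_mono (subset_univ _)).trans (h.reportLaw_univ_le i hω)
  have hm : ∀ {B : Set Ω}, MeasurableSet[sigmaAt F ∞] B → Measurable[MeasurableSpace.prod
      inferInstance (sigmaAt F ∞)] fun z : ℝ≥0 × Ω => (Iic s ×ˢ B).indicator (1 : ℝ≥0 × Ω → ℝ≥0∞) z :=
    fun hB => measurable_indicator_prod measurableSet_Iic hB
  have hkm : Measurable[sigmaAt F ∞] fun ω => reportLaw P c μ i ω (Iic s) := by
    have h1 := h.measurable_reportLaw i (hm MeasurableSet.univ)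
    convert h1 using 2 with ω
    rw [← lintegral_indicator_one measurableSet_Iic]
    refine lintegral_congr fun u => ?_
    simp [indicator]
  refine (h.condExp_sigmaAt_top_ae_eq s (measurableSet_firstReport_le le_rfl)).symm.trans ?_
  refine (ae_eq_condExp_of_forall_setIntegral_eq (sigmaAt_le F ∞)
    ((integrable_const (1 : ℝ)).indicator hO) (fun B _ _ => ?_) (fun B hB _ => ?_)
    hkm.ennreal_toReal.stronglyMeasurable.aestronglyMeasurable).symm
  · refine Integrable.integrableOn (Integrable.of_bound (C := 1)
      (hkm.mono (sigmaAt_le F ∞) le_rfl).ennreal_toReal.aestronglyMeasurable ?_)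
    filter_upwards [hle1] with ω hω
    rw [Real.norm_of_nonneg ENNReal.toReal_nonneg]
    exact ENNReal.toReal_le_of_le_ofReal zero_le_one (by simpa using hω)
  · have hB' := sigmaAt_le F ∞ B hB
    rw [integral_toReal (hkm.mono (sigmaAt_le F ∞) le_rfl).aemeasurable
      (ae_restrict_of_ae (hle1.mono fun ω hω => hω.trans_lt ENNReal.one_lt_top)),
      integral_indicator_const _ hO, smul_eq_mul, mul_one, measureReal_def,
      Measure.restrict_apply hO]
    congr 1
    have h2 := h.lintegral_comp_firstReport i (hm hB)
    have h3 : ∫⁻ ω in B, reportLaw P c μ i ω (Iic s) ∂P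
        = ∫⁻ ω, ∫⁻ u, (Iic s ×ˢ B).indicator 1 (u, ω) ∂reportLaw P c μ i ω ∂P := by
      rw [← lintegral_indicator hB']
      refine lintegral_congr fun ω => ?_
      by_cases hω : ω ∈ B
      · rw [indicator_of_mem hω, ← lintegral_indicator_one measurableSet_Iic]
        refine lintegral_congr fun u => ?_
        simp [indicator, hω]
      · simp [indicator, hω]
    have hfin : MeasurableSet {ω | c.firstReport i ω < ∞} :=
      measurableSet_lt (h.measurable_firstReport i) measurable_const
    rw [h3, ← h2, ← lintegral_indicator hfin, ← lintegral_indicator_one (hO.inter hB')]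
    refine lintegral_congr fun ω => ?_
    by_cases h4 : c.firstReport i ω < ∞
    · have h5 : (c.firstReport i ω).toNNReal ≤ s ↔ c.firstReport i ω ≤ s := by
        rw [← ENNReal.coe_le_coe, ENNReal.coe_toNNReal h4.ne]
      rw [indicator_of_mem (by exact h4)]
      have h6 : ((c.firstReport i ω).toNNReal, ω) ∈ Iic s ×ˢ B
          ↔ ω ∈ {ω | c.firstReport i ω ≤ s} ∩ B := and_congr_left' h5
      by_cases h7 : ω ∈ {ω | c.firstReport i ω ≤ s} ∩ B
      · rw [indicator_of_mem h7, indicator_of_mem (h6.2 h7)]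
        rfl
      · rw [indicator_of_notMem h7, indicator_of_notMem (fun h8 => h7 (h6.1 h8))]
    · rw [indicator_of_notMem (by exact h4), indicator_of_notMem]
      exact fun h5 => h4 (h5.1.trans_lt ENNReal.coe_lt_top)

/-- Agreement at countably many dense times extends to all times by right-continuity. This is why
the formula does not depend on the version `A`. -/
theorem ae_eq_reportLaw_Iic [IsProbabilityMeasure P] (h : IsModel P F c μ α₀ g) {i : Fin n}
    {A : Ω → StieltjesFunction ℝ≥0} (hA : IsReportVersion P F c i A) :
    ∀ᵐ ω ∂P, ∀ u, A ω u = (reportLaw P c μ i ω (Iic u)).toReal := by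
  obtain ⟨Q, hQc, hQd⟩ := TopologicalSpace.exists_countable_dense ℝ≥0
  have h1 : ∀ᵐ ω ∂P, ∀ q ∈ Q, A ω q = (reportLaw P c μ i ω (Iic q)).toReal :=
    (ae_ball_iff hQc).2 fun q _ => (hA q).trans (h.condExp_firstReport i q)
  filter_upwards [h1, h.ae_isRegularPath i] with ω hω hr
  have : IsFiniteMeasure (reportLaw P c μ i ω) :=
    ⟨(h.reportLaw_univ_le i hr).trans_lt ENNReal.one_lt_top⟩
  exact eq_of_dense_of_right_continuous (A ω).right_continuous'
    (distributionFunction (reportLaw P c μ i ω)).right_continuous' hQd hω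

theorem ae_restrict_measure_eq [IsProbabilityMeasure P] (h : IsModel P F c μ α₀ g) {i : Fin n}
    {A : Ω → StieltjesFunction ℝ≥0} (hA : IsReportVersion P F c i A) {t T : ℝ≥0} (htT : t ≤ T) :
    ∀ᵐ ω ∂P, (A ω).measure.restrict (Ioc t T) = (reportLaw P c μ i ω).restrict (Ioc t T) := by
  filter_upwards [h.ae_eq_reportLaw_Iic hA, h.ae_isRegularPath i] with ω hω hr
  have : IsFiniteMeasure (reportLaw P c μ i ω) :=
    ⟨(h.reportLaw_univ_le i hr).trans_lt ENNReal.one_lt_top⟩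
  have hAω : A ω = distributionFunction (reportLaw P c μ i ω) := StieltjesFunction.ext hω
  rw [hAω, distributionFunction_measure_restrict _ htT]

open Classical in
/-- The distribution functions of the conditional law of the first reporting time form a version of
the conditional distribution process. -/
theorem exists_isReportVersion [IsProbabilityMeasure P] (h : IsModel P F c μ α₀ g) (i : Fin n) :
    ∃ A, IsReportVersion P F c i A ∧ ∀ᵐ ω ∂P, ∀ s : ℝ≥0, A ω s = explicitReportProb μ α₀ g s ω := by
  -- An infinite law can occur only on a null set; there the distribution function of the zero
  -- measure is a harmless default.
  let A : Ω → StieltjesFunction ℝ≥0 := fun ω =>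
    if hω : IsFiniteMeasure (reportLaw P c μ i ω) then distributionFunction (reportLaw P c μ i ω)
    else distributionFunction 0
  have hA : ∀ ω, IsRegularPath μ ω → ∀ u, A ω u = (reportLaw P c μ i ω (Iic u)).toReal := by
    intro ω hω u
    have : IsFiniteMeasure (reportLaw P c μ i ω) :=
      ⟨(h.reportLaw_univ_le i hω).trans_lt ENNReal.one_lt_top⟩
    simp only [A, dif_pos this]
    rfl
  refine ⟨A, fun u => ?_, ?_⟩
  · filter_upwards [h.condExp_firstReport i u, h.ae_isRegularPath i] with ω h1 h2
    rw [h1, hA ω h2]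
  · filter_upwards [h.ae_isRegularPath i] with ω hω s
    rw [hA ω hω, h.toReal_reportLaw_Iic i s hω]

theorem condExp_firstReport_explicit [IsProbabilityMeasure P] (h : IsModel P F c μ α₀ g)
    (i : Fin n) (s : ℝ≥0) :
    P⟦{ω | c.firstReport i ω ≤ s} | F s⟧ =ᵐ[P] explicitReportProb μ α₀ g s := by
  filter_upwards [h.condExp_firstReport i s, h.ae_isRegularPath i] with ω h1 h2
  rw [h1, h.toReal_reportLaw_Iic i s h2]

end IsModel

end Insurance

end

/-! ### One policy on its canonical space; its history around the first report. -/

section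
namespace Insurance

/-- The data of a single policy up to the first reporting: accident time, delay and first mark. -/
abbrev FirstData := ℝ≥0∞ × ℝ≥0 × ℝ≥0

/-- The space of developments. -/
abbrev DevData := ℕ → ℝ≥0∞ × ℝ≥0

/-- The portfolio consisting of a single policy on its canonical space. -/
def canonicalPortfolio : Portfolio (FirstData × DevData) 1 where
  accident _ z := z.1.1
  delay _ z := z.1.2.1
  firstMark _ z := z.1.2.2
  devTime _ j z := (z.2 j).1
  devMark _ j z := (z.2 j).2

theorem indicator_const_eq_of_iff {α β : Type*} {s : Set α} {t : Set β} {a : α} {b : β}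
    (h : a ∈ s ↔ b ∈ t) :
    s.indicator (fun _ => (1 : ℝ≥0∞)) a = t.indicator (fun _ => (1 : ℝ≥0∞)) b := by
  by_cases hb : b ∈ t
  · rw [indicator_of_mem hb, indicator_of_mem (h.2 hb)]
  · rw [indicator_of_notMem hb, indicator_of_notMem (fun ha => hb (h.1 ha))]

namespace Portfolio

variable {Ω : Type*} {n : ℕ} (c : Portfolio Ω n) (i : Fin n)

/-- Accident time, delay and first mark of a policy. -/
def firstData (ω : Ω) : FirstData := (c.accident i ω, c.delay i ω, c.firstMark i ω)

/-- Turns an event of the history into a condition on the pair of first data and development, so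
that the former can be frozen while the latter is integrated out. -/
theorem sigmaPolicy_eq_comap (t : ℝ≥0) :
    c.sigmaPolicy i t = (canonicalPortfolio.sigmaPolicy 0 t).comap
      fun ω => (c.firstData i ω, c.development i ω) := by
  unfold sigmaPolicy naturalSigma
  simp only [MeasurableSpace.comap_iSup, MeasurableSpace.comap_comp]
  have h1 : ∀ j ω, canonicalPortfolio.reportTime 0 j (c.firstData i ω, c.development i ω)
      = c.reportTime i j ω := by
    rintro (_ | j) ω <;> rfl
  have h2 : ∀ j ω, canonicalPortfolio.mark 0 j (c.firstData i ω, c.development i ω)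
      = c.mark i j ω := by
    rintro (_ | j) ω <;> rfl
  refine iSup_congr fun s => iSup_congr fun _ => iSup_congr fun B => iSup_congr fun _ => ?_
  congr 1
  ext ω
  refine tsum_congr fun j => indicator_const_eq_of_iff ?_
  rw [mem_ofPred_eq, mem_ofPred_eq, h1, h2]

/-- Given the data of the first reporting at time `x ≤ t`, the information about the policy up to
time `t` is the information about the development up to time `t - x`. -/
theorem measurable_prodMk_development {e : FirstData} {t : ℝ≥0} (he : e.1 + e.2.1 ≤ t) :
    Measurable[c.sigmaDev i (t - (e.1 + e.2.1).toNNReal), canonicalPortfolio.sigmaPolicy 0 t]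
      fun ω => (e, c.development i ω) := by
  obtain ⟨x, hx⟩ : ∃ x : ℝ≥0, e.1 + e.2.1 = x :=
    ⟨_, (ENNReal.coe_toNNReal (he.trans_lt ENNReal.coe_lt_top).ne).symm⟩
  rw [hx] at he
  rw [hx, ENNReal.toNNReal_coe, measurable_iff_comap_le, sigmaPolicy, naturalSigma]
  simp only [MeasurableSpace.comap_iSup, MeasurableSpace.comap_comp, iSup_le_iff]
  intro s hs B hB
  rw [← measurable_iff_comap_le]
  by_cases hxs : x ≤ s
  -- Updates carry the delay mark `0`, so only the section of `B` at `0` matters for them. The first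
  -- report at `x ≤ s` contributes a constant, since its mark is frozen.
  · set B' : Set ℝ≥0 := {y | ((0 : ℝ≥0), y) ∈ B} with hB'
    have hBm : MeasurableSet B' := measurable_prodMk_left hB
    have h1 : markedCount (canonicalPortfolio.reportTime 0) (canonicalPortfolio.mark 0) s B ∘
        (fun ω => (e, c.development i ω)) = fun ω => B.indicator (fun _ => (1 : ℝ≥0∞)) e.2
          + markedCount (c.devTime i) (c.devMark i) (s - x) B' ω := by
      ext ω
      simp only [Function.comp, markedCount]
      rw [tsum_eq_zero_add' ENNReal.summable]
      congr 1
      · have h2 : canonicalPortfolio.reportTime 0 0 (e, c.development i ω) = x := hx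
        have h3 : canonicalPortfolio.mark 0 0 (e, c.development i ω) = e.2 := rfl
        have h4 : (x : ℝ≥0∞) ≤ s := by exact_mod_cast hxs
        refine indicator_const_eq_of_iff ?_
        rw [mem_ofPred_eq, h2, h3]
        exact and_iff_right h4
      · refine tsum_congr fun j => ?_
        have h2 : canonicalPortfolio.reportTime 0 (j + 1) (e, c.development i ω)
            = x + c.devTime i j ω := by
          rw [← hx]
          rfl
        have h3 : canonicalPortfolio.mark 0 (j + 1) (e, c.development i ω)
            = (0, c.devMark i j ω) := rfl
        have h4 : (x : ℝ≥0∞) + c.devTime i j ω ≤ s ↔ c.devTime i j ω ≤ ((s - x : ℝ≥0) : ℝ≥0∞) := by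
          rw [ENNReal.coe_sub]
          exact (ENNReal.le_sub_iff_add_le_left ENNReal.coe_ne_top (by exact_mod_cast hxs)).symm
        refine indicator_const_eq_of_iff ?_
        rw [mem_ofPred_eq, mem_ofPred_eq, h2, h3, h4]
        rfl
    rw [h1]
    have h2 : Measurable[c.sigmaDev i (t - x)]
        (markedCount (c.devTime i) (c.devMark i) (s - x) B') :=
      measurable_iff_comap_le.2 (le_iSup_of_le (s - x) (le_iSup_of_le (tsub_le_tsub_right hs x)
        (le_iSup_of_le B' (le_iSup_of_le hBm le_rfl))))
    exact h2.const_add _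
  · have h1 : markedCount (canonicalPortfolio.reportTime 0) (canonicalPortfolio.mark 0) s B ∘
        (fun ω => (e, c.development i ω)) = fun _ => 0 := by
      ext ω
      refine ENNReal.tsum_eq_zero.2 fun j => indicator_of_notMem (fun h2 => hxs ?_) _
      have h3 : (x : ℝ≥0∞) ≤ canonicalPortfolio.reportTime 0 j (e, c.development i ω) := by
        cases j with
        | zero => exact hx.ge
        | succ j => exact hx.ge.trans le_self_add
      exact_mod_cast h3.trans h2.1
    rw [h1]
    exact measurable_const

/-- Before the first reporting, there is no information about the policy. -/
theorem inter_lt_firstReport_of_sigmaPolicy {t : ℝ≥0} {A : Set Ω}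
    (hA : MeasurableSet[c.sigmaPolicy i t] A) :
    A ∩ {ω | (t : ℝ≥0∞) < c.firstReport i ω} = ∅ ∨
      A ∩ {ω | (t : ℝ≥0∞) < c.firstReport i ω} = {ω | (t : ℝ≥0∞) < c.firstReport i ω} := by
  set D := {ω | (t : ℝ≥0∞) < c.firstReport i ω} with hD
  -- On `D` nothing has been reported by time `t`, so all counts vanish and the trace of the history
  -- is trivial.
  have h1 : (c.sigmaPolicy i t).comap (Subtype.val : D → Ω) = ⊥ := by
    rw [sigmaPolicy, naturalSigma]
    simp only [MeasurableSpace.comap_iSup, MeasurableSpace.comap_comp, iSup_eq_bot]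
    intro s hs B hB
    have h2 : markedCount (c.reportTime i) (c.mark i) s B ∘ (Subtype.val : D → Ω) = fun _ => 0 := by
      ext ω
      refine ENNReal.tsum_eq_zero.2 fun j => indicator_of_notMem (fun h3 => ?_) _
      have h4 : c.firstReport i ω ≤ c.reportTime i j ω := by
        cases j with
        | zero => exact le_rfl
        | succ j => exact le_self_add
      have h5 : (s : ℝ≥0∞) ≤ t := by exact_mod_cast hs
      exact absurd (ω.2 : (t : ℝ≥0∞) < _) (not_lt.2 ((h4.trans h3.1).trans h5))
    rw [h2, MeasurableSpace.comap_const]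
  have h2 : MeasurableSet[(c.sigmaPolicy i t).comap (Subtype.val : D → Ω)]
      (Subtype.val ⁻¹' A) := ⟨A, hA, rfl⟩
  rw [h1, MeasurableSpace.measurableSet_bot_iff] at h2
  rw [inter_comm, ← Subtype.image_preimage_coe]
  rcases h2 with h2 | h2
  · left
    rw [h2, image_empty]
  · right
    rw [h2, image_univ, Subtype.range_coe]

end Portfolio

end Insurance

end

/-! ### Expected payments after and before the first report. -/

section
namespace Insurance

theorem measurable_devSum_prod {Ω : Type*} {m : MeasurableSpace Ω} {z : ℝ≥0 → Ω → ℝ≥0∞}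
    (hz : Measurable fun q : ℝ≥0 × Ω => z q.1 q.2) (t T : ℝ≥0) {τ : Ω → ℝ≥0∞}
    (hτ : Measurable τ) :
    Measurable fun q : Ω × DevData => devSum (fun u => z u q.1) t T (τ q.1) q.2 := by
  have h1 : Measurable fun q : (Ω × DevData) × ℝ≥0 => z q.2 q.1.1 :=
    hz.comp (measurable_snd.prodMk measurable_fst.fst)
  exact measurable_devSum (β := Ω × DevData) (φ := fun q u => z u q.1) h1
    measurable_const T (hτ.comp measurable_fst) measurable_snd

theorem devSum_eq_zero_of_lt {φ : ℝ≥0 → ℝ≥0∞} {t T : ℝ≥0} {x : ℝ≥0∞} (hx : (T : ℝ≥0∞) < x)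
    (d : DevData) : devSum φ t T x d = 0 :=
  ENNReal.tsum_eq_zero.2 fun _ => indicator_of_notMem
    (fun h => absurd h.2 (not_le.2 (hx.trans_le le_self_add))) _

/-- The updates after the first reporting at time `u` are those after any earlier time `t`. -/
theorem devSum_eq_of_pos {φ : ℝ≥0 → ℝ≥0∞} {t T u : ℝ≥0} (htu : t ≤ u) {d : DevData}
    (hd : ∀ j, 0 < (d j).1) : devSum φ t T u d = devSum φ u T u d := by
  refine tsum_congr fun j => ?_
  have h1 : (u : ℝ≥0∞) < u + (d j).1 := ENNReal.lt_add_right ENNReal.coe_ne_top (hd j).ne'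
  have h2 : (t : ℝ≥0∞) < u + (d j).1 := lt_of_le_of_lt (by exact_mod_cast htu) h1
  by_cases h3 : u + (d j).1 ≤ T
  · rw [indicator_of_mem (by exact ⟨h2, h3⟩), indicator_of_mem (by exact ⟨h1, h3⟩)]
  · rw [indicator_of_notMem (fun h => h3 h.2), indicator_of_notMem (fun h => h3 h.2)]

section Definitions

variable {Ω : Type*} {n : ℕ}

/-- The sum of all `z`-weighted amounts reported during `(t, T]`. -/
def payment (c : Portfolio Ω n) (i : Fin n) (z : ℝ≥0 → Ω → ℝ≥0∞) (t T : ℝ≥0) (ω : Ω) : ℝ≥0∞ :=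
  {u : ℝ≥0∞ | t < u ∧ u ≤ T}.indicator (fun u => (c.firstMark i ω : ℝ≥0∞) * z u.toNNReal ω)
      (c.firstReport i ω)
    + devSum (fun u => z u ω) t T (c.firstReport i ω) (c.development i ω)

/-- The expectation of the sum of the weighted updates during `(t, T]`, if the first reporting
happens at time `x` and the weight function is fixed. -/
def devMean [MeasurableSpace Ω] (P : Measure Ω) (c : Portfolio Ω n) (i : Fin n)
    (z : ℝ≥0 → Ω → ℝ≥0∞) (t T : ℝ≥0) (x : ℝ≥0∞) (ω : Ω) : ℝ≥0∞ :=
  ∫⁻ ω', devSum (fun u => z u ω) t T x (c.development i ω') ∂P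

end Definitions

variable {Ω : Type*} [mΩ : MeasurableSpace Ω] {n : ℕ} {P : Measure Ω} {F : Filtration ℝ≥0 mΩ}
  {c : Portfolio Ω n} {μ : ℝ≥0 → Ω → ℝ} {α₀ : ℝ} {g : ℝ → ℝ} {i : Fin n} {z : ℝ≥0 → Ω → ℝ≥0∞}

theorem canonical_sigmaPolicy_le (t : ℝ≥0) :
    canonicalPortfolio.sigmaPolicy 0 t ≤ (inferInstance : MeasurableSpace (FirstData × DevData)) := by
  have h1 : Measurable fun q : FirstData × DevData => q.1.1 + (q.1.2.1 : ℝ≥0∞) :=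
    measurable_fst.fst.add measurable_fst.snd.fst.coe_nnreal_ennreal
  have h2 : ∀ j, Measurable fun q : FirstData × DevData => q.2 j := fun j =>
    (measurable_pi_apply j).comp measurable_snd
  refine naturalSigma_le fun s _ B hB j => ?_
  cases j with
  | zero => exact (measurableSet_le h1 measurable_const).inter (measurable_fst.snd hB)
  | succ j =>
    exact (measurableSet_le (h1.add (h2 j).fst) measurable_const).inter
      ((measurable_const.prodMk (h2 j).snd : Measurable fun q : FirstData × DevData =>
        ((0 : ℝ≥0), (q.2 j).2)) hB)

namespace IsModel

/-- The reference filtration, all accident times, and the data of the first reporting of policy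
`i`. -/
@[reducible] def sigmaPre (F : Filtration ℝ≥0 mΩ) (c : Portfolio Ω n) (i : Fin n) :
    MeasurableSpace Ω :=
  sigmaBase F c ⊔ MeasurableSpace.comap (c.firstData i) inferInstance

/-- The reference filtration, all accident times, and the delay of policy `i`. -/
@[reducible] def sigmaReport (F : Filtration ℝ≥0 mΩ) (c : Portfolio Ω n) (i : Fin n) :
    MeasurableSpace Ω :=
  sigmaBase F c ⊔ MeasurableSpace.comap (c.delay i) inferInstance

theorem measurable_firstData_sigmaPre : Measurable[sigmaPre F c i] (c.firstData i) :=
  measurable_iff_comap_le.2 le_sup_right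

theorem measurable_firstReport_sigmaPre : Measurable[sigmaPre F c i] (c.firstReport i) :=
  (measurable_firstData_sigmaPre (F := F)).fst.add
    (measurable_firstData_sigmaPre (F := F)).snd.fst.coe_nnreal_ennreal

theorem sigmaAt_le_sigmaPre : sigmaAt F ∞ ≤ sigmaPre F c i := le_sup_of_le_left le_sup_left

theorem measurable_sigmaPre_of_sigmaAt {β γ : Type*} [MeasurableSpace β] [MeasurableSpace γ]
    {f : β × Ω → γ} (hf : Measurable[MeasurableSpace.prod inferInstance (sigmaAt F ∞)] f) :
    Measurable[MeasurableSpace.prod inferInstance (sigmaPre F c i)] f :=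
  hf.mono (sup_le_sup_left (MeasurableSpace.comap_mono sigmaAt_le_sigmaPre) _) le_rfl

theorem measurable_firstData (h : IsModel P F c μ α₀ g) (i : Fin n) : Measurable (c.firstData i) :=
  (h.measurable_accident i).prodMk ((h.measurable_delay i).prodMk (h.measurable_firstMark i))

theorem sigmaPre_le (h : IsModel P F c μ α₀ g) (i : Fin n) : sigmaPre F c i ≤ mΩ :=
  sup_le h.sigmaBase_le (h.measurable_firstData i).comap_le

theorem indep_development (h : IsModel P F c μ α₀ g) (i : Fin n) :
    Indep (sigmaPre F c i) (MeasurableSpace.comap (c.development i) inferInstance) P := by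
  refine (indep_of_indep_of_le h.development_indep (le_iSup (fun k =>
    MeasurableSpace.comap (c.development k) inferInstance) i) ?_).symm
  have h1 : ∀ k, Measurable[sigmaAt F ∞ ⊔ ⨆ i, MeasurableSpace.comap
      (fun ω => (c.firstReport i ω, c.delay i ω, c.firstMark i ω)) inferInstance]
      (fun ω => (c.firstReport k ω, c.delay k ω, c.firstMark k ω)) := fun k =>
    (comap_measurable _).mono ((le_iSup (fun i => MeasurableSpace.comap
      (fun ω => (c.firstReport i ω, c.delay i ω, c.firstMark i ω)) inferInstance) k).trans
        le_sup_right) le_rfl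
  have h2 : ∀ k, Measurable[sigmaAt F ∞ ⊔ ⨆ i, MeasurableSpace.comap
      (fun ω => (c.firstReport i ω, c.delay i ω, c.firstMark i ω)) inferInstance]
      (c.accident k) := by
    intro k
    have h3 : c.accident k = fun ω => c.firstReport k ω - c.delay k ω := by
      ext ω
      exact (ENNReal.add_sub_cancel_right ENNReal.coe_ne_top).symm
    rw [h3]
    exact (h1 k).fst.sub (h1 k).snd.fst.coe_nnreal_ennreal
  exact sup_le (sup_le le_sup_left (iSup_le fun k => (h2 k).comap_le))
    ((h2 i).prodMk (h1 i).snd).comap_le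

/-- The first mark is assumed independent of filtration and accident times; the delay is independent
of these together with the first marks, so `Indep.assoc` moves it to the other side. -/
theorem indep_firstMark [IsProbabilityMeasure P] (h : IsModel P F c μ α₀ g) (i : Fin n) :
    Indep (sigmaReport F c i)
      (MeasurableSpace.comap (c.firstMark i) inferInstance) P := by
  refine (Indep.assoc (h.measurable_firstMark i).comap_le h.sigmaBase_le
    (h.measurable_delay i).comap_le ?_ ?_).symm
  · exact indep_of_indep_of_le_left h.firstMark_indep (le_iSup (fun k =>
      MeasurableSpace.comap (c.firstMark k) inferInstance) i)
  · refine (indep_of_indep_of_le h.delay_indep (le_iSup (fun k =>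
      MeasurableSpace.comap (c.delay k) inferInstance) i) ?_).symm
    have h1 : ∀ k, Measurable[sigmaAt F ∞ ⊔ ⨆ i, MeasurableSpace.comap
        (fun ω => (c.accident i ω, c.firstMark i ω)) inferInstance]
        (fun ω => (c.accident k ω, c.firstMark k ω)) := fun k =>
      (comap_measurable _).mono ((le_iSup (fun i => MeasurableSpace.comap
        (fun ω => (c.accident i ω, c.firstMark i ω)) inferInstance) k).trans le_sup_right) le_rfl
    exact sup_le (h1 i).snd.comap_le
      (sup_le le_sup_left (iSup_le fun k => (h1 k).fst.comap_le))

theorem ae_devTime_pos (h : IsModel P F c μ α₀ g) (i : Fin n) :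
    ∀ᵐ ω ∂P, ∀ j, 0 < c.devTime i j ω := by
  filter_upwards [h.devTime_pos i, h.devTime_lt i] with ω h1 h2 j
  induction j with
  | zero => exact h1
  | succ j hj => exact hj.trans_le (h2 j).1

theorem devMean_eq_zero_of_lt {t T : ℝ≥0} {x : ℝ≥0∞} (hx : (T : ℝ≥0∞) < x) (ω : Ω) :
    devMean P c i z t T x ω = 0 := by
  simp only [devMean, devSum_eq_zero_of_lt hx, lintegral_zero]

theorem measurable_devMean [IsProbabilityMeasure P] (h : IsModel P F c μ α₀ g) (i : Fin n)
    {β : Type*} {mβ : MeasurableSpace β} {Z : ℝ≥0 → β → ℝ≥0∞}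
    (hZ : Measurable fun q : ℝ≥0 × β => Z q.1 q.2) (t T : ℝ≥0) {τ : β → ℝ≥0∞} (hτ : Measurable τ) :
    Measurable fun b => ∫⁻ ω', devSum (fun u => Z u b) t T (τ b) (c.development i ω') ∂P := by
  have h1 : Measurable fun q : β × Ω =>
      devSum (fun u => Z u q.1) t T (τ q.1) (c.development i q.2) :=
    (measurable_devSum_prod hZ t T hτ).comp
      (measurable_fst.prodMk ((h.measurable_development i).comp measurable_snd))
  exact h1.lintegral_prod_right'

/-- After the first reporting, future updates may be replaced by their expectations. -/
theorem setLIntegral_devSum_firstReport [IsProbabilityMeasure P] (h : IsModel P F c μ α₀ g)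
    {t T : ℝ≥0} (hS : HasIndepDevIncrements P c i T) (htT : t ≤ T)
    (hz : Measurable[MeasurableSpace.prod inferInstance (sigmaAt F ∞)]
      fun q : ℝ≥0 × Ω => z q.1 q.2)
    {A B : Set Ω} (hA : MeasurableSet[F t] A) (hB : MeasurableSet[c.sigmaPolicy i t] B) :
    ∫⁻ ω in A ∩ B ∩ {ω | c.firstReport i ω ≤ t},
        devSum (fun u => z u ω) t T (c.firstReport i ω) (c.development i ω) ∂P
      = ∫⁻ ω in A ∩ B ∩ {ω | c.firstReport i ω ≤ t}, devMean P c i z t T (c.firstReport i ω) ω ∂P := by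
  have hBm := h.sigmaPolicy_le i t B hB
  rw [c.sigmaPolicy_eq_comap i t] at hB
  obtain ⟨S, hSm, rfl⟩ := hB
  have hSm' : MeasurableSet S := canonical_sigmaPolicy_le t S hSm
  set D := {ω | c.firstReport i ω ≤ t} with hD
  have hDm : MeasurableSet[sigmaPre F c i] D :=
    measurableSet_le (measurable_firstReport_sigmaPre (F := F)) measurable_const
  have hADm : MeasurableSet[sigmaPre F c i] (A ∩ D) :=
    MeasurableSet.inter (((le_sigmaAt_top F t).trans sigmaAt_le_sigmaPre) _ hA) hDm
  have hz' := measurable_sigmaPre_of_sigmaAt (c := c) (i := i) hz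
  have hzΩ : Measurable fun q : ℝ≥0 × Ω => z q.1 q.2 := hz.mono (prod_sigmaAt_le F) le_rfl
  have hfst : Measurable[(sigmaPre F c i).prod inferInstance, sigmaPre F c i]
      fun q : Ω × DevData => q.1 := @measurable_fst _ _ (sigmaPre F c i) _
  have hsnd : Measurable[(sigmaPre F c i).prod inferInstance]
      fun q : Ω × DevData => q.2 := @measurable_snd _ _ (sigmaPre F c i) _
  have hm1 : Measurable[(sigmaPre F c i).prod inferInstance] fun q : Ω × DevData =>
      (A ∩ D).indicator (fun _ => (1 : ℝ≥0∞)) q.1 * S.indicator (fun _ => (1 : ℝ≥0∞))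
        (c.firstData i q.1, q.2) :=
    ((measurable_const.indicator hADm).comp hfst).mul ((measurable_const.indicator hSm').comp
      (((measurable_firstData_sigmaPre (F := F)).comp hfst).prodMk hsnd))
  have hm2 : Measurable[(sigmaPre F c i).prod inferInstance] fun q : Ω × DevData =>
      devSum (fun u => z u q.1) t T (c.firstReport i q.1) q.2 :=
    measurable_devSum_prod (m := sigmaPre F c i) hz' t T measurable_firstReport_sigmaPre
  have hm3 : Measurable[(sigmaPre F c i).prod inferInstance] fun q : Ω × DevData =>
      devMean P c i z t T (c.firstReport i q.1) q.1 :=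
    (h.measurable_devMean i (mβ := sigmaPre F c i) hz' t T
      measurable_firstReport_sigmaPre).comp hfst
  have hind := h.indep_development i
  have hle := h.sigmaPre_le i
  have hVm := h.measurable_development i
  -- The development is replaced by an independent copy, evaluated at `ω'`, while weights and first
  -- data stay frozen at `ω`. The two sides are then compared for each `ω` separately.
  have e1 := lintegral_comp_of_indep hle hVm hind (hm1.mul hm2)
  have e2 := lintegral_comp_of_indep hle hVm hind (hm1.mul hm3)
  have hset : ∀ ω, (A ∩ (fun ω => (c.firstData i ω, c.development i ω)) ⁻¹' S ∩ D).indicator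
      (fun _ => (1 : ℝ≥0∞)) ω = (A ∩ D).indicator (fun _ => (1 : ℝ≥0∞)) ω
        * S.indicator (fun _ => (1 : ℝ≥0∞)) (c.firstData i ω, c.development i ω) := by
    intro ω
    by_cases h1 : ω ∈ A ∩ D
    · rw [indicator_of_mem h1, one_mul]
      refine indicator_const_eq_of_iff ⟨fun h2 => h2.1.2, fun h2 => ⟨⟨h1.1, h2⟩, h1.2⟩⟩
    · rw [indicator_of_notMem h1, zero_mul,
        indicator_of_notMem (fun h2 => h1 ⟨h2.1.1, h2.2⟩)]
  have hsm : MeasurableSet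
      (A ∩ (fun ω => (c.firstData i ω, c.development i ω)) ⁻¹' S ∩ D) :=
    ((F.le t A hA).inter hBm).inter (hle _ hDm)
  have hres : ∀ f : Ω → ℝ≥0∞,
      ∫⁻ ω in A ∩ (fun ω => (c.firstData i ω, c.development i ω)) ⁻¹' S ∩ D, f ω ∂P
      = ∫⁻ ω, (A ∩ D).indicator (fun _ => (1 : ℝ≥0∞)) ω
        * S.indicator (fun _ => (1 : ℝ≥0∞)) (c.firstData i ω, c.development i ω) * f ω ∂P := by
    intro f
    rw [← lintegral_indicator hsm]
    refine lintegral_congr fun ω => ?_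
    rw [← hset ω]
    by_cases h1 : ω ∈ A ∩ (fun ω => (c.firstData i ω, c.development i ω)) ⁻¹' S ∩ D
    · rw [indicator_of_mem h1, indicator_of_mem h1, one_mul]
    · rw [indicator_of_notMem h1, indicator_of_notMem h1, zero_mul]
  rw [hres, hres]
  refine e1.trans (Eq.trans (lintegral_congr fun ω => ?_) e2.symm)
  by_cases hω : ω ∈ A ∩ D
  · simp only [Pi.mul_apply, indicator_of_mem hω, one_mul]
    have he : (c.firstData i ω).1 + (c.firstData i ω).2.1 ≤ t := hω.2
    obtain ⟨x, hx⟩ : ∃ x : ℝ≥0, c.firstReport i ω = x :=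
      ⟨_, (ENNReal.coe_toNNReal (he.trans_lt ENNReal.coe_lt_top).ne).symm⟩
    have hx' : (c.firstData i ω).1 + (c.firstData i ω).2.1 = (x : ℝ≥0∞) := hx
    -- With the report frozen at `x ≤ t`, the section of `S` depends on the development up to `t -
    -- x` only, so independent increments separate it from the later updates.
    have hC := c.measurable_prodMk_development i he hSm
    rw [hx', ENNReal.toNNReal_coe] at hC
    rw [hx'] at he
    have hC' := Portfolio.sigmaDev_le (h.sigmaMarks_le i) _ _ hC
    have key := h.setLIntegral_devSum_of_indep hS (by exact_mod_cast he) htT hC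
      (φ := fun u => z u ω) (hzΩ.comp measurable_prodMk_right)
    have hmul : ∀ f : Ω → ℝ≥0∞, ∫⁻ ω', S.indicator (fun _ => (1 : ℝ≥0∞))
        (c.firstData i ω, c.development i ω') * f ω' ∂P
        = ∫⁻ ω' in (fun ω' => (c.firstData i ω, c.development i ω')) ⁻¹' S, f ω' ∂P := by
      intro f
      rw [← lintegral_indicator hC']
      refine lintegral_congr fun ω' => ?_
      by_cases h1 : ω' ∈ (fun ω' => (c.firstData i ω, c.development i ω')) ⁻¹' S
      · rw [indicator_of_mem h1, indicator_of_mem (by exact h1), one_mul]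
      · rw [indicator_of_notMem h1, indicator_of_notMem (by exact h1), zero_mul]
    rw [hmul, hmul, hx, key, setLIntegral_const, mul_comm]
    rfl
  · simp only [Pi.mul_apply, indicator_of_notMem hω, zero_mul]

/-- The expected discounted future payments, given the first reporting during `(t, T]`. -/
def reportMean (h : IsModel P F c μ α₀ g) (i : Fin n) (z : ℝ≥0 → Ω → ℝ≥0∞) (t T : ℝ≥0) (ω : Ω) :
    ℝ≥0∞ :=
  ∫⁻ u in Ioc t T, ((∫⁻ ω', c.firstMark i ω' ∂P) * z u ω
    + ∫⁻ v in Ioc u T, z v ω ∂(h.shiftedMeanDev i u).measure) ∂reportLaw P c μ i ω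

theorem devMean_eq [IsProbabilityMeasure P] (h : IsModel P F c μ α₀ g) {t T x : ℝ≥0} (hxt : x ≤ t)
    (htT : t ≤ T) (ω : Ω) (hz : Measurable fun u => z u ω) :
    devMean P c i z t T x ω = ∫⁻ v in Ioc t T, z v ω ∂(h.shiftedMeanDev i x).measure :=
  h.lintegral_devSum i hxt htT hz

theorem devMean_eq_of_le [IsProbabilityMeasure P] (h : IsModel P F c μ α₀ g) {t T u : ℝ≥0}
    (htu : t ≤ u) (huT : u ≤ T) (ω : Ω) (hz : Measurable fun u => z u ω) :
    devMean P c i z t T u ω = ∫⁻ v in Ioc u T, z v ω ∂(h.shiftedMeanDev i u).measure := by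
  rw [← h.devMean_eq le_rfl huT ω hz]
  refine lintegral_congr_ae ?_
  filter_upwards [h.ae_devTime_pos i] with ω' hω'
  exact devSum_eq_of_pos htu hω'

/-- Before the first reporting. -/
theorem setLIntegral_payment_late [IsProbabilityMeasure P] (h : IsModel P F c μ α₀ g)
    {t T : ℝ≥0} (hz : Measurable[MeasurableSpace.prod inferInstance (sigmaAt F ∞)]
      fun q : ℝ≥0 × Ω => z q.1 q.2)
    {A : Set Ω} (hA : MeasurableSet[sigmaAt F ∞] A) :
    ∫⁻ ω in A ∩ {ω | (t : ℝ≥0∞) < c.firstReport i ω}, payment c i z t T ω ∂P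
      = ∫⁻ ω in A, h.reportMean i z t T ω ∂P := by
  have hz' := measurable_sigmaPre_of_sigmaAt (c := c) (i := i) hz
  have hzΩ : Measurable fun q : ℝ≥0 × Ω => z q.1 q.2 := hz.mono (prod_sigmaAt_le F) le_rfl
  have hzω : ∀ ω, Measurable fun u => z u ω := fun ω => hzΩ.comp measurable_prodMk_right
  have hAΩ := sigmaAt_le F ∞ A hA
  set E := ∫⁻ ω', c.firstMark i ω' ∂P with hE
  set L := {ω | (t : ℝ≥0∞) < c.firstReport i ω} with hL
  have hτ := h.measurable_firstReport i
  have hLm : MeasurableSet L := measurableSet_lt measurable_const hτ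
  -- the first mark
  have hfirst : ∫⁻ ω in A ∩ L, {u : ℝ≥0∞ | t < u ∧ u ≤ T}.indicator
        (fun u => (c.firstMark i ω : ℝ≥0∞) * z u.toNNReal ω) (c.firstReport i ω) ∂P
      = ∫⁻ ω in A ∩ L, {u : ℝ≥0∞ | t < u ∧ u ≤ T}.indicator
        (fun u => E * z u.toNNReal ω) (c.firstReport i ω) ∂P := by
    have hle : sigmaReport F c i ≤ mΩ := sup_le h.sigmaBase_le (h.measurable_delay i).comap_le
    have hτr : Measurable[sigmaReport F c i] (c.firstReport i) := by
      have h1 : Measurable[sigmaReport F c i] (c.accident i) := measurable_iff_comap_le.2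
        (((le_iSup c.sigmaAccident i).trans le_sup_right).trans le_sup_left)
      have h2 : Measurable[sigmaReport F c i] (c.delay i) := measurable_iff_comap_le.2 le_sup_right
      exact h1.add h2.coe_nnreal_ennreal
    have hzτ : Measurable[sigmaReport F c i] fun ω => z (c.firstReport i ω).toNNReal ω :=
      measurable_comp_prodMk (mβ := sigmaAt F ∞) hz hτr.ennreal_toNNReal
        (measurable_id'' (le_sup_left.trans le_sup_left))
    set G := A ∩ L ∩ {ω | c.firstReport i ω ≤ T} with hG
    have hGm : MeasurableSet[sigmaReport F c i] G :=
      (MeasurableSet.inter ((le_sup_left.trans le_sup_left : sigmaAt F ∞ ≤ sigmaReport F c i) _ hA)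
        (measurableSet_lt measurable_const hτr)).inter (measurableSet_le hτr measurable_const)
    have hψ : Measurable[sigmaReport F c i] (G.indicator fun ω => z (c.firstReport i ω).toNNReal ω) :=
      hzτ.indicator hGm
    have hf : Measurable[(sigmaReport F c i).prod inferInstance] fun q : Ω × ℝ≥0 =>
        G.indicator (fun ω => z (c.firstReport i ω).toNNReal ω) q.1 * (q.2 : ℝ≥0∞) :=
      (hψ.comp (@measurable_fst _ _ (sigmaReport F c i) _)).mul (@measurable_snd _ _ (sigmaReport F c i) _).coe_nnreal_ennreal
    have e := lintegral_comp_of_indep hle (h.measurable_firstMark i) (h.indep_firstMark i) hf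
    have hcase : ∀ (X : ℝ≥0∞) (ω : Ω), (A ∩ L).indicator (fun ω => {u : ℝ≥0∞ | t < u ∧ u ≤ T}.indicator
        (fun u => X * z u.toNNReal ω) (c.firstReport i ω)) ω
        = G.indicator (fun ω => z (c.firstReport i ω).toNNReal ω) ω * X := by
      intro X ω
      by_cases h1 : ω ∈ A ∩ L
      · rw [indicator_of_mem h1]
        by_cases h2 : c.firstReport i ω ≤ T
        · rw [indicator_of_mem (by exact ⟨h1.2, h2⟩), indicator_of_mem (by exact ⟨h1, h2⟩),
            mul_comm]
        · rw [indicator_of_notMem (fun h3 => h2 h3.2), indicator_of_notMem (fun h3 => h2 h3.2),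
            zero_mul]
      · rw [indicator_of_notMem h1, indicator_of_notMem (fun h3 => h1 h3.1), zero_mul]
    rw [← lintegral_indicator (hAΩ.inter hLm), ← lintegral_indicator (hAΩ.inter hLm)]
    calc _ = ∫⁻ ω, G.indicator (fun ω => z (c.firstReport i ω).toNNReal ω) ω
          * (c.firstMark i ω : ℝ≥0∞) ∂P := by
          refine lintegral_congr fun ω => ?_
          rw [← hcase]
          by_cases h1 : ω ∈ A ∩ L
          · rw [indicator_of_mem h1, indicator_of_mem h1]
          · rw [indicator_of_notMem h1, indicator_of_notMem h1]
      _ = _ := e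
      _ = _ := by
          refine lintegral_congr fun ω => ?_
          rw [hcase]
          exact lintegral_const_mul (G.indicator (fun ω => z (c.firstReport i ω).toNNReal ω) ω)
            (h.measurable_firstMark i).coe_nnreal_ennreal
  -- the updates
  have hdev : ∫⁻ ω in A ∩ L, devSum (fun u => z u ω) t T (c.firstReport i ω) (c.development i ω) ∂P
      = ∫⁻ ω in A ∩ L, devMean P c i z t T (c.firstReport i ω) ω ∂P := by
    have hALm : MeasurableSet[sigmaPre F c i] (A ∩ L) :=
      MeasurableSet.inter (sigmaAt_le_sigmaPre _ hA)
        (measurableSet_lt measurable_const (measurable_firstReport_sigmaPre (F := F)))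
    have hfst : Measurable[(sigmaPre F c i).prod inferInstance, sigmaPre F c i]
        fun q : Ω × DevData => q.1 := @measurable_fst _ _ (sigmaPre F c i) _
    have hm2 : Measurable[(sigmaPre F c i).prod inferInstance] fun q : Ω × DevData =>
        (A ∩ L).indicator (fun _ => (1 : ℝ≥0∞)) q.1
          * devSum (fun u => z u q.1) t T (c.firstReport i q.1) q.2 :=
      ((measurable_const.indicator hALm).comp hfst).mul
        (measurable_devSum_prod (m := sigmaPre F c i) hz' t T measurable_firstReport_sigmaPre)
    have e := lintegral_comp_of_indep (h.sigmaPre_le i) (h.measurable_development i)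
      (h.indep_development i) hm2
    have hcase : ∀ f : Ω → ℝ≥0∞, ∫⁻ ω in A ∩ L, f ω ∂P
        = ∫⁻ ω, (A ∩ L).indicator (fun _ => (1 : ℝ≥0∞)) ω * f ω ∂P := by
      intro f
      rw [← lintegral_indicator (hAΩ.inter hLm)]
      refine lintegral_congr fun ω => ?_
      by_cases h1 : ω ∈ A ∩ L
      · rw [indicator_of_mem h1, indicator_of_mem h1, one_mul]
      · rw [indicator_of_notMem h1, indicator_of_notMem h1, zero_mul]
    rw [hcase, hcase, e]
    refine lintegral_congr fun ω => ?_
    exact lintegral_const_mul ((A ∩ L).indicator (fun _ => (1 : ℝ≥0∞)) ω)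
      (h.measurable_devSum_development i (hzω ω) t T (c.firstReport i ω))
  have hdm : Measurable[MeasurableSpace.prod inferInstance (sigmaAt F ∞)]
      fun q : ℝ≥0 × Ω => devMean P c i z t T q.1 q.2 :=
    h.measurable_devMean i (β := ℝ≥0 × Ω) (mβ := MeasurableSpace.prod inferInstance (sigmaAt F ∞))
      (Z := fun u q => z u q.2) (measurable_comp_prodMk (mβ := sigmaAt F ∞) hz measurable_fst
        ((@measurable_snd _ _ _ (sigmaAt F ∞)).comp (@measurable_snd _ _ _
          (MeasurableSpace.prod inferInstance (sigmaAt F ∞))))) t T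
      (τ := fun q => (q.1 : ℝ≥0∞)) (@measurable_fst _ _ _ (sigmaAt F ∞)).coe_nnreal_ennreal
  -- After averaging over first mark and development, a function of the reporting time and the
  -- filtration remains, to which `lintegral_comp_firstReport` applies. The set `Ioc t T ×ˢ A`
  -- encodes the event; reports after `T`, including infinite ones, contribute nothing.
  set ψ : ℝ≥0 × Ω → ℝ≥0∞ := (Ioc t T ×ˢ A).indicator
    fun q => E * z q.1 q.2 + devMean P c i z t T q.1 q.2 with hψ
  have hψm : Measurable[MeasurableSpace.prod inferInstance (sigmaAt F ∞)] ψ :=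
    Measurable.indicator ((measurable_const.mul hz).add hdm)
      (@MeasurableSet.prod _ _ _ (sigmaAt F ∞) _ _ measurableSet_Ioc hA)
  have e := h.lintegral_comp_firstReport i hψm
  have hfin : MeasurableSet {ω | c.firstReport i ω < ∞} := measurableSet_lt hτ measurable_const
  have hfm : Measurable fun ω => {u : ℝ≥0∞ | t < u ∧ u ≤ T}.indicator
      (fun u => (c.firstMark i ω : ℝ≥0∞) * z u.toNNReal ω) (c.firstReport i ω) := by
    have h1 : Measurable fun ω => (c.firstMark i ω : ℝ≥0∞) * z (c.firstReport i ω).toNNReal ω :=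
      (h.measurable_firstMark i).coe_nnreal_ennreal.mul
        (hzΩ.comp (hτ.ennreal_toNNReal.prodMk measurable_id))
    exact h1.indicator (hLm.inter (measurableSet_le hτ measurable_const) :
      MeasurableSet {ω | (t : ℝ≥0∞) < c.firstReport i ω ∧ c.firstReport i ω ≤ T})
  have hfm' : Measurable fun ω => {u : ℝ≥0∞ | t < u ∧ u ≤ T}.indicator
      (fun u => E * z u.toNNReal ω) (c.firstReport i ω) := by
    have h1 : Measurable fun ω => E * z (c.firstReport i ω).toNNReal ω :=
      measurable_const.mul (hzΩ.comp (hτ.ennreal_toNNReal.prodMk measurable_id))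
    exact h1.indicator (hLm.inter (measurableSet_le hτ measurable_const) :
      MeasurableSet {ω | (t : ℝ≥0∞) < c.firstReport i ω ∧ c.firstReport i ω ≤ T})
  simp only [payment]
  rw [lintegral_add_left hfm, hfirst, hdev, ← lintegral_add_left hfm']
  calc _ = ∫⁻ ω in {ω | c.firstReport i ω < ∞}, ψ ((c.firstReport i ω).toNNReal, ω) ∂P := by
        rw [← lintegral_indicator (hAΩ.inter hLm), ← lintegral_indicator hfin]
        refine lintegral_congr fun ω => ?_
        by_cases hωA : ω ∈ A
        · generalize hu : c.firstReport i ω = u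
          have hωL : ω ∈ A ∩ L ↔ (t : ℝ≥0∞) < u := by
            rw [← hu]
            exact and_iff_right hωA
          by_cases h1 : (t : ℝ≥0∞) < u
          · rw [indicator_of_mem (hωL.2 h1)]
            induction u with
            | top =>
              have hR : {ω | c.firstReport i ω < ∞}.indicator
                  (fun ω => ψ ((c.firstReport i ω).toNNReal, ω)) ω = 0 :=
                indicator_of_notMem (by rw [mem_ofPred_eq, hu]; exact lt_irrefl _) _
              rw [hR, hu, indicator_of_notMem (fun h2 => absurd h2.2 (not_le.2 ENNReal.coe_lt_top)),
                devMean_eq_zero_of_lt ENNReal.coe_lt_top, add_zero]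
            | coe u =>
              have hR : {ω | c.firstReport i ω < ∞}.indicator
                  (fun ω => ψ ((c.firstReport i ω).toNNReal, ω)) ω = ψ (u, ω) := by
                rw [indicator_of_mem (by rw [mem_ofPred_eq, hu]; exact ENNReal.coe_lt_top), hu,
                  ENNReal.toNNReal_coe]
              rw [hR, hu, hψ]
              by_cases h2 : u ≤ T
              · have h3 : (u : ℝ≥0∞) ≤ T := by exact_mod_cast h2
                rw [indicator_of_mem (by exact ⟨h1, h3⟩),
                  indicator_of_mem (by exact ⟨⟨by exact_mod_cast h1, h2⟩, hωA⟩),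
                  ENNReal.toNNReal_coe]
              · have h3 : ¬ (u : ℝ≥0∞) ≤ T := fun h4 => h2 (by exact_mod_cast h4)
                rw [indicator_of_notMem (fun h4 => h3 h4.2),
                  indicator_of_notMem (fun h4 => h2 h4.1.2),
                  devMean_eq_zero_of_lt (not_le.1 h3), add_zero]
          · rw [indicator_of_notMem (fun h2 => h1 (hωL.1 h2))]
            refine (indicator_apply_eq_zero.2 fun _ => ?_).symm
            rw [hu, hψ]
            refine indicator_of_notMem (fun h2 => ?_) _
            rw [← ENNReal.coe_toNNReal ((not_lt.1 h1).trans_lt ENNReal.coe_lt_top).ne] at h1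
            exact h1 (by exact_mod_cast h2.1.1)
        · rw [indicator_of_notMem (fun h1 => hωA h1.1)]
          exact (indicator_apply_eq_zero.2 fun _ =>
            indicator_of_notMem (fun h1 => hωA h1.2) _).symm
    _ = _ := e
    _ = _ := by
        rw [← lintegral_indicator hAΩ]
        refine lintegral_congr fun ω => ?_
        by_cases hωA : ω ∈ A
        · rw [indicator_of_mem hωA, reportMean, ← lintegral_indicator measurableSet_Ioc]
          refine lintegral_congr fun u => ?_
          by_cases hu : u ∈ Ioc t T
          · rw [indicator_of_mem hu, hψ, indicator_of_mem (by exact ⟨hu, hωA⟩),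
              h.devMean_eq_of_le hu.1.le hu.2 ω (hzω ω)]
          · rw [indicator_of_notMem hu, hψ, indicator_of_notMem (fun h1 => hu h1.1)]
        · rw [indicator_of_notMem hωA]
          simp [hψ, hωA]

end IsModel

end Insurance

end

/-! ### Conditional expectations on an event; positive and negative parts. -/

section
namespace Insurance

section Generic

variable {Ω : Type*} {m0 : MeasurableSpace Ω} {P : Measure Ω}

theorem condExp_sup_ae_eq_of_setIntegral [IsFiniteMeasure P] {m₁ m₂ : MeasurableSpace Ω}
    (h₁ : m₁ ≤ m0) (h₂ : m₂ ≤ m0) {f k : Ω → ℝ} (hf : Integrable f P) (hk : Integrable k P)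
    (h : ∀ A B, MeasurableSet[m₁] A → MeasurableSet[m₂] B →
      ∫ ω in A ∩ B, f ω ∂P = ∫ ω in A ∩ B, k ω ∂P) :
    P[f | m₁ ⊔ m₂] =ᵐ[P] P[k | m₁ ⊔ m₂] := by
  refine condExp_ae_eq_of_isPiSystem (sup_le h₁ h₂)
    (C := {S | ∃ A B, MeasurableSet[m₁] A ∧ B ∈ {B | MeasurableSet[m₂] B} ∧ S = A ∩ B})
    (isPiSystem_inter (m := m₁) (@MeasurableSpace.isPiSystem_measurableSet _ m₂)) ?_ hf hk ?_ ?_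
  · rw [← sup_generateFrom_eq (C := {B | MeasurableSet[m₂] B}) (@MeasurableSet.univ _ m₂),
      MeasurableSpace.generateFrom_measurableSet]
  · simpa using h univ univ MeasurableSet.univ MeasurableSet.univ
  · rintro _ ⟨A, B, hA, hB, rfl⟩
    exact h A B hA hB

theorem condExp_ae_eq_of_setIntegral [IsFiniteMeasure P] {m : MeasurableSpace Ω}
    (hm : m ≤ m0) {f k : Ω → ℝ} (hf : Integrable f P) (hk : Integrable k P)
    (h : ∀ A, MeasurableSet[m] A → ∫ ω in A, f ω ∂P = ∫ ω in A, k ω ∂P) :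
    P[f | m] =ᵐ[P] P[k | m] := by
  have := condExp_sup_ae_eq_of_setIntegral hm hm hf hk
    fun A B hA hB => h _ (MeasurableSet.inter hA hB)
  rwa [sup_idem] at this

/-- A conditional expectation is determined on `D` by its integrals over subsets of `D`. -/
theorem indicator_condExp_ae_eq [IsFiniteMeasure P] {m : MeasurableSpace Ω}
    (hm : m ≤ m0) {D : Set Ω} (hD : MeasurableSet[m] D) {W V : Ω → ℝ} (hW : Integrable W P)
    (hV : Integrable V P) (hVm : StronglyMeasurable[m] V)
    (h : ∀ A, MeasurableSet[m] A → ∫ ω in A ∩ D, W ω ∂P = ∫ ω in A ∩ D, V ω ∂P) :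
    D.indicator (P[W | m]) =ᵐ[P] D.indicator V := by
  have h1 : P[D.indicator W | m] =ᵐ[P] P[D.indicator V | m] := by
    refine condExp_ae_eq_of_setIntegral hm (hW.indicator (hm _ hD)) (hV.indicator (hm _ hD))
      fun A hA => ?_
    rw [setIntegral_indicator (hm _ hD), setIntegral_indicator (hm _ hD), h A hA]
  refine (condExp_indicator hW hD).symm.trans (h1.trans ?_)
  rw [condExp_of_stronglyMeasurable hm (hVm.indicator hD) (hV.indicator (hm _ hD))]

/-- Restricted to `m`, the measure `P` on `L` has density `P(L | m)`; this is the defining property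
of the conditional probability. -/
theorem setLIntegral_eq_lintegral_condExp_mul [IsFiniteMeasure P] {m : MeasurableSpace Ω}
    (hm : m ≤ m0) {L : Set Ω} (hL : MeasurableSet[m0] L) {q : Ω → ℝ≥0∞} (hq : Measurable[m] q) :
    ∫⁻ ω in L, q ω ∂P = ∫⁻ ω, ENNReal.ofReal ((P⟦L | m⟧) ω) * q ω ∂P := by
  have hpm : Measurable[m] fun ω => ENNReal.ofReal ((P⟦L | m⟧) ω) :=
    stronglyMeasurable_condExp.measurable.ennreal_ofReal
  have hi : Integrable (L.indicator fun _ => (1 : ℝ)) P := (integrable_const 1).indicator hL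
  have h1 : (P.restrict L).trim hm
      = (P.withDensity fun ω => ENNReal.ofReal ((P⟦L | m⟧) ω)).trim hm := by
    refine @Measure.ext _ m _ _ fun A hA => ?_
    rw [trim_measurableSet_eq hm hA, trim_measurableSet_eq hm hA,
      Measure.restrict_apply (hm _ hA), withDensity_apply _ (hm _ hA),
      ← ofReal_integral_eq_lintegral_ofReal integrable_condExp.integrableOn
        (ae_restrict_of_ae (condExp_nonneg (Eventually.of_forall fun ω =>
          indicator_nonneg (fun _ _ => zero_le_one) ω))),
      setIntegral_condExp hm hi hA, integral_indicator_const _ hL, smul_eq_mul, mul_one,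
      ofReal_measureReal, Measure.restrict_apply hL, inter_comm]
  rw [← lintegral_trim hm hq, h1, lintegral_trim hm hq,
    lintegral_withDensity_eq_lintegral_mul _ (hpm.mono hm le_rfl) (hq.mono hm le_rfl)]
  rfl

/-- The quotient alone need not be integrable, since its denominator can be close to `0`. Over `L`
conditioning produces a factor `P(L | m)` that cancels the denominator, and what remains is the
integral of `|V|`. -/
theorem integrable_indicator_div_condExp [IsFiniteMeasure P] {m : MeasurableSpace Ω}
    (hm : m ≤ m0) {L : Set Ω} (hL : MeasurableSet[m0] L) (hpos : ∀ᵐ ω ∂P, 0 < (P⟦L | m⟧) ω)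
    {V : Ω → ℝ} (hVm : StronglyMeasurable[m] V) (hV : Integrable V P) :
    Integrable (L.indicator fun ω => V ω / (P⟦L | m⟧) ω) P := by
  have hq : Measurable[m] fun ω => V ω / (P⟦L | m⟧) ω :=
    hVm.measurable.div stronglyMeasurable_condExp.measurable
  refine ⟨((hq.mono hm le_rfl).indicator hL).aestronglyMeasurable, ?_⟩
  rw [hasFiniteIntegral_iff_enorm]
  simp only [enorm_indicator_eq_indicator_enorm]
  rw [lintegral_indicator hL, setLIntegral_eq_lintegral_condExp_mul hm hL hq.enorm]
  refine lt_of_eq_of_lt (lintegral_congr_ae ?_) hV.2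
  filter_upwards [hpos] with ω hω
  rw [← Real.enorm_of_nonneg hω.le, ← enorm_mul, mul_div_cancel₀ _ hω.ne']

/-- If a σ-algebra `𝓗` contains no information on the event `L`, then the conditional expectation
given `m ⊔ 𝓗` is an elementary conditional expectation on `L`. -/
theorem condExp_sup_indicator_ae_eq [IsFiniteMeasure P] {m 𝓗 : MeasurableSpace Ω} (hm : m ≤ m0)
    (h𝓗 : 𝓗 ≤ m0) {L : Set Ω} (hL : MeasurableSet[m ⊔ 𝓗] L)
    (hatom : ∀ B, MeasurableSet[𝓗] B → B ∩ L = ∅ ∨ B ∩ L = L)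
    (hpos : ∀ᵐ ω ∂P, 0 < (P⟦L | m⟧) ω) {Y R : Ω → ℝ} (hY : Integrable Y P) (hR : Integrable R P)
    (hYR : ∀ A, MeasurableSet[m] A → ∫ ω in A ∩ L, Y ω ∂P = ∫ ω in A, R ω ∂P) :
    P[L.indicator Y | m ⊔ 𝓗] =ᵐ[P] L.indicator fun ω => (P[R | m]) ω / (P⟦L | m⟧) ω := by
  have hsup : m ⊔ 𝓗 ≤ m0 := sup_le hm h𝓗
  have hL0 := hsup _ hL
  have hi := integrable_indicator_div_condExp hm hL0 hpos
    (stronglyMeasurable_condExp (f := R)) integrable_condExp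
  have hqm : StronglyMeasurable[m] fun ω => (P[R | m]) ω / (P⟦L | m⟧) ω :=
    (stronglyMeasurable_condExp.measurable.div stronglyMeasurable_condExp.measurable).stronglyMeasurable
  have hint : ∀ A, MeasurableSet[m] A →
      ∫ ω in A ∩ L, (P[R | m]) ω / (P⟦L | m⟧) ω ∂P = ∫ ω in A, R ω ∂P := by
    intro A hA
    have hmul : (L.indicator fun ω => (P[R | m]) ω / (P⟦L | m⟧) ω)
        = (fun ω => (P[R | m]) ω / (P⟦L | m⟧) ω) * L.indicator fun _ => (1 : ℝ) := by
      ext ω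
      by_cases hω : ω ∈ L <;> simp [hω]
    have h1 := condExp_mul_of_stronglyMeasurable_left (μ := P) hqm (by rw [← hmul]; exact hi)
      ((integrable_const (1 : ℝ)).indicator hL0)
    rw [← hmul] at h1
    rw [← setIntegral_indicator hL0, ← setIntegral_condExp hm hi hA, ← setIntegral_condExp hm hR hA]
    refine setIntegral_congr_ae (hm _ hA) ?_
    filter_upwards [h1, hpos] with ω h2 h3 _
    rw [h2, Pi.mul_apply, div_mul_cancel₀ _ h3.ne']
  have h1 : P[L.indicator Y | m ⊔ 𝓗]
      =ᵐ[P] P[L.indicator fun ω => (P[R | m]) ω / (P⟦L | m⟧) ω | m ⊔ 𝓗] := by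
    refine condExp_sup_ae_eq_of_setIntegral hm h𝓗 (hY.indicator hL0) hi fun A B hA hB => ?_
    rw [setIntegral_indicator hL0, setIntegral_indicator hL0, inter_assoc]
    -- `B` either misses `L` or contains it, so only the sets `A ∩ L` with `A` in `m` have to be
    -- tested.
    rcases hatom B hB with h2 | h2
    · rw [h2, inter_empty]
      simp
    · rw [h2, hYR A hA, hint A hA]
  refine h1.trans ?_
  rw [condExp_of_stronglyMeasurable hsup ((hqm.mono le_sup_left).indicator hL) hi]

end Generic

theorem tsum_eq_toReal_sub_toReal {a : ℕ → ℝ} (h₁ : ∑' j, ENNReal.ofReal (a j) ≠ ∞)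
    (h₂ : ∑' j, ENNReal.ofReal (-a j) ≠ ∞) :
    ∑' j, a j = (∑' j, ENNReal.ofReal (a j)).toReal - (∑' j, ENNReal.ofReal (-a j)).toReal := by
  rw [ENNReal.tsum_toReal_eq fun j => ENNReal.ofReal_ne_top,
    ENNReal.tsum_toReal_eq fun j => ENNReal.ofReal_ne_top,
    ← (ENNReal.summable_toReal h₁).tsum_sub (ENNReal.summable_toReal h₂)]
  refine tsum_congr fun j => ?_
  rw [ENNReal.toReal_ofReal', ENNReal.toReal_ofReal', max_zero_sub_max_neg_zero_eq_self]

theorem setIntegral_toReal_sub {Ω : Type*} {m0 : MeasurableSpace Ω} {P : Measure Ω}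
    {f k : Ω → ℝ≥0∞} (hf : Measurable f) (hk : Measurable k) {S : Set Ω}
    (hfi : ∫⁻ ω in S, f ω ∂P ≠ ∞) (hki : ∫⁻ ω in S, k ω ∂P ≠ ∞) :
    ∫ ω in S, ((f ω).toReal - (k ω).toReal) ∂P
      = (∫⁻ ω in S, f ω ∂P).toReal - (∫⁻ ω in S, k ω ∂P).toReal := by
  rw [integral_sub (integrable_toReal_of_lintegral_ne_top hf.aemeasurable hfi)
    (integrable_toReal_of_lintegral_ne_top hk.aemeasurable hki),
    integral_toReal hf.aemeasurable (ae_lt_top hf hfi),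
    integral_toReal hk.aemeasurable (ae_lt_top hk hki)]

end Insurance

end

/-! ### Measurability and integrability of the payments. -/

section
namespace Insurance

variable {Ω : Type*} [mΩ : MeasurableSpace Ω] {n : ℕ} {P : Measure Ω} {F : Filtration ℝ≥0 mΩ}
  {c : Portfolio Ω n} {μ : ℝ≥0 → Ω → ℝ} {α₀ : ℝ} {g : ℝ → ℝ} {i : Fin n} {z : ℝ≥0 → Ω → ℝ≥0∞}
  {K : ℝ≥0∞} {t T : ℝ≥0} {Z : ℝ≥0 → Ω → ℝ} {C : ℝ}

theorem payment_eq_tsum {Ω : Type*} {c : Portfolio Ω n} {z : ℝ≥0 → Ω → ℝ≥0∞} (ω : Ω) :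
    payment c i z t T ω = ∑' j, {ω' | (t : ℝ≥0∞) < c.reportTime i j ω' ∧ c.reportTime i j ω' ≤ T}.indicator
      (fun ω' => (c.amount i j ω' : ℝ≥0∞) * z (c.reportTime i j ω').toNNReal ω') ω := by
  rw [tsum_eq_zero_add' ENNReal.summable]
  rfl

theorem payment_of_le {Ω : Type*} {c : Portfolio Ω n} {z : ℝ≥0 → Ω → ℝ≥0∞} {ω : Ω}
    (hω : c.firstReport i ω ≤ t) :
    payment c i z t T ω
      = devSum (fun u => z u ω) t T (c.firstReport i ω) (c.development i ω) := by
  rw [payment, indicator_of_notMem (fun h => absurd h.1 (not_lt.2 hω)), zero_add]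

theorem measurable_payment {Ω : Type*} {c : Portfolio Ω n} {z : ℝ≥0 → Ω → ℝ≥0∞}
    {m : MeasurableSpace Ω}
    (hz : Measurable[MeasurableSpace.prod inferInstance m] fun q : ℝ≥0 × Ω => z q.1 q.2)
    (hX : Measurable[m] (c.firstMark i)) (hτ : Measurable[m] (c.firstReport i))
    (hd : Measurable[m] (c.development i)) : Measurable[m] (payment c i z t T) := by
  have hφ : Measurable[MeasurableSpace.prod m inferInstance] fun q : Ω × ℝ≥0 => z q.2 q.1 :=
    measurable_comp_prodMk (mβ := m) hz (@measurable_snd _ _ m _) (@measurable_fst _ _ m _)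
  have h1 : Measurable[m] fun ω => (c.firstMark i ω : ℝ≥0∞) * z (c.firstReport i ω).toNNReal ω :=
    hX.coe_nnreal_ennreal.mul
      (measurable_comp_prodMk (mβ := m) hz hτ.ennreal_toNNReal (@measurable_id _ m))
  have h2 : MeasurableSet[m] {ω | (t : ℝ≥0∞) < c.firstReport i ω ∧ c.firstReport i ω ≤ T} :=
    MeasurableSet.inter (measurableSet_lt measurable_const hτ)
      (measurableSet_le hτ measurable_const)
  exact (Measurable.indicator h1 h2).add
    (measurable_devSum (φ := fun ω u => z u ω) hφ measurable_const T hτ hd)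

namespace IsModel

theorem lintegral_firstMark_ne_top (h : IsModel P F c μ α₀ g) (i : Fin n) :
    ∫⁻ ω, c.firstMark i ω ∂P ≠ ∞ := by
  have := (h.integrable_firstMark i).2
  rw [hasFiniteIntegral_iff_enorm] at this
  simpa using this.ne

theorem integral_firstMark (h : IsModel P F c μ α₀ g) (i : Fin n) :
    ∫ ω, (c.firstMark i ω : ℝ) ∂P = (∫⁻ ω, c.firstMark i ω ∂P).toReal := by
  rw [← integral_toReal (h.measurable_firstMark i).coe_nnreal_ennreal.aemeasurable
    (Eventually.of_forall fun ω => ENNReal.coe_lt_top)]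
  rfl

/-- A bound for the expected weighted updates. -/
theorem devMean_le (h : IsModel P F c μ α₀ g) (hK : ∀ u ω, z u ω ≤ K) (x : ℝ≥0∞) (ω : Ω) :
    devMean P c i z t T x ω ≤ (∫⁻ ω, c.devTotalENN i T ω ∂P) * K :=
  h.lintegral_devSum_le (fun u _ => hK u ω) x i

theorem devBound_ne_top (h : IsModel P F c μ α₀ g) (i : Fin n) (T : ℝ≥0) (hK : K ≠ ∞) :
    (∫⁻ ω, c.devTotalENN i T ω ∂P) * K ≠ ∞ :=
  ENNReal.mul_ne_top (h.devTotal_finite i T).ne hK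

theorem lintegral_payment_ne_top (h : IsModel P F c μ α₀ g) (hK : ∀ u ω, z u ω ≤ K) (hK' : K ≠ ∞) :
    ∫⁻ ω, payment c i z t T ω ∂P ≠ ∞ := by
  have h1 : ∀ ω, payment c i z t T ω ≤ (c.firstMark i ω : ℝ≥0∞) * K + c.devTotalENN i T ω * K := by
    intro ω
    refine add_le_add ?_ (devSum_le (fun u _ => hK u ω) _ i ω)
    refine indicator_apply_le' (fun _ => ?_) fun _ => zero_le
    exact mul_le_mul_right (hK _ _) _
  refine ((lintegral_mono h1).trans_lt ?_).ne
  rw [lintegral_add_left ((h.measurable_firstMark i).coe_nnreal_ennreal.mul_const _),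
    lintegral_mul_const _ (h.measurable_firstMark i).coe_nnreal_ennreal,
    lintegral_mul_const _ (h.measurable_devTotalENN i T)]
  exact ENNReal.add_lt_top.2 ⟨(ENNReal.mul_ne_top (h.lintegral_firstMark_ne_top i) hK').lt_top,
    (h.devBound_ne_top i T hK').lt_top⟩

theorem measurable_payment' (h : IsModel P F c μ α₀ g)
    (hz : Measurable[MeasurableSpace.prod inferInstance (sigmaAt F ∞)]
      fun q : ℝ≥0 × Ω => z q.1 q.2) : Measurable (payment c i z t T) :=
  measurable_payment (hz.mono (prod_sigmaAt_le F) le_rfl) (h.measurable_firstMark i)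
    (h.measurable_firstReport i) (h.measurable_development i)

theorem measurable_payment_sigmaOwn
    (hz : Measurable[MeasurableSpace.prod inferInstance (sigmaAt F ∞)]
      fun q : ℝ≥0 × Ω => z q.1 q.2) : Measurable[sigmaOwn F c i] (payment c i z t T) := by
  have hle : sigmaAt F ∞ ≤ sigmaOwn F c i := le_sup_left.trans le_sup_left
  have ha : Measurable[sigmaOwn F c i] (c.accident i) :=
    measurable_iff_comap_le.2 (le_sup_right.trans le_sup_left)
  exact measurable_payment (hz.mono (sup_le_sup_left (MeasurableSpace.comap_mono hle) _) le_rfl)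
    (Portfolio.measurable_firstMark_of_le le_sup_right)
    (Portfolio.measurable_firstReport_of_le le_sup_right ha)
    (Portfolio.measurable_development_of_le le_sup_right)

/-- The inner integral over `(u, T]` uses a measure that varies with `u`. Rewriting it with
`devMean` from the fixed time `t` gives an integrand that is visibly jointly measurable. -/
theorem reportMean_eq [IsProbabilityMeasure P] (h : IsModel P F c μ α₀ g)
    (hz : Measurable fun q : ℝ≥0 × Ω => z q.1 q.2) (ω : Ω) :
    h.reportMean i z t T ω = ∫⁻ u, (Ioc t T ×ˢ univ).indicator
      (fun q => (∫⁻ ω', c.firstMark i ω' ∂P) * z q.1 q.2 + devMean P c i z t T q.1 q.2) (u, ω)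
        ∂reportLaw P c μ i ω := by
  rw [reportMean, ← lintegral_indicator measurableSet_Ioc]
  refine lintegral_congr fun u => ?_
  by_cases hu : u ∈ Ioc t T
  · rw [indicator_of_mem hu, indicator_of_mem (by exact ⟨hu, mem_univ _⟩),
      h.devMean_eq_of_le hu.1.le hu.2 ω (hz.comp measurable_prodMk_right)]
  · rw [indicator_of_notMem hu, indicator_of_notMem (fun h1 => hu h1.1)]

theorem measurable_devMean_coe [IsProbabilityMeasure P] (h : IsModel P F c μ α₀ g)
    (hz : Measurable[MeasurableSpace.prod inferInstance (sigmaAt F ∞)]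
      fun q : ℝ≥0 × Ω => z q.1 q.2) :
    Measurable[MeasurableSpace.prod inferInstance (sigmaAt F ∞)]
      fun q : ℝ≥0 × Ω => devMean P c i z t T q.1 q.2 :=
  h.measurable_devMean i (β := ℝ≥0 × Ω) (mβ := MeasurableSpace.prod inferInstance (sigmaAt F ∞))
    (Z := fun u q => z u q.2) (measurable_comp_prodMk (mβ := sigmaAt F ∞) hz measurable_fst
      ((@measurable_snd _ _ _ (sigmaAt F ∞)).comp (@measurable_snd _ _ _
        (MeasurableSpace.prod inferInstance (sigmaAt F ∞))))) t T
    (τ := fun q => (q.1 : ℝ≥0∞)) (@measurable_fst _ _ _ (sigmaAt F ∞)).coe_nnreal_ennreal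

theorem measurable_reportMean [IsProbabilityMeasure P] (h : IsModel P F c μ α₀ g)
    (hz : Measurable[MeasurableSpace.prod inferInstance (sigmaAt F ∞)]
      fun q : ℝ≥0 × Ω => z q.1 q.2) : Measurable[sigmaAt F ∞] (h.reportMean i z t T) := by
  have h1 : h.reportMean i z t T = _ := funext fun ω =>
    h.reportMean_eq (hz.mono (prod_sigmaAt_le F) le_rfl) ω
  rw [h1]
  exact h.measurable_reportLaw i (Measurable.indicator
    ((measurable_const.mul hz).add (h.measurable_devMean_coe hz))
      (@MeasurableSet.prod _ _ _ (sigmaAt F ∞) _ _ measurableSet_Ioc (@MeasurableSet.univ _ (sigmaAt F ∞))))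

/-- By `setLIntegral_payment_late` the expectation is that of the payments on the event of a late
report. -/
theorem lintegral_reportMean_ne_top [IsProbabilityMeasure P] (h : IsModel P F c μ α₀ g)
    (hz : Measurable[MeasurableSpace.prod inferInstance (sigmaAt F ∞)]
      fun q : ℝ≥0 × Ω => z q.1 q.2) (hK : ∀ u ω, z u ω ≤ K) (hK' : K ≠ ∞) :
    ∫⁻ ω, h.reportMean i z t T ω ∂P ≠ ∞ := by
  have h1 := h.setLIntegral_payment_late (i := i) (t := t) (T := T) hz
    (@MeasurableSet.univ _ (sigmaAt F ∞))
  rw [setLIntegral_univ] at h1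
  rw [← h1]
  exact ((setLIntegral_le_lintegral _ _).trans_lt
    (h.lintegral_payment_ne_top hK hK').lt_top).ne

end IsModel

section Real

/-- Positive part of a real weight process. -/
abbrev weightPos (Z : ℝ≥0 → Ω → ℝ) (u : ℝ≥0) (ω : Ω) : ℝ≥0∞ := ENNReal.ofReal (Z u ω)

/-- Negative part of a real weight process. -/
abbrev weightNeg (Z : ℝ≥0 → Ω → ℝ) (u : ℝ≥0) (ω : Ω) : ℝ≥0∞ := ENNReal.ofReal (-Z u ω)

/-- The expected weighted updates, for a real weight process. -/
def devMeanReal (P : Measure Ω) (c : Portfolio Ω n) (i : Fin n) (Z : ℝ≥0 → Ω → ℝ) (t T : ℝ≥0)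
    (x : ℝ≥0∞) (ω : Ω) : ℝ :=
  (devMean P c i (weightPos Z) t T x ω).toReal - (devMean P c i (weightNeg Z) t T x ω).toReal

/-- The weighted payments, for a real weight process. -/
def paymentReal (c : Portfolio Ω n) (i : Fin n) (Z : ℝ≥0 → Ω → ℝ) (t T : ℝ≥0) (ω : Ω) : ℝ :=
  (payment c i (weightPos Z) t T ω).toReal - (payment c i (weightNeg Z) t T ω).toReal

/-- The expected payments after the first reporting, for a real weight process. -/
def reportMeanReal (h : IsModel P F c μ α₀ g) (i : Fin n) (Z : ℝ≥0 → Ω → ℝ) (t T : ℝ≥0) (ω : Ω) :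
    ℝ :=
  (h.reportMean i (weightPos Z) t T ω).toReal - (h.reportMean i (weightNeg Z) t T ω).toReal

end Real

end Insurance

end

/-! ### Transfer to real weight processes. -/

section
namespace Insurance

variable {Ω : Type*} [mΩ : MeasurableSpace Ω] {n : ℕ} {P : Measure Ω} {F : Filtration ℝ≥0 mΩ}
  {c : Portfolio Ω n} {μ : ℝ≥0 → Ω → ℝ} {α₀ : ℝ} {g : ℝ → ℝ} {i : Fin n}
  {t T : ℝ≥0} {Z : ℝ≥0 → Ω → ℝ} {C : ℝ}

/-- Continuous bounded processes which are determined by the reference filtration. -/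
structure IsWeight (F : Filtration ℝ≥0 mΩ) (Z : ℝ≥0 → Ω → ℝ) (C : ℝ) : Prop where
  measurable : Measurable[MeasurableSpace.prod inferInstance (sigmaAt F ∞)]
    fun q : ℝ≥0 × Ω => Z q.1 q.2
  bound : ∀ u ω, |Z u ω| ≤ C
  continuous : ∀ ω, Continuous fun u => Z u ω

namespace IsWeight

theorem neg (hZ : IsWeight F Z C) : IsWeight F (fun u ω => -Z u ω) C where
  measurable := hZ.measurable.neg
  bound u ω := by rw [abs_neg]; exact hZ.bound u ω
  continuous ω := (hZ.continuous ω).neg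

theorem measurable_weightPos (hZ : IsWeight F Z C) :
    Measurable[MeasurableSpace.prod inferInstance (sigmaAt F ∞)]
      fun q : ℝ≥0 × Ω => weightPos Z q.1 q.2 := hZ.measurable.ennreal_ofReal

theorem measurable_weightNeg (hZ : IsWeight F Z C) :
    Measurable[MeasurableSpace.prod inferInstance (sigmaAt F ∞)]
      fun q : ℝ≥0 × Ω => weightNeg Z q.1 q.2 := hZ.neg.measurable_weightPos

theorem weightPos_le (hZ : IsWeight F Z C) (u : ℝ≥0) (ω : Ω) :
    weightPos Z u ω ≤ ENNReal.ofReal C :=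
  ENNReal.ofReal_le_ofReal ((le_abs_self _).trans (hZ.bound u ω))

theorem weightNeg_le (hZ : IsWeight F Z C) (u : ℝ≥0) (ω : Ω) :
    weightNeg Z u ω ≤ ENNReal.ofReal C := hZ.neg.weightPos_le u ω

theorem measurable_path (hZ : IsWeight F Z C) (ω : Ω) : Measurable fun u => Z u ω :=
  (hZ.continuous ω).measurable

end IsWeight

namespace IsModel

theorem integrable_paymentReal (h : IsModel P F c μ α₀ g) (hZ : IsWeight F Z C) :
    Integrable (paymentReal c i Z t T) P :=
  (integrable_toReal_of_lintegral_ne_top (h.measurable_payment' hZ.measurable_weightPos).aemeasurable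
    (h.lintegral_payment_ne_top hZ.weightPos_le ENNReal.ofReal_ne_top)).sub
  (integrable_toReal_of_lintegral_ne_top (h.measurable_payment' hZ.measurable_weightNeg).aemeasurable
    (h.lintegral_payment_ne_top hZ.weightNeg_le ENNReal.ofReal_ne_top))

theorem stronglyMeasurable_paymentReal (hZ : IsWeight F Z C) :
    StronglyMeasurable[sigmaOwn F c i] (paymentReal c i Z t T) :=
  ((measurable_payment_sigmaOwn hZ.measurable_weightPos).ennreal_toReal.sub
    (measurable_payment_sigmaOwn hZ.measurable_weightNeg).ennreal_toReal).stronglyMeasurable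

/-- The series of positive parts and that of negative parts have finite expectation because the
weight is bounded. Both are therefore a.s. finite and the signed series is their difference. -/
theorem futurePayments_ae_eq (h : IsModel P F c μ α₀ g) (hZ : IsWeight F Z C) :
    c.futurePayments i t T Z =ᵐ[P] paymentReal c i Z t T := by
  have hp := h.lintegral_payment_ne_top (i := i) (t := t) (T := T) hZ.weightPos_le
    ENNReal.ofReal_ne_top
  have hn := h.lintegral_payment_ne_top (i := i) (t := t) (T := T) hZ.weightNeg_le
    ENNReal.ofReal_ne_top
  filter_upwards [ae_lt_top (h.measurable_payment' hZ.measurable_weightPos) hp,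
    ae_lt_top (h.measurable_payment' hZ.measurable_weightNeg) hn] with ω h1 h2
  rw [payment_eq_tsum] at h1 h2
  rw [paymentReal, payment_eq_tsum, payment_eq_tsum]
  have e1 : ∀ j, {ω' | (t : ℝ≥0∞) < c.reportTime i j ω' ∧ c.reportTime i j ω' ≤ T}.indicator
      (fun ω' => (c.amount i j ω' : ℝ≥0∞) * weightPos Z (c.reportTime i j ω').toNNReal ω') ω
      = ENNReal.ofReal ({ω' | (t : ℝ≥0∞) < c.reportTime i j ω' ∧ c.reportTime i j ω' ≤ T}.indicator
      (fun ω' => (c.amount i j ω' : ℝ) * Z (c.reportTime i j ω').toNNReal ω') ω) := by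
    intro j
    by_cases hj : ω ∈ {ω' | (t : ℝ≥0∞) < c.reportTime i j ω' ∧ c.reportTime i j ω' ≤ T}
    · rw [indicator_of_mem hj, indicator_of_mem hj, ENNReal.ofReal_mul NNReal.zero_le_coe,
        ENNReal.ofReal_coe_nnreal]
    · rw [indicator_of_notMem hj, indicator_of_notMem hj, ENNReal.ofReal_zero]
  have e2 : ∀ j, {ω' | (t : ℝ≥0∞) < c.reportTime i j ω' ∧ c.reportTime i j ω' ≤ T}.indicator
      (fun ω' => (c.amount i j ω' : ℝ≥0∞) * weightNeg Z (c.reportTime i j ω').toNNReal ω') ω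
      = ENNReal.ofReal (-{ω' | (t : ℝ≥0∞) < c.reportTime i j ω' ∧ c.reportTime i j ω' ≤ T}.indicator
      (fun ω' => (c.amount i j ω' : ℝ) * Z (c.reportTime i j ω').toNNReal ω') ω) := by
    intro j
    by_cases hj : ω ∈ {ω' | (t : ℝ≥0∞) < c.reportTime i j ω' ∧ c.reportTime i j ω' ≤ T}
    · rw [indicator_of_mem hj, indicator_of_mem hj, ← mul_neg, ENNReal.ofReal_mul NNReal.zero_le_coe,
        ENNReal.ofReal_coe_nnreal]
    · rw [indicator_of_notMem hj, indicator_of_notMem hj, neg_zero, ENNReal.ofReal_zero]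
  rw [tsum_congr e1] at h1 ⊢
  rw [tsum_congr e2] at h2 ⊢
  exact tsum_eq_toReal_sub_toReal h1.ne h2.ne

theorem integral_eq_toReal_sub (hZ : IsWeight F Z C) {ν : Measure ℝ≥0} {S : Set ℝ≥0}
    (hν : ν S ≠ ∞) (ω : Ω) :
    ∫ u in S, Z u ω ∂ν
      = (∫⁻ u in S, weightPos Z u ω ∂ν).toReal - (∫⁻ u in S, weightNeg Z u ω ∂ν).toReal := by
  refine integral_eq_lintegral_pos_part_sub_lintegral_neg_part ?_
  have : IsFiniteMeasure (ν.restrict S) := ⟨by rw [Measure.restrict_apply_univ]; exact hν.lt_top⟩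
  exact Integrable.of_bound (hZ.measurable_path ω).aestronglyMeasurable C
    (Eventually.of_forall fun u => hZ.bound u ω)

theorem devIntegral_eq [IsProbabilityMeasure P] (h : IsModel P F c μ α₀ g) (hZ : IsWeight F Z C)
    {x : ℝ≥0} (hxt : x ≤ t) (htT : t ≤ T) (ω : Ω) :
    h.devIntegral i Z t T x ω = devMeanReal P c i Z t T x ω := by
  rw [devIntegral, devMeanReal, h.devMean_eq hxt htT ω (hZ.measurable_path ω).ennreal_ofReal,
    h.devMean_eq hxt htT ω (hZ.measurable_path ω).neg.ennreal_ofReal]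
  refine integral_eq_toReal_sub hZ ?_ ω
  rw [StieltjesFunction.measure_Ioc]
  exact ENNReal.ofReal_ne_top

/-- Every version `A` has a.s. the same Stieltjes measure on `(t, T]` as `reportLaw`. What remains
is to split the integrand, for almost every path, into two parts with finite integral. -/
theorem reportIntegral_ae_eq [IsProbabilityMeasure P] (h : IsModel P F c μ α₀ g)
    (hZ : IsWeight F Z C) (htT : t ≤ T) {A : Ω → StieltjesFunction ℝ≥0}
    (hA : IsReportVersion P F c i A) :
    h.reportIntegral i Z A t T =ᵐ[P] reportMeanReal h i Z t T := by
  have hm : ∀ {z : ℝ≥0 → Ω → ℝ≥0∞}, (Measurable[MeasurableSpace.prod inferInstance (sigmaAt F ∞)]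
      fun q : ℝ≥0 × Ω => z q.1 q.2) → ∀ ω, Measurable fun u =>
      (∫⁻ ω', c.firstMark i ω' ∂P) * z u ω + devMean P c i z t T u ω := by
    intro z hz ω
    have h1 := (measurable_const (a := ∫⁻ ω', c.firstMark i ω' ∂P)).mul hz |>.add
      (h.measurable_devMean_coe (i := i) (t := t) (T := T) hz)
    exact (h1.mono (prod_sigmaAt_le F) le_rfl).comp measurable_prodMk_right
  have hR : ∀ {z : ℝ≥0 → Ω → ℝ≥0∞}, (Measurable[MeasurableSpace.prod inferInstance (sigmaAt F ∞)]
      fun q : ℝ≥0 × Ω => z q.1 q.2) → ∀ ω, h.reportMean i z t T ω = ∫⁻ u in Ioc t T,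
      ((∫⁻ ω', c.firstMark i ω' ∂P) * z u ω + devMean P c i z t T u ω) ∂reportLaw P c μ i ω := by
    intro z hz ω
    refine setLIntegral_congr_fun measurableSet_Ioc fun u hu => ?_
    simp only [h.devMean_eq_of_le hu.1.le hu.2 ω
      ((hz.mono (prod_sigmaAt_le F) le_rfl).comp measurable_prodMk_right)]
  have hfin : ∀ {z : ℝ≥0 → Ω → ℝ≥0∞}, (Measurable[MeasurableSpace.prod inferInstance (sigmaAt F ∞)]
      fun q : ℝ≥0 × Ω => z q.1 q.2) → (∀ u ω, z u ω ≤ ENNReal.ofReal C) →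
      ∀ᵐ ω ∂P, h.reportMean i z t T ω < ∞ := fun hz hK =>
    ae_lt_top ((h.measurable_reportMean hz).mono (sigmaAt_le F ∞) le_rfl)
      (h.lintegral_reportMean_ne_top hz hK ENNReal.ofReal_ne_top)
  filter_upwards [h.ae_restrict_measure_eq hA htT, hfin hZ.measurable_weightPos hZ.weightPos_le,
    hfin hZ.measurable_weightNeg hZ.weightNeg_le] with ω h1 h2 h3
  have hE := h.lintegral_firstMark_ne_top i
  rw [hR hZ.measurable_weightPos] at h2
  rw [hR hZ.measurable_weightNeg] at h3
  rw [reportIntegral, h1, reportMeanReal, hR hZ.measurable_weightPos, hR hZ.measurable_weightNeg,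
    ← setIntegral_toReal_sub (hm hZ.measurable_weightPos ω) (hm hZ.measurable_weightNeg ω) h2.ne h3.ne]
  refine setIntegral_congr_fun measurableSet_Ioc fun u hu => ?_
  have hdT := h.devBound_ne_top i T (K := ENNReal.ofReal C) ENNReal.ofReal_ne_top
  have hdp : devMean P c i (weightPos Z) t T u ω ≠ ∞ :=
    ((h.devMean_le hZ.weightPos_le u ω).trans_lt hdT.lt_top).ne
  have hdn : devMean P c i (weightNeg Z) t T u ω ≠ ∞ :=
    ((h.devMean_le hZ.weightNeg_le u ω).trans_lt hdT.lt_top).ne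
  rw [h.devIntegral_eq hZ le_rfl hu.2, devMeanReal, h.integral_firstMark,
    ENNReal.toReal_add (ENNReal.mul_ne_top hE ENNReal.ofReal_ne_top) hdp,
    ENNReal.toReal_add (ENNReal.mul_ne_top hE ENNReal.ofReal_ne_top) hdn, ENNReal.toReal_mul,
    ENNReal.toReal_mul,
    h.devMean_eq_of_le hu.1.le hu.2 ω (hZ.measurable_path ω).ennreal_ofReal,
    h.devMean_eq_of_le hu.1.le hu.2 ω (hZ.measurable_path ω).neg.ennreal_ofReal,
    h.devMean_eq le_rfl hu.2 ω (hZ.measurable_path ω).ennreal_ofReal,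
    h.devMean_eq le_rfl hu.2 ω (hZ.measurable_path ω).neg.ennreal_ofReal]
  have h5 : Z u ω = (weightPos Z u ω).toReal - (weightNeg Z u ω).toReal := by
    rw [ENNReal.toReal_ofReal', ENNReal.toReal_ofReal', max_zero_sub_max_neg_zero_eq_self]
  linear_combination (∫⁻ ω, c.firstMark i ω ∂P).toReal * h5

theorem integrable_reportMeanReal [IsProbabilityMeasure P] (h : IsModel P F c μ α₀ g)
    (hZ : IsWeight F Z C) : Integrable (reportMeanReal h i Z t T) P :=
  (integrable_toReal_of_lintegral_ne_top
    ((h.measurable_reportMean hZ.measurable_weightPos).mono (sigmaAt_le F ∞) le_rfl).aemeasurable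
    (h.lintegral_reportMean_ne_top hZ.measurable_weightPos hZ.weightPos_le ENNReal.ofReal_ne_top)).sub
  (integrable_toReal_of_lintegral_ne_top
    ((h.measurable_reportMean hZ.measurable_weightNeg).mono (sigmaAt_le F ∞) le_rfl).aemeasurable
    (h.lintegral_reportMean_ne_top hZ.measurable_weightNeg hZ.weightNeg_le ENNReal.ofReal_ne_top))

theorem setIntegral_paymentReal_late [IsProbabilityMeasure P] (h : IsModel P F c μ α₀ g)
    (hZ : IsWeight F Z C) {A : Set Ω} (hA : MeasurableSet[sigmaAt F ∞] A) :
    ∫ ω in A ∩ {ω | (t : ℝ≥0∞) < c.firstReport i ω}, paymentReal c i Z t T ω ∂P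
      = ∫ ω in A, reportMeanReal h i Z t T ω ∂P := by
  have hfin : ∀ {f : Ω → ℝ≥0∞} (S : Set Ω), ∫⁻ ω, f ω ∂P ≠ ∞ → ∫⁻ ω in S, f ω ∂P ≠ ∞ :=
    fun S hf => ((setLIntegral_le_lintegral _ _).trans_lt hf.lt_top).ne
  simp only [paymentReal, reportMeanReal]
  rw [setIntegral_toReal_sub (h.measurable_payment' hZ.measurable_weightPos)
    (h.measurable_payment' hZ.measurable_weightNeg)
    (hfin _ (h.lintegral_payment_ne_top hZ.weightPos_le ENNReal.ofReal_ne_top))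
    (hfin _ (h.lintegral_payment_ne_top hZ.weightNeg_le ENNReal.ofReal_ne_top)),
    setIntegral_toReal_sub
      ((h.measurable_reportMean hZ.measurable_weightPos).mono (sigmaAt_le F ∞) le_rfl)
      ((h.measurable_reportMean hZ.measurable_weightNeg).mono (sigmaAt_le F ∞) le_rfl)
      (hfin _ (h.lintegral_reportMean_ne_top hZ.measurable_weightPos hZ.weightPos_le
        ENNReal.ofReal_ne_top))
      (hfin _ (h.lintegral_reportMean_ne_top hZ.measurable_weightNeg hZ.weightNeg_le
        ENNReal.ofReal_ne_top)),
    h.setLIntegral_payment_late hZ.measurable_weightPos hA,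
    h.setLIntegral_payment_late hZ.measurable_weightNeg hA]

theorem lintegral_devMean_ne_top [IsProbabilityMeasure P] (h : IsModel P F c μ α₀ g)
    {z : ℝ≥0 → Ω → ℝ≥0∞} {K : ℝ≥0∞} (hK : ∀ u ω, z u ω ≤ K) (hK' : K ≠ ∞) (τ : Ω → ℝ≥0∞) :
    ∫⁻ ω, devMean P c i z t T (τ ω) ω ∂P ≠ ∞ := by
  refine ((lintegral_mono fun ω => h.devMean_le hK (τ ω) ω).trans_lt ?_).ne
  rw [lintegral_const, measure_univ, mul_one]
  exact (h.devBound_ne_top i T hK').lt_top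

theorem measurable_devMean' [IsProbabilityMeasure P] (h : IsModel P F c μ α₀ g)
    {z : ℝ≥0 → Ω → ℝ≥0∞} (hz : Measurable[MeasurableSpace.prod inferInstance (sigmaAt F ∞)]
      fun q : ℝ≥0 × Ω => z q.1 q.2) {τ : Ω → ℝ≥0∞} (hτ : Measurable τ) :
    Measurable fun ω => devMean P c i z t T (τ ω) ω :=
  h.measurable_devMean i (hz.mono (prod_sigmaAt_le F) le_rfl) t T hτ

theorem setIntegral_paymentReal_early [IsProbabilityMeasure P] (h : IsModel P F c μ α₀ g)
    (hS : HasIndepDevIncrements P c i T) (htT : t ≤ T) (hZ : IsWeight F Z C)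
    {A B : Set Ω} (hA : MeasurableSet[F t] A) (hB : MeasurableSet[c.sigmaPolicy i t] B) :
    ∫ ω in A ∩ B ∩ {ω | c.firstReport i ω ≤ t}, paymentReal c i Z t T ω ∂P
      = ∫ ω in A ∩ B ∩ {ω | c.firstReport i ω ≤ t},
        devMeanReal P c i Z t T (c.firstReport i ω) ω ∂P := by
  have hfin : ∀ {f : Ω → ℝ≥0∞} (S : Set Ω), ∫⁻ ω, f ω ∂P ≠ ∞ → ∫⁻ ω in S, f ω ∂P ≠ ∞ :=
    fun S hf => ((setLIntegral_le_lintegral _ _).trans_lt hf.lt_top).ne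
  have hSm : MeasurableSet (A ∩ B ∩ {ω | c.firstReport i ω ≤ t}) :=
    ((F.le t A hA).inter (h.sigmaPolicy_le i t B hB)).inter
      (measurableSet_le (h.measurable_firstReport i) measurable_const)
  have key : ∀ {z : ℝ≥0 → Ω → ℝ≥0∞}, (Measurable[MeasurableSpace.prod inferInstance (sigmaAt F ∞)]
      fun q : ℝ≥0 × Ω => z q.1 q.2) →
      ∫⁻ ω in A ∩ B ∩ {ω | c.firstReport i ω ≤ t}, payment c i z t T ω ∂P
      = ∫⁻ ω in A ∩ B ∩ {ω | c.firstReport i ω ≤ t}, devMean P c i z t T (c.firstReport i ω) ω ∂P := by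
    intro z hz
    rw [← h.setLIntegral_devSum_firstReport hS htT hz hA hB]
    exact setLIntegral_congr_fun hSm fun ω hω => payment_of_le hω.2
  have hτ := h.measurable_firstReport i
  simp only [paymentReal, devMeanReal]
  rw [setIntegral_toReal_sub (h.measurable_payment' hZ.measurable_weightPos)
    (h.measurable_payment' hZ.measurable_weightNeg)
    (hfin _ (h.lintegral_payment_ne_top hZ.weightPos_le ENNReal.ofReal_ne_top))
    (hfin _ (h.lintegral_payment_ne_top hZ.weightNeg_le ENNReal.ofReal_ne_top)),
    setIntegral_toReal_sub (h.measurable_devMean' hZ.measurable_weightPos hτ)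
      (h.measurable_devMean' hZ.measurable_weightNeg hτ)
      (hfin _ (h.lintegral_devMean_ne_top hZ.weightPos_le ENNReal.ofReal_ne_top _))
      (hfin _ (h.lintegral_devMean_ne_top hZ.weightNeg_le ENNReal.ofReal_ne_top _)),
    key hZ.measurable_weightPos, key hZ.measurable_weightNeg]

end IsModel

end Insurance

end

/-! ### Conditional expectation before the first report; dropping superfluous information. -/

section
namespace Insurance

namespace Portfolio

variable {Ω : Type*} {n : ℕ} (c : Portfolio Ω n) (i : Fin n)

/-- No update precedes the first report, so a first report by time `s` is seen from the count over
all marks being nonzero. -/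
theorem measurableSet_firstReport_le {s t : ℝ≥0} (hst : s ≤ t) :
    MeasurableSet[c.sigmaPolicy i t] {ω | c.firstReport i ω ≤ s} := by
  have h1 : Measurable[c.sigmaPolicy i t] (markedCount (c.reportTime i) (c.mark i) s univ) :=
    measurable_iff_comap_le.2 (le_iSup_of_le s (le_iSup_of_le hst
      (le_iSup_of_le univ (le_iSup_of_le MeasurableSet.univ le_rfl))))
  have h2 : {ω | c.firstReport i ω ≤ s}
      = markedCount (c.reportTime i) (c.mark i) s univ ⁻¹' {0}ᶜ := by
    ext ω
    rw [mem_preimage, mem_compl_singleton_iff, mem_ofPred_eq]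
    constructor
    · intro h3 h4
      have h5 := ENNReal.tsum_eq_zero.1 h4 0
      rw [indicator_of_mem (by exact ⟨h3, mem_univ _⟩)] at h5
      exact one_ne_zero h5
    · intro h3
      by_contra h4
      refine h3 (ENNReal.tsum_eq_zero.2 fun j => indicator_of_notMem (fun h5 => h4 ?_) _)
      refine le_trans ?_ h5.1
      cases j with
      | zero => exact le_rfl
      | succ j => exact le_self_add
  rw [h2]
  exact h1 (measurableSet_singleton 0).compl

theorem lt_firstReport_eq_compl (t : ℝ≥0) :
    {ω | (t : ℝ≥0∞) < c.firstReport i ω} = {ω | c.firstReport i ω ≤ t}ᶜ := by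
  ext ω
  simp

theorem measurableSet_lt_firstReport (t : ℝ≥0) :
    MeasurableSet[c.sigmaPolicy i t] {ω | (t : ℝ≥0∞) < c.firstReport i ω} := by
  rw [c.lt_firstReport_eq_compl i t]
  exact MeasurableSet.compl (c.measurableSet_firstReport_le i le_rfl)

open Classical in
/-- The first reporting time, if it is known at time `t`. -/
def cappedReport (t : ℝ≥0) (ω : Ω) : ℝ≥0∞ :=
  if c.firstReport i ω ≤ t then c.firstReport i ω else ∞

theorem cappedReport_of_le {t : ℝ≥0} {ω : Ω} (hω : c.firstReport i ω ≤ t) :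
    c.cappedReport i t ω = c.firstReport i ω := if_pos hω

theorem measurable_cappedReport (t : ℝ≥0) :
    Measurable[c.sigmaPolicy i t] (c.cappedReport i t) := by
  refine measurable_of_Iic fun a => ?_
  induction a with
  | top => simp
  | coe a =>
    have : c.cappedReport i t ⁻¹' Iic (a : ℝ≥0∞)
        = {ω | c.firstReport i ω ≤ ((min a t : ℝ≥0) : ℝ≥0∞)} := by
      ext ω
      simp only [mem_preimage, mem_Iic, mem_ofPred_eq, cappedReport, ENNReal.coe_min, le_min_iff]
      split_ifs with h1 <;> simp [h1]
    rw [this]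
    exact c.measurableSet_firstReport_le i (min_le_right _ _)

end Portfolio

variable {Ω : Type*} [mΩ : MeasurableSpace Ω] {n : ℕ} {P : Measure Ω} {F : Filtration ℝ≥0 mΩ}
  {c : Portfolio Ω n} {μ : ℝ≥0 → Ω → ℝ} {α₀ : ℝ} {g : ℝ → ℝ} {i : Fin n}
  {t T : ℝ≥0} {Z : ℝ≥0 → Ω → ℝ} {C : ℝ}

namespace IsModel

/-- The conditional probability that there is no reporting up to time `t` is positive. -/
theorem condExp_lt_firstReport_pos [IsProbabilityMeasure P] (h : IsModel P F c μ α₀ g) (i : Fin n)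
    (t : ℝ≥0) : ∀ᵐ ω ∂P, 0 < (P⟦{ω | (t : ℝ≥0∞) < c.firstReport i ω} | F t⟧) ω := by
  have hm : MeasurableSet {ω | (t : ℝ≥0∞) < c.firstReport i ω} :=
    measurableSet_lt measurable_const (h.measurable_firstReport i)
  have hm' := h.measurableSet_lt_accident i t
  -- A report cannot precede the accident, so the probability of no report dominates the survival
  -- probability `exp (-Γ_t)`.
  have h1 : P⟦{ω | (t : ℝ≥0∞) < c.accident i ω} | F t⟧
      ≤ᵐ[P] P⟦{ω | (t : ℝ≥0∞) < c.firstReport i ω} | F t⟧ :=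
    condExp_mono ((integrable_const _).indicator hm') ((integrable_const _).indicator hm)
      (Eventually.of_forall fun ω => indicator_le_indicator_of_subset
        (fun ω hω => lt_of_lt_of_le (b := c.accident i ω) hω le_self_add) (fun _ => zero_le_one) ω)
  filter_upwards [h1, h.accident_condExp i ∞ t le_top, h.condExp_lt_accident i t]
    with ω h2 h3 h4
  rw [← h3, h4] at h2
  exact (Real.exp_pos _).trans_le h2

theorem condExp_late [IsProbabilityMeasure P] (h : IsModel P F c μ α₀ g) (hZ : IsWeight F Z C) :
    P[{ω | (t : ℝ≥0∞) < c.firstReport i ω}.indicator (paymentReal c i Z t T) |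
        F t ⊔ c.sigmaPolicy i t]
      =ᵐ[P] {ω | (t : ℝ≥0∞) < c.firstReport i ω}.indicator fun ω =>
        (P[reportMeanReal h i Z t T | F t]) ω
          / (P⟦{ω | (t : ℝ≥0∞) < c.firstReport i ω} | F t⟧) ω :=
  condExp_sup_indicator_ae_eq (F.le t) (h.sigmaPolicy_le i t)
    (le_sup_right (a := (F t : MeasurableSpace Ω)) _ (c.measurableSet_lt_firstReport i t))
    (fun _ hB => c.inter_lt_firstReport_of_sigmaPolicy i hB) (h.condExp_lt_firstReport_pos i t)
    (h.integrable_paymentReal hZ) (h.integrable_reportMeanReal hZ)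
    fun _ hA => h.setIntegral_paymentReal_late hZ (le_sigmaAt_top F t _ hA)

theorem abs_devMeanReal_le (h : IsModel P F c μ α₀ g) (hZ : IsWeight F Z C) (x : ℝ≥0∞) (ω : Ω) :
    |devMeanReal P c i Z t T x ω|
      ≤ ((∫⁻ ω, c.devTotalENN i T ω ∂P) * ENNReal.ofReal C).toReal := by
  have hfin := h.devBound_ne_top i T (K := ENNReal.ofReal C) ENNReal.ofReal_ne_top
  refine abs_sub_le_of_nonneg_of_le ENNReal.toReal_nonneg ?_ ENNReal.toReal_nonneg ?_
  · exact ENNReal.toReal_mono hfin (h.devMean_le hZ.weightPos_le x ω)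
  · exact ENNReal.toReal_mono hfin (h.devMean_le hZ.weightNeg_le x ω)

theorem measurable_devMeanReal [IsProbabilityMeasure P] (h : IsModel P F c μ α₀ g)
    (hZ : IsWeight F Z C) {τ : Ω → ℝ≥0∞} (hτ : Measurable τ) :
    Measurable fun ω => devMeanReal P c i Z t T (τ ω) ω :=
  (h.measurable_devMean' hZ.measurable_weightPos hτ).ennreal_toReal.sub
    (h.measurable_devMean' hZ.measurable_weightNeg hτ).ennreal_toReal

theorem integrable_devMeanReal [IsProbabilityMeasure P] (h : IsModel P F c μ α₀ g)
    (hZ : IsWeight F Z C) {τ : Ω → ℝ≥0∞} (hτ : Measurable τ) :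
    Integrable (fun ω => devMeanReal P c i Z t T (τ ω) ω) P :=
  Integrable.of_bound (h.measurable_devMeanReal hZ hτ).aestronglyMeasurable _
    (Eventually.of_forall fun ω => h.abs_devMeanReal_le hZ (τ ω) ω)

theorem stronglyMeasurable_devMeanReal [IsProbabilityMeasure P] (h : IsModel P F c μ α₀ g)
    (hZ : IsWeight F Z C) (x : ℝ≥0∞) :
    StronglyMeasurable[sigmaAt F ∞] (devMeanReal P c i Z t T x) :=
  ((h.measurable_devMean i (mβ := sigmaAt F ∞) hZ.measurable_weightPos t T
      (@measurable_const _ _ _ (sigmaAt F ∞) x)).ennreal_toReal.sub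
    (h.measurable_devMean i (mβ := sigmaAt F ∞) hZ.measurable_weightNeg t T
      (@measurable_const _ _ _ (sigmaAt F ∞) x)).ennreal_toReal).stronglyMeasurable

theorem tendsto_devMeanReal (h : IsModel P F c μ α₀ g) (hZ : IsWeight F Z C) (x : ℝ≥0) (ω : Ω) :
    Tendsto (fun y : ℝ≥0 => devMeanReal P c i Z t T y ω) (𝓝[≤] x)
      (𝓝 (devMeanReal P c i Z t T x ω)) := by
  have hfin := h.devBound_ne_top i T (K := ENNReal.ofReal C) ENNReal.ofReal_ne_top
  have key : ∀ {Z : ℝ≥0 → Ω → ℝ}, IsWeight F Z C →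
      Tendsto (fun y : ℝ≥0 => (devMean P c i (weightPos Z) t T y ω).toReal) (𝓝[≤] x)
      (𝓝 (devMean P c i (weightPos Z) t T x ω).toReal) := fun hZ =>
    (ENNReal.tendsto_toReal ((h.devMean_le hZ.weightPos_le x ω).trans_lt hfin.lt_top).ne).comp
      (h.tendsto_lintegral_devSum i (ENNReal.continuous_ofReal.comp (hZ.continuous ω))
        (fun u _ => hZ.weightPos_le u ω) ENNReal.ofReal_ne_top t x)
  exact (key hZ).sub (key hZ.neg)

/-- On the event that the first reporting is known at time `t`, the information about the first
reporting and about the development can be dropped. -/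
theorem indicator_condExp_devMeanReal [IsProbabilityMeasure P] (h : IsModel P F c μ α₀ g)
    (hZ : IsWeight F Z C) (s : ℝ≥0) (x : ℝ≥0∞) :
    {ω | c.firstReport i ω ≤ t}.indicator
        (P[devMeanReal P c i Z t T x | c.sigmaFirst i ⊔ c.sigmaDev i s ⊔ F t])
      =ᵐ[P] {ω | c.firstReport i ω ≤ t}.indicator (P[devMeanReal P c i Z t T x | F t]) := by
  set D := {ω | c.firstReport i ω ≤ t} with hD
  have hWi : Integrable (devMeanReal P c i Z t T x) P :=
    h.integrable_devMeanReal hZ (measurable_const (a := x))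
  have hDfirst : MeasurableSet[c.sigmaFirst i] D := by
    refine (le_iSup (fun t => eventSigma (c.reportTime i 0) (c.mark i 0) t) t) D ?_
    refine MeasurableSpace.measurableSet_generateFrom ⟨t, le_rfl, univ, MeasurableSet.univ, ?_⟩
    ext ω
    exact (and_iff_left (mem_univ _)).symm
  have hlarge : F t ⊔ sigmaLarge c univ t ≤ mΩ := sup_le (F.le t) (h.sigmaLarge_le univ t)
  have hDl : MeasurableSet[F t ⊔ sigmaLarge c univ t] D :=
    le_sup_right (a := (F t : MeasurableSpace Ω)) _ (measurableSet_firstReport_le le_rfl)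
  have hle : c.sigmaFirst i ⊔ c.sigmaDev i s ⊔ F t ≤ mΩ :=
    sup_le (sup_le (Portfolio.sigmaFirst_le (h.sigmaMarks_le i) (h.sigmaAccident_le i))
      (Portfolio.sigmaDev_le (h.sigmaMarks_le i) s)) (F.le t)
  have hmarks : c.sigmaMarks i ≤ F t ⊔ sigmaLarge c univ t :=
    (sigmaMarks_le_sigmaLarge (mem_univ i) t).trans le_sup_right
  refine indicator_condExp_ae_eq hle (le_sup_left (b := (F t : MeasurableSpace Ω)) _
    (le_sup_left (b := c.sigmaDev i s) _ hDfirst)) hWi integrable_condExp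
    (stronglyMeasurable_condExp.mono le_sup_right) fun A hA => ?_
  -- `sigmaFirst` also describes first reports after `t`, so it need not be contained in `F t ⊔
  -- sigmaLarge c univ t`. Its trace on `D` is: on `D` a time `s` may be replaced by `min s t`.
  have hAD : MeasurableSet[F t ⊔ sigmaLarge c univ t] (A ∩ D) := by
    have hfirst : ∀ B, MeasurableSet[c.sigmaFirst i] B →
        MeasurableSet[F t ⊔ sigmaLarge c univ t] (B ∩ D) := by
      intro B hB
      have hgen : c.sigmaFirst i = MeasurableSpace.generateFrom
          (⋃ r : ℝ≥0, {A | ∃ s ≤ r, ∃ B : Set (ℝ≥0 × ℝ≥0), MeasurableSet B ∧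
            A = {ω | c.reportTime i 0 ω ≤ (s : ℝ≥0∞) ∧ c.mark i 0 ω ∈ B}}) :=
        MeasurableSpace.iSup_generateFrom _
      rw [hgen] at hB
      refine measurableSet_inter_of_generateFrom hDl ?_ hB
      intro A hA
      obtain ⟨r, s, -, B, hB, rfl⟩ := mem_iUnion.1 hA
      have h2 : {ω | c.reportTime i 0 ω ≤ (s : ℝ≥0∞) ∧ c.mark i 0 ω ∈ B} ∩ D
          = {ω | c.firstReport i ω ≤ ((min s t : ℝ≥0) : ℝ≥0∞)} ∩ {ω | c.mark i 0 ω ∈ B} := by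
        ext ω
        simp only [hD, mem_inter_iff, mem_ofPred_eq, ENNReal.coe_min, le_min_iff]
        exact ⟨fun h3 => ⟨⟨h3.1.1, h3.2⟩, h3.1.2⟩, fun h3 => ⟨⟨h3.1.1, h3.2⟩, h3.1.2⟩⟩
      rw [h2]
      exact MeasurableSet.inter (le_sup_right (a := (F t : MeasurableSpace Ω)) _
        (measurableSet_firstReport_le (min_le_right _ _)))
        (Portfolio.measurable_mark_of_le hmarks 0 hB)
    have hgen : c.sigmaFirst i ⊔ c.sigmaDev i s ⊔ F t = MeasurableSpace.generateFrom
        ({A | MeasurableSet[c.sigmaFirst i] A} ∪ {A | MeasurableSet[c.sigmaDev i s ⊔ F t] A}) := by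
      rw [← MeasurableSpace.generateFrom_sup_generateFrom,
        @MeasurableSpace.generateFrom_measurableSet _ (c.sigmaFirst i),
        @MeasurableSpace.generateFrom_measurableSet _ (c.sigmaDev i s ⊔ F t), sup_assoc]
    rw [hgen] at hA
    refine measurableSet_inter_of_generateFrom hDl (fun B hB => ?_) hA
    rcases hB with hB | hB
    · exact hfirst B hB
    · exact MeasurableSet.inter
        ((sup_le (Portfolio.sigmaDev_le hmarks s) le_sup_left :
          c.sigmaDev i s ⊔ F t ≤ F t ⊔ sigmaLarge c univ t) _ hB) hDl
  rw [← setIntegral_condExp hlarge hWi hAD]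
  refine setIntegral_congr_ae (hlarge _ hAD) ?_
  filter_upwards [h.condExp_sigmaLarge_ae_eq t (h.stronglyMeasurable_devMeanReal hZ x) hWi]
    with ω hω _ using hω

end IsModel

end Insurance

end

/-! ### Inserting the random reporting time by discretisation. -/

section
namespace Insurance

/-- The largest multiple of `1 / (m + 1)` which is at most `x`. -/
def floorApprox (m : ℕ) (x : ℝ≥0) : ℝ≥0 := (⌊x * (m + 1)⌋₊ : ℝ≥0) / (m + 1)

theorem floorApprox_le (m : ℕ) (x : ℝ≥0) : floorApprox m x ≤ x :=
  div_le_of_le_mul₀ zero_le zero_le (Nat.floor_le zero_le)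

theorem measurable_floorApprox (m : ℕ) : Measurable (floorApprox m) :=
  (((measurable_of_countable fun k : ℕ => (k : ℝ≥0)).comp
    (Nat.measurable_floor.comp (measurable_id.mul_const _))).div_const _)

theorem tendsto_floorApprox (x : ℝ≥0) : Tendsto (fun m => floorApprox m x) atTop (𝓝[≤] x) := by
  refine tendsto_nhdsWithin_iff.2 ⟨?_, Eventually.of_forall fun m => floorApprox_le m x⟩
  rw [← NNReal.tendsto_coe]
  have h1 : Tendsto (fun m : ℕ => ((⌊(x : ℝ) * ((m : ℝ) + 1)⌋₊ : ℕ) : ℝ) / ((m : ℝ) + 1)) atTop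
      (𝓝 (x : ℝ)) :=
    (tendsto_nat_floor_mul_div_atTop x.coe_nonneg).comp
      (tendsto_atTop_add_const_right _ 1 tendsto_natCast_atTop_atTop)
  refine h1.congr fun m => ?_
  have h2 : ⌊(x : ℝ) * ((m : ℝ) + 1)⌋₊ = ⌊x * ((m : ℝ≥0) + 1)⌋₊ := by
    refine eq_of_forall_le_iff fun k => ?_
    rw [Nat.le_floor_iff (by positivity), Nat.le_floor_iff zero_le, ← NNReal.coe_le_coe]
    push_cast
    rfl
  rw [floorApprox, h2]
  push_cast
  rfl

theorem toNNReal_le_of_le_coe {a : ℝ≥0∞} {b : ℝ≥0} (hab : a ≤ b) : a.toNNReal ≤ b :=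
  (ENNReal.toNNReal_mono ENNReal.coe_ne_top hab).trans_eq (ENNReal.toNNReal_coe _)

/-- Each `f k` is replaced by an `m`-measurable version; the limsup of these versions is
`m`-measurable and agrees with `G` almost surely. -/
theorem aestronglyMeasurable_of_tendsto_ae_of_sub {Ω : Type*} {m m0 : MeasurableSpace Ω}
    {P : Measure[m0] Ω} {f : ℕ → Ω → ℝ} {G : Ω → ℝ} (hf : ∀ k, AEStronglyMeasurable[m] (f k) P)
    (hG : ∀ᵐ ω ∂P, Tendsto (fun k => f k ω) atTop (𝓝 (G ω))) : AEStronglyMeasurable[m] G P := by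
  have h1 : ∀ᵐ ω ∂P, ∀ k, f k ω = (hf k).mk (f k) ω := ae_all_iff.2 fun k => (hf k).ae_eq_mk
  refine ⟨fun ω => limsup (fun k => (hf k).mk (f k) ω) atTop,
    (Measurable.limsup fun k => (hf k).stronglyMeasurable_mk.measurable).stronglyMeasurable, ?_⟩
  filter_upwards [h1, hG] with ω h1 h2
  simp only [← h1]
  exact h2.limsup_eq.symm

variable {Ω : Type*} [mΩ : MeasurableSpace Ω] {n : ℕ} {P : Measure Ω} {F : Filtration ℝ≥0 mΩ}
  {c : Portfolio Ω n} {μ : ℝ≥0 → Ω → ℝ} {α₀ : ℝ} {g : ℝ → ℝ} {i : Fin n}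
  {t T : ℝ≥0} {Z : ℝ≥0 → Ω → ℝ} {C : ℝ}

namespace IsModel

/-- For each `x` the variable `Φ x` is fixed only up to a null set, so a random time cannot be
inserted directly. The discretised time has countably many values `k / (m + 1)`, and on each of its
level sets the statement for fixed `x` applies. The capped reporting time is used because it is
measurable for the history at time `t`. -/
theorem condExp_floorApprox [IsProbabilityMeasure P] (h : IsModel P F c μ α₀ g)
    (hZ : IsWeight F Z C) {Φ : ℝ≥0 → Ω → ℝ}
    (hΦ : ∀ x ≤ t, Φ x =ᵐ[P]
      P[devMeanReal P c i Z t T x | c.sigmaFirst i ⊔ c.sigmaDev i (t - x) ⊔ F t]) (m : ℕ) :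
    P[{ω | c.firstReport i ω ≤ t}.indicator fun ω =>
        devMeanReal P c i Z t T (floorApprox m (c.cappedReport i t ω).toNNReal) ω |
          F t ⊔ c.sigmaPolicy i t]
      =ᵐ[P] {ω | c.firstReport i ω ≤ t}.indicator fun ω =>
        Φ (floorApprox m (c.cappedReport i t ω).toNNReal) ω := by
  set D := {ω | c.firstReport i ω ≤ t} with hD
  set f : Ω → ℝ := D.indicator fun ω =>
    devMeanReal P c i Z t T (floorApprox m (c.cappedReport i t ω).toNNReal) ω with hf
  have hle : F t ⊔ c.sigmaPolicy i t ≤ mΩ := sup_le (F.le t) (h.sigmaPolicy_le i t)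
  have hpol : c.sigmaPolicy i t ≤ F t ⊔ c.sigmaPolicy i t := le_sup_right
  have hDm : MeasurableSet[c.sigmaPolicy i t] D := c.measurableSet_firstReport_le i le_rfl
  have hτ : Measurable[c.sigmaPolicy i t] fun ω => (c.cappedReport i t ω).toNNReal :=
    (c.measurable_cappedReport i t).ennreal_toNNReal
  have hfi : Integrable f P :=
    (h.integrable_devMeanReal hZ (((measurable_floorApprox m).comp
      (hτ.mono (h.sigmaPolicy_le i t) le_rfl)).coe_nnreal_ennreal)).indicator (hle _ (hpol _ hDm))
  have hWi : ∀ x, Integrable (devMeanReal P c i Z t T x) P := fun x =>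
    h.integrable_devMeanReal hZ (measurable_const (a := x))
  -- off the event that the first reporting is known
  have hoff : P[f | F t ⊔ c.sigmaPolicy i t] =ᵐ[P]
      D.indicator (P[f | F t ⊔ c.sigmaPolicy i t]) := by
    have h1 := condExp_indicator hfi (hpol _ hDm)
    have h2 : D.indicator f = f := by rw [hf, indicator_indicator, inter_self]
    rwa [h2] at h1
  -- on the events on which the approximation is constant
  have hon : ∀ k : ℕ, ∀ᵐ ω ∂P, ω ∈ D → ⌊(c.cappedReport i t ω).toNNReal * (m + 1)⌋₊ = k →
      (P[f | F t ⊔ c.sigmaPolicy i t]) ω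
        = Φ (floorApprox m (c.cappedReport i t ω).toNNReal) ω := by
    intro k
    set x : ℝ≥0 := (k : ℝ≥0) / (m + 1) with hx
    by_cases hxt : x ≤ t
    · set S := D ∩ {ω | ⌊(c.cappedReport i t ω).toNNReal * (m + 1)⌋₊ = k} with hSdef
      have hSm : MeasurableSet[F t ⊔ c.sigmaPolicy i t] S := by
        refine hpol _ (MeasurableSet.inter hDm ?_)
        exact (Nat.measurable_floor.comp (hτ.mul_const _)) (measurableSet_singleton k)
      have h1 := condExp_indicator hfi hSm
      have h2 : S.indicator f = S.indicator (devMeanReal P c i Z t T x) := by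
        ext ω
        by_cases hω : ω ∈ S
        · rw [indicator_of_mem hω, indicator_of_mem hω, hf, indicator_of_mem hω.1, floorApprox,
            hω.2]
        · rw [indicator_of_notMem hω, indicator_of_notMem hω]
      rw [h2] at h1
      have h3 := condExp_indicator (hWi x) hSm
      -- For fixed `x` the history of the policy adds nothing to `F t`. On `D` the same is true of
      -- the σ-algebra that defines `Φ x`, so the two conditional expectations coincide there.
      have h4 := h.condExp_ae_eq_of_le_sigmaLarge (t := t) (h.stronglyMeasurable_devMeanReal hZ x)
        (hWi x) (F t ⊔ c.sigmaPolicy i t) le_sup_left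
        (sup_le_sup_left (sigmaPolicy_le_sigmaLarge (mem_univ i) t) _)
      filter_upwards [h1, h3, h4, h.indicator_condExp_devMeanReal (i := i) (t := t) (T := T) hZ
        (t - x) x, hΦ x hxt] with ω h1 h3 h4 h5 h6 hωD hωk
      have hωS : ω ∈ S := ⟨hωD, hωk⟩
      rw [indicator_of_mem hωS] at h1 h3
      rw [indicator_of_mem hωD, indicator_of_mem hωD] at h5
      rw [← h1, h3, h4, ← h5, ← h6, floorApprox, hωk]
    -- Values above `t` do not occur: on `D` the discretised time is at most the reporting time.
    · refine Eventually.of_forall fun ω hωD hωk => absurd ?_ hxt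
      have h1 := floorApprox_le m (c.cappedReport i t ω).toNNReal
      rw [floorApprox, hωk] at h1
      refine h1.trans ?_
      rw [c.cappedReport_of_le i hωD]
      exact toNNReal_le_of_le_coe hωD
  filter_upwards [hoff, ae_all_iff.2 hon] with ω h1 h2
  by_cases hω : ω ∈ D
  · rw [indicator_of_mem hω]
    exact h2 _ hω rfl
  · rw [indicator_of_notMem hω] at h1 ⊢
    exact h1

/-- Independent increments replace the payments by their mean at the reporting time. This mean and
`Φ` are both left-continuous in that time, which `floorApprox` approaches from below. The identity
for discretised times therefore passes to the limit, all terms being bounded by `B`. -/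
theorem condExp_early [IsProbabilityMeasure P] (h : IsModel P F c μ α₀ g)
    (hS : HasIndepDevIncrements P c i T) (htT : t ≤ T) (hZ : IsWeight F Z C) {Φ : ℝ≥0 → Ω → ℝ}
    (hΦ : ∀ x ≤ t, Φ x =ᵐ[P]
      P[devMeanReal P c i Z t T x | c.sigmaFirst i ⊔ c.sigmaDev i (t - x) ⊔ F t])
    (hΦ' : ∀ᵐ ω ∂P, ∀ x ≤ t, ContinuousWithinAt (fun y => Φ y ω) (Iic x) x) :
    P[{ω | c.firstReport i ω ≤ t}.indicator (paymentReal c i Z t T) | F t ⊔ c.sigmaPolicy i t]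
      =ᵐ[P] {ω | c.firstReport i ω ≤ t}.indicator fun ω => Φ (c.firstReport i ω).toNNReal ω := by
  set D := {ω | c.firstReport i ω ≤ t} with hD
  have hle : F t ⊔ c.sigmaPolicy i t ≤ mΩ := sup_le (F.le t) (h.sigmaPolicy_le i t)
  have hDm : MeasurableSet D := h.sigmaPolicy_le i t _ (c.measurableSet_firstReport_le i le_rfl)
  have hτ : Measurable (c.firstReport i) := h.measurable_firstReport i
  set B : ℝ := ((∫⁻ ω, c.devTotalENN i T ω ∂P) * ENNReal.ofReal C).toReal with hB
  have hB0 : 0 ≤ B := ENNReal.toReal_nonneg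
  set f : Ω → ℝ := D.indicator fun ω => devMeanReal P c i Z t T (c.firstReport i ω) ω with hf
  have h1 : P[D.indicator (paymentReal c i Z t T) | F t ⊔ c.sigmaPolicy i t]
      =ᵐ[P] P[f | F t ⊔ c.sigmaPolicy i t] := by
    refine condExp_sup_ae_eq_of_setIntegral (F.le t) (h.sigmaPolicy_le i t)
      ((h.integrable_paymentReal hZ).indicator hDm)
      ((h.integrable_devMeanReal hZ hτ).indicator hDm) fun A B hA hB => ?_
    rw [setIntegral_indicator hDm, hf, setIntegral_indicator hDm]
    exact h.setIntegral_paymentReal_early hS htT hZ hA hB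
  set fs : ℕ → Ω → ℝ := fun m => D.indicator fun ω =>
    devMeanReal P c i Z t T (floorApprox m (c.cappedReport i t ω).toNNReal) ω with hfs
  set gs : ℕ → Ω → ℝ := fun m => D.indicator fun ω =>
    Φ (floorApprox m (c.cappedReport i t ω).toNNReal) ω with hgs
  set G : Ω → ℝ := D.indicator fun ω => Φ (c.firstReport i ω).toNNReal ω with hG
  have hfg : ∀ m, P[fs m | F t ⊔ c.sigmaPolicy i t] =ᵐ[P] gs m := fun m =>
    h.condExp_floorApprox hZ hΦ m
  have hcap : Measurable fun ω => (c.cappedReport i t ω).toNNReal :=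
    ((c.measurable_cappedReport i t).mono (h.sigmaPolicy_le i t) le_rfl).ennreal_toNNReal
  have hfsi : ∀ m, Integrable (fs m) P := fun m =>
    (h.integrable_devMeanReal hZ (((measurable_floorApprox m).comp hcap).coe_nnreal_ennreal)).indicator
      hDm
  have hfsb : ∀ m ω, ‖fs m ω‖ ≤ B := by
    intro m ω
    by_cases hω : ω ∈ D
    · simp only [hfs, indicator_of_mem hω]
      exact h.abs_devMeanReal_le hZ _ ω
    · simp only [hfs, indicator_of_notMem hω, norm_zero]
      exact hB0
  have hgsi : ∀ m, Integrable (gs m) P := fun m => (integrable_congr (hfg m)).1 integrable_condExp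
  have hgsb : ∀ m, ∀ᵐ ω ∂P, ‖gs m ω‖ ≤ B := by
    intro m
    have h2 := ae_bdd_abs_condExp_of_ae_bdd_abs (m := F t ⊔ c.sigmaPolicy i t) (R := B)
      (Eventually.of_forall fun ω => hfsb m ω : ∀ᵐ ω ∂P, |fs m ω| ≤ B)
    filter_upwards [h2, hfg m] with ω h3 h4
    rw [← h4]
    exact h3
  have hcapeq : ∀ ω ∈ D, c.cappedReport i t ω = c.firstReport i ω := fun ω hω =>
    c.cappedReport_of_le i hω
  have hfst : ∀ ω, Tendsto (fun m => fs m ω) atTop (𝓝 (f ω)) := by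
    intro ω
    by_cases hω : ω ∈ D
    · simp only [hfs, hf, indicator_of_mem hω, hcapeq ω hω]
      obtain ⟨x, hx⟩ : ∃ x : ℝ≥0, c.firstReport i ω = x :=
        ⟨_, (ENNReal.coe_toNNReal (lt_of_le_of_lt (show c.firstReport i ω ≤ t from hω)
          ENNReal.coe_lt_top).ne).symm⟩
      rw [hx, ENNReal.toNNReal_coe]
      exact (h.tendsto_devMeanReal hZ x ω).comp (tendsto_floorApprox x)
    · simp only [hfs, hf, indicator_of_notMem hω]
      exact tendsto_const_nhds
  have hgst : ∀ᵐ ω ∂P, Tendsto (fun m => gs m ω) atTop (𝓝 (G ω)) := by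
    filter_upwards [hΦ'] with ω hω'
    by_cases hω : ω ∈ D
    · simp only [hgs, hG, indicator_of_mem hω, hcapeq ω hω]
      exact (hω' _ (toNNReal_le_of_le_coe hω)).tendsto.comp (tendsto_floorApprox _)
    · simp only [hgs, hG, indicator_of_notMem hω]
      exact tendsto_const_nhds
  -- `Φ` need not be jointly measurable. Measurability of `G`, up to null sets, comes from its being
  -- an a.s. limit of conditional expectations.
  have hGm : AEStronglyMeasurable[F t ⊔ c.sigmaPolicy i t] G P :=
    aestronglyMeasurable_of_tendsto_ae_of_sub
      (fun m => stronglyMeasurable_condExp.aestronglyMeasurable.congr (hfg m)) hgst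
  have hGb : ∀ᵐ ω ∂P, ‖G ω‖ ≤ B := by
    filter_upwards [hgst, ae_all_iff.2 hgsb] with ω h2 h3
    exact le_of_tendsto h2.norm (Eventually.of_forall h3)
  have hGi : Integrable G P := Integrable.of_bound (hGm.mono hle) B hGb
  have h2 : P[f | F t ⊔ c.sigmaPolicy i t] =ᵐ[P] P[G | F t ⊔ c.sigmaPolicy i t] := by
    refine tendsto_condExp_unique fs gs f G hfsi hgsi (Eventually.of_forall hfst) hgst
      (fun _ => B) (integrable_const B) (fun _ => B) (integrable_const B)
      (fun m => Eventually.of_forall (hfsb m)) hgsb fun m => ?_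
    refine (hfg m).trans ?_
    exact (condExp_of_aestronglyMeasurable' hle
      (stronglyMeasurable_condExp.aestronglyMeasurable.congr (hfg m)) (hgsi m)).symm
  exact h1.trans (h2.trans (condExp_of_aestronglyMeasurable' hle hGm hGi))

end IsModel

end Insurance

end

/-! ### Existence of a left-continuous version. -/

section
namespace Insurance

/-- Bernstein approximations converge uniformly, and each is a finite sum of fixed polynomials
multiplied by values of `f` at given points. -/
theorem stronglyMeasurable_continuousMap {Ω : Type*} [MeasurableSpace Ω]
    {f : Ω → C(unitInterval, ℝ)} (hf : ∀ r, Measurable fun ω => f ω r) : StronglyMeasurable f := by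
  refine stronglyMeasurable_of_tendsto atTop
    (f := fun (N : ℕ) ω => bernsteinApproximation N (f ω)) (fun N => ?_)
    (tendsto_pi_nhds.2 fun ω => bernsteinApproximation_uniform (f ω))
  unfold bernsteinApproximation
  refine Finset.stronglyMeasurable_fun_sum _ fun k _ => ?_
  have h1 : Continuous fun y : ℝ => bernstein N k • ContinuousMap.const unitInterval y := by
    have h2 := ((continuous_const (y := bernstein N k)).mul
      (ContinuousMap.continuous_const' (X := unitInterval) (Y := ℝ)))
    exact h2
  exact h1.comp_stronglyMeasurable (hf _).stronglyMeasurable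

/-- The point `u / T` of the unit interval, for `0 ≤ u ≤ T`. -/
def pathPoint (T u : ℝ≥0) : unitInterval := projIcc 0 1 zero_le_one ((u : ℝ) / T)

theorem continuous_pathPoint (T : ℝ≥0) : Continuous (pathPoint T) :=
  continuous_projIcc.comp (NNReal.continuous_coe.div_const _)

theorem toNNReal_pathPoint_mul {T u : ℝ≥0} (hu : u ≤ T) :
    (pathPoint T u : ℝ).toNNReal * T = u := by
  rcases eq_or_ne T 0 with rfl | hT
  · rw [mul_zero, nonpos_iff_eq_zero.1 hu]
  · have hT' : (0 : ℝ) < T := NNReal.coe_pos.2 (pos_iff_ne_zero.2 hT)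
    have h1 : (u : ℝ) / T ∈ Icc (0 : ℝ) 1 :=
      ⟨by positivity, (div_le_one hT').2 (NNReal.coe_le_coe.2 hu)⟩
    rw [pathPoint, projIcc_of_mem _ h1, ← NNReal.coe_inj]
    push_cast
    rw [Real.coe_toNNReal _ h1.1, div_mul_cancel₀ _ hT'.ne']

variable {Ω : Type*} [mΩ : MeasurableSpace Ω] {n : ℕ} {P : Measure Ω} {F : Filtration ℝ≥0 mΩ}
  {c : Portfolio Ω n} {μ : ℝ≥0 → Ω → ℝ} {α₀ : ℝ} {g : ℝ → ℝ} {i : Fin n}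
  {t T : ℝ≥0} {Z : ℝ≥0 → Ω → ℝ} {C : ℝ}

/-- The deterministic weight process with a given path on `[0, T]`. -/
def pathWeight (Ω : Type*) (T : ℝ≥0) (f : C(unitInterval, ℝ)) (u : ℝ≥0) (_ : Ω) : ℝ :=
  f (pathPoint T u)

theorem isWeight_pathWeight (F : Filtration ℝ≥0 mΩ) (T : ℝ≥0) (f : C(unitInterval, ℝ)) :
    IsWeight F (pathWeight Ω T f) ‖f‖ where
  measurable := (f.continuous.comp (continuous_pathPoint T)).measurable.comp
    (@measurable_fst _ _ _ (sigmaAt F ∞))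
  bound u _ := f.norm_coe_le_norm (pathPoint T u)
  continuous _ := f.continuous.comp (continuous_pathPoint T)

/-- The paths of a weight process on `[0, T]`, as continuous functions on the unit interval. -/
def weightPath (hZ : IsWeight F Z C) (T : ℝ≥0) (ω : Ω) : C(unitInterval, ℝ) where
  toFun r := Z ((r : ℝ).toNNReal * T) ω
  continuous_toFun := (hZ.continuous ω).comp
    ((continuous_real_toNNReal.comp continuous_subtype_val).mul_const T)

namespace IsWeight

theorem measurable_apply (hZ : IsWeight F Z C) (u : ℝ≥0) : Measurable[sigmaAt F ∞] (Z u) :=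
  measurable_comp_prodMk (mβ := sigmaAt F ∞) hZ.measurable
    (@measurable_const _ _ _ (sigmaAt F ∞) u) (@measurable_id _ (sigmaAt F ∞))

theorem integrable_weightPath [IsProbabilityMeasure P] (hZ : IsWeight F Z C) (T : ℝ≥0) :
    Integrable (weightPath hZ T) P := by
  refine Integrable.of_bound (C := C) (stronglyMeasurable_continuousMap fun r =>
    (hZ.measurable_apply _).mono (sigmaAt_le F ∞) le_rfl).aestronglyMeasurable ?_
  refine Eventually.of_forall fun ω => (ContinuousMap.norm_le_of_nonempty _).2 fun r => ?_
  exact hZ.bound _ ω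

end IsWeight

namespace IsModel

theorem integrable_path (h : IsModel P F c μ α₀ g) (i : Fin n) (t T x : ℝ≥0)
    (f : C(unitInterval, ℝ)) :
    Integrable (fun u => f (pathPoint T u))
      ((h.shiftedMeanDev i x).measure.restrict (Ioc t T)) := by
  have hfin : (h.shiftedMeanDev i x).measure (Ioc t T) < ∞ := by
    rw [StieltjesFunction.measure_Ioc]
    exact ENNReal.ofReal_lt_top
  have : IsFiniteMeasure ((h.shiftedMeanDev i x).measure.restrict (Ioc t T)) :=
    ⟨by rwa [Measure.restrict_apply_univ]⟩
  exact Integrable.of_bound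
    (f.continuous.comp (continuous_pathPoint T)).measurable.aestronglyMeasurable ‖f‖
    (Eventually.of_forall fun u => f.norm_coe_le_norm _)

/-- Integration of paths on `(t, T]` with respect to `m̃(u - x)`. -/
def pathIntegral (h : IsModel P F c μ α₀ g) (i : Fin n) (t T x : ℝ≥0) :
    C(unitInterval, ℝ) →L[ℝ] ℝ :=
  LinearMap.mkContinuous
    { toFun f := ∫ u in Ioc t T, f (pathPoint T u) ∂(h.shiftedMeanDev i x).measure
      map_add' f₁ f₂ := integral_add (h.integrable_path i t T x f₁) (h.integrable_path i t T x f₂)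
      map_smul' a f := integral_const_mul a fun u => f (pathPoint T u) }
    ((h.shiftedMeanDev i x).measure.real (Ioc t T)) fun f => by
      rw [mul_comm]
      refine norm_setIntegral_le_of_norm_le_const ?_ fun u _ => f.norm_coe_le_norm _
      rw [StieltjesFunction.measure_Ioc]
      exact ENNReal.ofReal_lt_top

theorem pathIntegral_eq_devIntegral (h : IsModel P F c μ α₀ g) (i : Fin n) (t T x : ℝ≥0)
    (f : C(unitInterval, ℝ)) (ω : Ω) :
    h.pathIntegral i t T x f = h.devIntegral i (pathWeight Ω T f) t T x ω := rfl

theorem pathIntegral_weightPath (h : IsModel P F c μ α₀ g) (hZ : IsWeight F Z C) (x : ℝ≥0)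
    (ω : Ω) : h.pathIntegral i t T x (weightPath hZ T ω) = h.devIntegral i Z t T x ω := by
  refine setIntegral_congr_fun measurableSet_Ioc fun u hu => ?_
  change Z _ ω = Z u ω
  rw [toNNReal_pathPoint_mul hu.2]

theorem continuousWithinAt_pathIntegral [IsProbabilityMeasure P] (h : IsModel P F c μ α₀ g)
    (htT : t ≤ T) {x : ℝ≥0} (hx : x ≤ t) (f : C(unitInterval, ℝ)) (ω : Ω) :
    ContinuousWithinAt (fun y => h.pathIntegral i t T y f) (Iic x) x := by
  have hZ := isWeight_pathWeight (Ω := Ω) F T f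
  have h1 := h.tendsto_devMeanReal (i := i) (t := t) (T := T) hZ x ω
  rw [ContinuousWithinAt, h.pathIntegral_eq_devIntegral i t T x f ω, h.devIntegral_eq hZ hx htT]
  refine h1.congr' ?_
  filter_upwards [self_mem_nhdsWithin] with y hy
  rw [h.pathIntegral_eq_devIntegral i t T y f ω, h.devIntegral_eq hZ (le_trans hy hx) htT]

/-- The path of `Z` is conditioned once, as a random element of the Banach space of continuous
functions. For every `x`, integration against `m̃(· - x)` is a continuous linear functional, so it
commutes with the conditional expectation; applied to one fixed path it is left-continuous in `x`.
The development may be left out of the conditioning, being independent of the filtration and the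
first data. -/
theorem exists_isDevVersion [IsProbabilityMeasure P] (h : IsModel P F c μ α₀ g)
    (hZ : IsWeight F Z C) (htT : t ≤ T) : ∃ Φ, h.IsDevVersion i Z t T Φ := by
  have hacc : c.sigmaAccident i ≤ sigmaPre F c i :=
    measurable_iff_comap_le.1 (measurable_firstData_sigmaPre (F := F)).fst
  have hdelay : Measurable[sigmaPre F c i] (c.delay i) :=
    (measurable_firstData_sigmaPre (F := F)).snd.fst
  have hmark : Measurable[sigmaPre F c i] (c.firstMark i) :=
    (measurable_firstData_sigmaPre (F := F)).snd.snd
  have hfirst : c.sigmaFirst i ≤ sigmaPre F c i := by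
    refine iSup_le fun t => MeasurableSpace.generateFrom_le ?_
    rintro _ ⟨s, -, B, hB, rfl⟩
    exact (measurableSet_le measurable_firstReport_sigmaPre measurable_const).inter
      ((hdelay.prodMk hmark) hB)
  have hdevm : ∀ s, c.sigmaDev i s ≤ MeasurableSpace.comap (c.development i) inferInstance := by
    intro s
    have h1 : ∀ j, Measurable[MeasurableSpace.comap (c.development i) inferInstance]
        fun ω => (c.devTime i j ω, c.devMark i j ω) := fun j =>
      (measurable_pi_apply j).comp (comap_measurable (c.development i))
    exact naturalSigma_le fun s _ B hB j =>
      (measurableSet_le (h1 j).fst measurable_const).inter ((h1 j).snd hB)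
  have hdev : Measurable (c.development i) := measurable_pi_lambda _ fun j =>
    (h.measurable_devTime i j).prodMk (h.measurable_devMark i j)
  have hpre : c.sigmaFirst i ⊔ F t ≤ sigmaPre F c i :=
    sup_le hfirst ((le_sigmaAt_top F t).trans sigmaAt_le_sigmaPre)
  refine ⟨fun x ω => h.pathIntegral i t T x
    ((P[weightPath hZ T | c.sigmaFirst i ⊔ F t]) ω), fun x hx => ?_,
    Eventually.of_forall fun ω x hx => h.continuousWithinAt_pathIntegral htT hx _ ω⟩
  have hpath : (h.pathIntegral i t T x) ∘ weightPath hZ T = h.devIntegral i Z t T x :=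
    funext fun ω => h.pathIntegral_weightPath hZ x ω
  have h1 := (h.pathIntegral i t T x).comp_condExp_comm (m := c.sigmaFirst i ⊔ F t)
    (hZ.integrable_weightPath (P := P) T)
  rw [hpath] at h1
  have hD : h.devIntegral i Z t T x = devMeanReal P c i Z t T x :=
    funext fun ω => h.devIntegral_eq hZ hx htT ω
  have h2 := condExp_sup_ae_eq_of_indep hpre (h.sigmaPre_le i)
    ((hdevm (t - x)).trans hdev.comap_le)
    (indep_of_indep_of_le_right (h.indep_development i) (hdevm (t - x))).symm
    ((h.stronglyMeasurable_devMeanReal (i := i) (t := t) (T := T) hZ x).mono sigmaAt_le_sigmaPre)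
    (h.integrable_devMeanReal hZ (measurable_const (a := (x : ℝ≥0∞))))
  rw [sup_right_comm, hD]
  rw [hD] at h1
  exact h1.trans h2.symm

end IsModel

end Insurance

end

/-! ### Extension of the weight beyond T and assembly. -/

section
namespace Insurance

variable {Ω : Type*} [mΩ : MeasurableSpace Ω] {n : ℕ} {P : Measure Ω} {F : Filtration ℝ≥0 mΩ}
  {c : Portfolio Ω n} {μ : ℝ≥0 → Ω → ℝ} {α₀ : ℝ} {g : ℝ → ℝ} {i : Fin n}
  {t T : ℝ≥0} {Z : ℝ≥0 → Ω → ℝ} {C : ℝ}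

/-- The process `Z` stopped at the deterministic time `T`. -/
def stoppedWeight (T : ℝ≥0) (Z : ℝ≥0 → Ω → ℝ) (u : ℝ≥0) (ω : Ω) : ℝ := Z (min u T) ω

theorem stoppedWeight_of_le {Ω : Type*} {T : ℝ≥0} {Z : ℝ≥0 → Ω → ℝ} {u : ℝ≥0} (hu : u ≤ T) (ω : Ω) : stoppedWeight T Z u ω = Z u ω := by
  rw [stoppedWeight, min_eq_left hu]

/-- `Z` is controlled on `[0, T]` only; stopping extends its continuity and bound to all times.
Joint measurability then follows from continuity in time and measurability at each time. -/
theorem isWeight_stoppedWeight (hZ_adapted : ∀ u ≤ T, Measurable[F u] (Z u))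
    (hZ_continuous : ∀ ω, ContinuousOn (fun u => Z u ω) (Icc 0 T))
    (hZ_bounded : ∀ u ≤ T, ∀ ω, |Z u ω| ≤ C) : IsWeight F (stoppedWeight T Z) C := by
  have hc : ∀ ω, Continuous fun u => stoppedWeight T Z u ω := fun ω =>
    (hZ_continuous ω).comp_continuous (continuous_id.min continuous_const)
      fun u => ⟨zero_le, min_le_right u T⟩
  refine ⟨?_, fun u ω => hZ_bounded _ (min_le_right u T) ω, hc⟩
  exact measurable_uncurry_of_continuous_of_measurable (m := sigmaAt F ∞) hc fun u =>
    (hZ_adapted _ (min_le_right u T)).mono (le_sigmaAt_top F _) le_rfl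

theorem futurePayments_stoppedWeight {Ω : Type*} {c : Portfolio Ω n} {Z : ℝ≥0 → Ω → ℝ} :
    c.futurePayments i t T (stoppedWeight T Z) = c.futurePayments i t T Z := by
  funext ω
  refine tsum_congr fun j => ?_
  by_cases hω : (t : ℝ≥0∞) < c.reportTime i j ω ∧ c.reportTime i j ω ≤ T
  · rw [indicator_of_mem (by exact hω), indicator_of_mem (by exact hω),
      stoppedWeight_of_le (toNNReal_le_of_le_coe hω.2)]
  · rw [indicator_of_notMem (by exact hω), indicator_of_notMem (by exact hω)]

namespace IsModel

theorem devIntegral_stoppedWeight (h : IsModel P F c μ α₀ g) (t x : ℝ≥0) (ω : Ω) :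
    h.devIntegral i (stoppedWeight T Z) t T x ω = h.devIntegral i Z t T x ω :=
  setIntegral_congr_fun measurableSet_Ioc fun _ hu => stoppedWeight_of_le hu.2 ω

theorem reportIntegral_stoppedWeight (h : IsModel P F c μ α₀ g) (A : Ω → StieltjesFunction ℝ≥0) :
    h.reportIntegral i (stoppedWeight T Z) A t T = h.reportIntegral i Z A t T := by
  funext ω
  refine setIntegral_congr_fun measurableSet_Ioc fun u hu => ?_
  simp only [stoppedWeight_of_le hu.2, h.devIntegral_stoppedWeight]

theorem isDevVersion_stoppedWeight_iff (h : IsModel P F c μ α₀ g) {Φ : ℝ≥0 → Ω → ℝ} :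
    h.IsDevVersion i (stoppedWeight T Z) t T Φ ↔ h.IsDevVersion i Z t T Φ := by
  have h1 : ∀ x, h.devIntegral i (stoppedWeight T Z) t T x = h.devIntegral i Z t T x := fun x =>
    funext (h.devIntegral_stoppedWeight t x)
  constructor
  · rintro ⟨h2, h3⟩
    exact ⟨fun x hx => h1 x ▸ h2 x hx, h3⟩
  · rintro ⟨h2, h3⟩
    exact ⟨fun x hx => (h1 x).symm ▸ h2 x hx, h3⟩

/-- After the other policies have been discarded, the payments are split according to whether the
first report is known at time `t`; `condExp_early` and `condExp_late` treat the two summands. -/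
theorem condExp_futurePayments [IsProbabilityMeasure P] (h : IsModel P F c μ α₀ g)
    (hS : HasIndepDevIncrements P c i T) (htT : t ≤ T) (hZ : IsWeight F Z C) {Φ : ℝ≥0 → Ω → ℝ}
    {A : Ω → StieltjesFunction ℝ≥0} (hΦ : h.IsDevVersion i Z t T Φ)
    (hA : IsReportVersion P F c i A) :
    P[c.futurePayments i t T Z | sigmaGlobal F c t] =ᵐ[P] fun ω =>
      {ω' | c.firstReport i ω' ≤ t}.indicator
          (fun ω' => Φ (c.firstReport i ω').toNNReal ω') ω
        + {ω' | (t : ℝ≥0∞) < c.firstReport i ω'}.indicator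
          (fun ω' => (P[h.reportIntegral i Z A t T | F t]) ω'
            / (P⟦{ω'' | (t : ℝ≥0∞) < c.firstReport i ω''} | F t⟧) ω') ω := by
  have hint := h.integrable_paymentReal (i := i) (t := t) (T := T) hZ
  have hD : MeasurableSet {ω | c.firstReport i ω ≤ t} :=
    h.sigmaPolicy_le i t _ (c.measurableSet_firstReport_le i le_rfl)
  have hsplit : paymentReal c i Z t T
      = {ω | c.firstReport i ω ≤ t}.indicator (paymentReal c i Z t T)
        + {ω | (t : ℝ≥0∞) < c.firstReport i ω}.indicator (paymentReal c i Z t T) := by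
    rw [c.lt_firstReport_eq_compl, indicator_self_add_compl]
  have hadd := condExp_add (m := F t ⊔ c.sigmaPolicy i t) (hint.indicator hD)
    (hint.indicator (c.lt_firstReport_eq_compl i t ▸ hD.compl :
      MeasurableSet {ω | (t : ℝ≥0∞) < c.firstReport i ω}))
  rw [← hsplit] at hadd
  have hΦ' : ∀ x ≤ t, Φ x =ᵐ[P]
      P[devMeanReal P c i Z t T x | c.sigmaFirst i ⊔ c.sigmaDev i (t - x) ⊔ F t] := by
    intro x hx
    have h1 : h.devIntegral i Z t T x = devMeanReal P c i Z t T x :=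
      funext fun ω => h.devIntegral_eq hZ hx htT ω
    rw [← h1]
    exact hΦ.condExp x hx
  filter_upwards [condExp_congr_ae (m := sigmaGlobal F c t)
      (h.futurePayments_ae_eq (i := i) (t := t) (T := T) hZ),
    h.condExp_sigmaGlobal_ae_eq i t (stronglyMeasurable_paymentReal hZ) hint, hadd,
    h.condExp_early hS htT hZ hΦ' hΦ.left_continuous, h.condExp_late hZ,
    condExp_congr_ae (m := F t) (h.reportIntegral_ae_eq hZ htT hA)] with ω h1 h2 h3 h4 h5 h6
  rw [h1, h2, h3, Pi.add_apply, h4, h5]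
  congr 1
  by_cases hω : (t : ℝ≥0∞) < c.firstReport i ω
  · rw [indicator_of_mem (by exact hω), indicator_of_mem (by exact hω), h6]
  · rw [indicator_of_notMem (by exact hω), indicator_of_notMem (by exact hω)]

end IsModel

end Insurance

end

end

theorem mainTheorem1 {Ω : Type*} [mΩ : MeasurableSpace Ω] {n : ℕ}
    (P : Measure Ω) [IsProbabilityMeasure P] (F : Filtration ℝ≥0 mΩ)
    (c : Insurance.Portfolio Ω n) (μ : ℝ≥0 → Ω → ℝ) (α₀ : ℝ) (g : ℝ → ℝ)
    (h : Insurance.IsModel P F c μ α₀ g) (i : Fin n)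
    (t T : ℝ≥0) (htT : t ≤ T) (Z : ℝ≥0 → Ω → ℝ)
    (hZ_adapted : ∀ u ≤ T, Measurable[F u] (Z u))
    (hZ_continuous : ∀ ω, ContinuousOn (fun u => Z u ω) (Icc 0 T))
    (hZ_bounded : ∃ C : ℝ, ∀ u ≤ T, ∀ ω, |Z u ω| ≤ C)
    (hS : Insurance.HasIndepDevIncrements P c i T) :
    Integrable (c.futurePayments i t T Z) P ∧
    (∃ Φ, h.IsDevVersion i Z t T Φ) ∧
    (∃ A, Insurance.IsReportVersion P F c i A ∧
      ∀ᵐ ω ∂P, ∀ s : ℝ≥0, A ω s = Insurance.explicitReportProb μ α₀ g s ω) ∧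
    (∀ x ≤ t, Integrable (h.devIntegral i Z t T x) P) ∧
    (∀ A, Insurance.IsReportVersion P F c i A → Integrable (h.reportIntegral i Z A t T) P) ∧
    (∀ Φ A, h.IsDevVersion i Z t T Φ → Insurance.IsReportVersion P F c i A →
      P[c.futurePayments i t T Z | Insurance.sigmaGlobal F c t] =ᵐ[P] fun ω =>
        {ω' | c.firstReport i ω' ≤ t}.indicator
            (fun ω' => Φ (c.firstReport i ω').toNNReal ω') ω
          + {ω' | (t : ℝ≥0∞) < c.firstReport i ω'}.indicator
            (fun ω' => (P[h.reportIntegral i Z A t T | F t]) ω'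
              / (P⟦{ω'' | (t : ℝ≥0∞) < c.firstReport i ω''} | F t⟧) ω') ω) ∧
    (∀ s : ℝ≥0, P⟦{ω | c.firstReport i ω ≤ s} | F s⟧
      =ᵐ[P] Insurance.explicitReportProb μ α₀ g s) := by
  obtain ⟨C, hC⟩ := hZ_bounded
  -- Every quantity in the statement uses `Z` on `[0, T]` only, so `Z` may be replaced by its
  -- stopped version.
  have hW := Insurance.isWeight_stoppedWeight hZ_adapted hZ_continuous hC
  refine ⟨?_, ?_, h.exists_isReportVersion i, fun x hx => ?_, fun A hA => ?_,
    fun Φ A hΦ hA => ?_, h.condExp_firstReport_explicit i⟩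
  · rw [← Insurance.futurePayments_stoppedWeight]
    exact (integrable_congr (h.futurePayments_ae_eq hW)).2 (h.integrable_paymentReal hW)
  · obtain ⟨Φ, hΦ⟩ := h.exists_isDevVersion (i := i) hW htT
    exact ⟨Φ, h.isDevVersion_stoppedWeight_iff.1 hΦ⟩
  · have h1 : h.devIntegral i Z t T x
        = Insurance.devMeanReal P c i (Insurance.stoppedWeight T Z) t T x := funext fun ω => by
      rw [← h.devIntegral_eq hW hx htT ω, h.devIntegral_stoppedWeight]
    rw [h1]
    exact h.integrable_devMeanReal hW (measurable_const (a := (x : ℝ≥0∞)))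
  · rw [← h.reportIntegral_stoppedWeight]
    exact (integrable_congr (h.reportIntegral_ae_eq hW htT hA)).2 (h.integrable_reportMeanReal hW)
  · rw [← Insurance.futurePayments_stoppedWeight, ← h.reportIntegral_stoppedWeight]
    exact h.condExp_futurePayments hS htT hW (h.isDevVersion_stoppedWeight_iff.2 hΦ) hA
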